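/- **Notation.** Let $0<x<1$, $0<s<2$, and let $r,k\in\mathbb R$ with $r>0$, $r-k>0$, $k\neq0$. Write $z_i=x^{2u_i}$, $z_i^c=x^{2u_ic}$, $[a]=\frac{x^a-x^{-a}}{x-x^{-1}}$, $[a]_+=x^a+x^{-a}$, $(z;q)_\infty=\prod_{j\ge0}(1-q^jz)$, $\Theta_q(z)=(q;q)_\infty(z;q)_\infty(q/z;q)_\infty$, $\delta(z)=\sum_{n\in\mathbb Z}z^n$, and $$[u]_t=x^{\frac{u^2}{t}-u}\,\frac{\Theta_{x^{2t}}(x^{2u})}{(x^{2t};x^{2t})_\infty^3}\qquad(t>0).$$ **Bosons.** Let $\alpha_m^j,\widetilde\alpha_m^j,\beta_m^j,\gamma_m^j$ ($j=1,2$, $m\in\mathbb Z\setminus\{0\}$) have central commutators $[a_m,b_n]=c_{a,b}(m)\,\delta_{m+n,0}$ where, with $S_m=[sm]+[(s-2)m]$ and $D_m=[sm]-[(s-2)m]$, $$c_{\alpha^j,\alpha^j}=-\frac{[2m][rm]}{m[km][(r-k)m]},\qquad c_{\alpha^1,\alpha^2}=\frac1m\Big(\frac{x^{(k-r)m}D_m}{[(r-k)m]}+\frac{x^{km}S_m}{[km]}\Big),$$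 $$c_{\widetilde\alpha^j,\widetilde\alpha^j}=-\frac{[2m][(r-k)m]}{m[km][rm]},\qquad c_{\widetilde\alpha^1,\widetilde\alpha^2}=\frac1m\Big(-\frac{x^{rm}D_m}{[rm]}+\frac{x^{km}S_m}{[km]}\Big),$$ $$c_{\alpha^j,\widetilde\alpha^j}=-\frac{[2m]}{m[km]},\qquad c_{\alpha^1,\widetilde\alpha^2}=c_{\widetilde\alpha^1,\alpha^2}=\frac{S_m}{m[km]},$$ $$c_{\beta^j,\beta^j}=\frac{[2m][(k+2)m]}{m},\quad c_{\beta^1,\beta^2}=-\frac{[(k+2)m]S_m}{m},\quad c_{\gamma^j,\gamma^j}=\frac{[2m]}{m[km]},\quad c_{\gamma^1,\gamma^2}=-\frac{S_m}{m[km]},$$ the other orders being given by antisymmetry of the bracket and all remaining commutators being zero. The zero modes satisfy $[P_0,iQ_0]=1$, $[h,\alpha]=2$, $[h_0,\alpha_0]=[h_1,\alpha_2]=[h_2,\alpha_1]=2-s$, all other brackets vanishing. They act on the Fock space $\mathcal F=\bigoplus \mathbb C[\alpha^j_{-m},\widetilde\alpha^j_{-m},\beta^j_{-m},\gamma^j_{-m}:\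 j=1,2,\ m>0]\otimes e^{p\,iQ_0}\otimes e^{n\alpha}\otimes e^{n_0\alpha_0}\otimes e^{n_1\alpha_1}\otimes e^{n_2\alpha_2}$ (sum over all $p\in\mathbb C$ and $n,n_0,n_1,n_2\in\mathbb Z$), where the modes with $m>0$ and the operators $P_0,h,h_0,h_1,h_2$ annihilate the vacuum $p=n=n_0=n_1=n_2=0$ (and the modes with $m>0$ annihilate every $e^{p\,iQ_0}\otimes e^{n\alpha}\otimes\cdots\otimes e^{n_2\alpha_2}$). **Currents.** Put $\varepsilon_1=1$, $\varepsilon_2=-1$, $\zeta=\sqrt{\tfrac{2r}{k(r-k)}}$, $\widetilde\zeta=\sqrt{\tfrac{2(r-k)}{kr}}$ (principal values) and $$C_j(z)=e^{-\varepsilon_j\zeta iQ_0}e^{-\varepsilon_j\zeta P_0\log z}:\!e^{-\sum_{m\ne0}\alpha^j_mz^{-m}}\!:,\qquad C_j^\dagger(z)=e^{\varepsilon_j\widetilde\zeta iQ_0}e^{\varepsilon_j\widetilde\zeta P_0\log z}:\!e^{\sum_{m\ne0}\widetilde\alpha^j_mz^{-m}}\!:.$$ With all sums over $m>0$ put $$\Psi_{j,I}(z)=e^{-(x-x^{-1})\sum\frac{x^{km/2}}{[m]_+}\beta^j_mz^{-m}}\,e^{-\sum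 x^{-km/2}\gamma^j_{-m}z^m}\,e^{-\sum x^{km/2}\frac{[(k+1)m]_+}{[m]_+}\gamma^j_mz^{-m}}\,e^{\varepsilon_j(\alpha+\alpha_0)+\alpha_j}\,x^{\varepsilon_j\frac h2+h_0+h_j}\,z^{-\varepsilon_j\frac hk},$$ $$\Psi_{j,II}(z)=e^{(x-x^{-1})\sum\frac{x^{km/2}}{[m]_+}\beta^j_{-m}z^{m}}\,e^{-\sum x^{km/2}\frac{[(k+1)m]_+}{[m]_+}\gamma^j_{-m}z^m}\,e^{-\sum x^{-km/2}\gamma^j_mz^{-m}}\,e^{\varepsilon_j(\alpha+\alpha_0)+\alpha_j}\,x^{-\varepsilon_j\frac h2+h_0-h_j}\,z^{-\varepsilon_j\frac hk},$$ $$\Psi^\dagger_{j,I}(z)=e^{(x-x^{-1})\sum\frac{x^{-km/2}}{[m]_+}\beta^j_mz^{-m}}\,e^{\sum x^{km/2}\gamma^j_{-m}z^m}\,e^{\sum x^{-km/2}\frac{[(k+1)m]_+}{[m]_+}\gamma^j_mz^{-m}}\,e^{-\varepsilon_j(\alpha+\alpha_0)+\alpha_j}\,x^{\varepsilon_j\frac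 h2-h_0-h_j}\,z^{\varepsilon_j\frac hk},$$ $$\Psi^\dagger_{j,II}(z)=e^{-(x-x^{-1})\sum\frac{x^{-km/2}}{[m]_+}\beta^j_{-m}z^{m}}\,e^{\sum x^{-km/2}\frac{[(k+1)m]_+}{[m]_+}\gamma^j_{-m}z^m}\,e^{\sum x^{km/2}\gamma^j_mz^{-m}}\,e^{-\varepsilon_j(\alpha+\alpha_0)+\alpha_j}\,x^{-\varepsilon_j\frac h2-h_0+h_j}\,z^{\varepsilon_j\frac hk},$$ $$\Psi_j=\frac{\Psi_{j,I}-\Psi_{j,II}}{x-x^{-1}},\quad \Psi_j^\dagger=-\frac{\Psi^\dagger_{j,I}-\Psi^\dagger_{j,II}}{x-x^{-1}},\quad E_j(z)=C_j(z)\Psi_j(z),\quad F_j(z)=C_j^\dagger(z)\Psi_j^\dagger(z)\qquad(j=1,2).$$ **Proposition.** (1) In the sense of analytic continuation of matrix elements, for $j=1,2$, $$[u_1-u_2]_{r-k}[u_1-u_2-1]_{r-k}E_j(z_1)E_j(z_2)=[u_2-u_1]_{r-k}[u_2-u_1-1]_{r-k}E_j(z_2)E_j(z_1),$$ $$[u_1-u_2+\tfrac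 s2]_{r-k}[u_1-u_2-\tfrac s2+1]_{r-k}E_1(z_1)E_2(z_2)=[u_2-u_1+\tfrac s2]_{r-k}[u_2-u_1-\tfrac s2+1]_{r-k}E_2(z_2)E_1(z_1),$$ $$[u_1-u_2]_{r}[u_1-u_2+1]_{r}F_j(z_1)F_j(z_2)=[u_2-u_1]_{r}[u_2-u_1+1]_{r}F_j(z_2)F_j(z_1),$$ $$[u_1-u_2-\tfrac s2]_{r}[u_1-u_2+\tfrac s2-1]_{r}F_1(z_1)F_2(z_2)=[u_2-u_1-\tfrac s2]_{r}[u_2-u_1+\tfrac s2-1]_{r}F_2(z_2)F_1(z_1).$$ Here a relation $L(u_1,u_2)A(z_1)B(z_2)=R(u_1,u_2)B(z_2)A(z_1)$ means: for some $\rho>0$, the series of every matrix element of $A(z_1)B(z_2)$ converges absolutely for $|z_2|<\rho|z_1|$, that of $B(z_2)A(z_1)$ converges absolutely for $|z_1|<\rho|z_2|$, and the two sides are the restrictions to these two regions of one meromorphic function of $(u_1,u_2)\in\mathbb C^2$, a quotient of entire functions whose denominator can be chosen independently of the matrix element. (2) As an identity of formal series in $z_1,z_2$ (with complex exponents) with operator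 coefficients, for $j=1,2$, $$[E_j(z_1),F_j(z_2)]=\frac{x^{(-1)^{j-1}(s-2)}}{x-x^{-1}}\Big(:\!C_j(z_1)C_j^\dagger(z_2)\Psi_{j,I}(z_1)\Psi_{j,I}^\dagger(z_2)\!:\,\delta\Big(\frac{x^kz_2}{z_1}\Big)-:\!C_j(z_1)C_j^\dagger(z_2)\Psi_{j,II}(z_1)\Psi_{j,II}^\dagger(z_2)\!:\,\delta\Big(\frac{x^{-k}z_2}{z_1}\Big)\Big).$$ In normally ordered products, creation modes stand to the left of annihilation modes, and the exponentials of $iQ_0,\alpha,\alpha_0,\alpha_1,\alpha_2$ to the left of the powers of $x$ and $z_i$. -/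

import Mathlib

noncomputable section

namespace LevelK

/-! ### Parameters and theta functions -/

/-- The parameters: `x` (base), `r` (elliptic parameter), `k` (level), `s` (deformation). -/
structure Params where
  x : ℝ
  r : ℝ
  k : ℝ
  s : ℝ

/-- `(z ; q)_∞ = ∏_{j ≥ 0} (1 - q^j z)`. -/
def qPoch (z q : ℂ) : ℂ := ∏' j : ℕ, (1 - q ^ j * z)

/-- `Θ_q(z) = (q;q)_∞ (z;q)_∞ (q/z;q)_∞`. -/
def bigTheta (q z : ℂ) : ℂ := qPoch q q * qPoch z q * qPoch (q / z) q

/-- The function `z^c` for `z = x^{2u}`, that is `x^{2uc}`. -/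
def zPow (x : ℝ) (u c : ℂ) : ℂ := (x : ℂ) ^ (2 * u * c)

/-- The theta function `[u]_t = x^{u²/t - u} Θ_{x^{2t}}(x^{2u}) / (x^{2t};x^{2t})_∞³`. -/
def theta (x t : ℝ) (u : ℂ) : ℂ :=
  (x : ℂ) ^ (u ^ 2 / t - u) * bigTheta ((x ^ (2 * t) : ℝ) : ℂ) ((x : ℂ) ^ (2 * u)) /
    qPoch ((x ^ (2 * t) : ℝ) : ℂ) ((x ^ (2 * t) : ℝ) : ℂ) ^ 3

/-- The `q`-integer `[a] = (x^a - x^{-a}) / (x - x^{-1})`. -/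
def qInt (x a : ℝ) : ℝ := (x ^ a - x ^ (-a)) / (x - x⁻¹)

/-- `[a]_+ = x^a + x^{-a}`. -/
def qPlus (x a : ℝ) : ℝ := x ^ a + x ^ (-a)

/-! ### The bosons -/

/-- The four kinds of bosons `α`, `α̃`, `β`, `γ`. -/
inductive Boson
  | alpha
  | alphaT
  | beta
  | gamma
  deriving DecidableEq

instance : Fintype Boson := ⟨{.alpha, .alphaT, .beta, .gamma}, by intro b; cases b <;> simp⟩

/-- A family of bosons: a kind together with the upper index `j`; the elements `0` and `1` of
`Fin 2` stand for `j = 1` and `j = 2`. -/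
abbrev Species := Boson × Fin 2

/-- From the commutators for `i = j` (`f`) and for `(i, j) = (1, 2)` (`g`) of two boson families of
the same kind, `[a_m^i, a_{-m}^j] = sameKind f g i j m`; the case `(2, 1)` is forced by
antisymmetry of the bracket. -/
def sameKind (f g : ℤ → ℝ) (i j : Fin 2) (m : ℤ) : ℝ :=
  if i = j then f m else if i < j then g m else -(g (-m))

/-- The scalars in `[a_m, b_n] = bosonComm a b m · δ_{m+n,0}` (`m ≠ 0`). -/
def bosonComm (P : Params) : Species → Species → ℤ → ℝ
  | (.alpha, i), (.alpha, j), m =>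
      sameKind
        (fun m => -(1 / m) * (qInt P.x (2 * m) * qInt P.x (P.r * m)) /
          (qInt P.x (P.k * m) * qInt P.x ((P.r - P.k) * m)))
        (fun m => 1 / m *
          (P.x ^ ((-P.r + P.k) * m) * (qInt P.x (P.s * m) - qInt P.x ((P.s - 2) * m)) /
              qInt P.x ((P.r - P.k) * m)
            + P.x ^ (P.k * m) * (qInt P.x (P.s * m) + qInt P.x ((P.s - 2) * m)) /
              qInt P.x (P.k * m)))
        i j m
  | (.alphaT, i), (.alphaT, j), m =>
      sameKind
        (fun m => -(1 / m) * (qInt P.x (2 * m) * qInt P.x ((P.r - P.k) * m)) /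
          (qInt P.x (P.k * m) * qInt P.x (P.r * m)))
        (fun m => 1 / m *
          (P.x ^ (P.r * m) * (-qInt P.x (P.s * m) + qInt P.x ((P.s - 2) * m)) /
              qInt P.x (P.r * m)
            + P.x ^ (P.k * m) * (qInt P.x (P.s * m) + qInt P.x ((P.s - 2) * m)) /
              qInt P.x (P.k * m)))
        i j m
  | (.alpha, i), (.alphaT, j), m =>
      if i = j then -(1 / m) * (qInt P.x (2 * m) / qInt P.x (P.k * m))
      else 1 / m * ((qInt P.x (P.s * m) + qInt P.x ((P.s - 2) * m)) / qInt P.x (P.k * m))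
  | (.alphaT, i), (.alpha, j), m =>
      if i = j then -(1 / m) * (qInt P.x (2 * m) / qInt P.x (P.k * m))
      else 1 / m * ((qInt P.x (P.s * m) + qInt P.x ((P.s - 2) * m)) / qInt P.x (P.k * m))
  | (.beta, i), (.beta, j), m =>
      sameKind
        (fun m => qInt P.x (2 * m) * qInt P.x ((P.k + 2) * m) / m)
        (fun m => -(qInt P.x ((P.k + 2) * m) *
          (qInt P.x (P.s * m) + qInt P.x ((P.s - 2) * m)) / m))
        i j m
  | (.gamma, i), (.gamma, j), m =>
      sameKind
        (fun m => 1 / m * (qInt P.x (2 * m) / qInt P.x (P.k * m)))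
        (fun m => -(1 / m) *
          ((qInt P.x (P.s * m) + qInt P.x ((P.s - 2) * m)) / qInt P.x (P.k * m)))
        i j m
  | _, _, _ => 0

/-! ### The Fock space -/

/-- Zero-mode charges. The charge `⟨p, n, n₀, n₁, n₂⟩` labels the vacuum
`e^{p iQ₀} ⊗ e^{nα} ⊗ e^{n₀α₀} ⊗ e^{n₁α₁} ⊗ e^{n₂α₂}`. All momenta `p` are allowed. -/
@[ext]
structure Charge where
  p : ℂ
  n : ℤ
  n₀ : ℤ
  n₁ : ℤ
  n₂ : ℤ

instance : Add Charge :=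
  ⟨fun a b => ⟨a.p + b.p, a.n + b.n, a.n₀ + b.n₀, a.n₁ + b.n₁, a.n₂ + b.n₂⟩⟩

/-- The creation operators `a_{-m}`, `m > 0`, freely generating the oscillator part. -/
abbrev Osc := Species × ℕ+

/-- The Fock space: the direct sum over all charges of polynomials in the creation operators. -/
abbrev Fock := Charge →₀ MvPolynomial Osc ℂ

/-- The coefficient of a Fock vector at the basis vector with charge `q` and monomial `μ`. -/
def Fock.coeff (q : Charge) (μ : Osc →₀ ℕ) (v : Fock) : ℂ := MvPolynomial.coeff μ (v q)

/-- The boson `a_m` on the Fock space: for `m < 0` multiplication by the generator, for `m > 0`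
the derivation `b_{-m} ↦ [a_m, b_{-m}]` annihilating the vacua. -/
def mode (P : Params) (a : Species) (m : ℤ) : Module.End ℂ Fock :=
  if h : m < 0 then
    Finsupp.mapRange.linearMap
      (LinearMap.mulLeft ℂ (MvPolynomial.X (a, ⟨(-m).toNat, by omega⟩) : MvPolynomial Osc ℂ))
  else if 0 < m then
    Finsupp.mapRange.linearMap
      (MvPolynomial.mkDerivation ℂ (fun b : Osc =>
        if (b.2 : ℤ) = m then MvPolynomial.C ((bosonComm P a b.1 m : ℝ) : ℂ) else 0) :
          Derivation ℂ (MvPolynomial Osc ℂ) (MvPolynomial Osc ℂ)).toLinearMap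
  else 0

/-! Eigenvalues of `h, h₀, h₁, h₂` on a charge: `[h, α] = 2`,
`[h₀, α₀] = [h₁, α₂] = [h₂, α₁] = 2 - s`, all other such brackets vanish. The eigenvalue of `P₀`
is `p`, as `[P₀, iQ₀] = 1`. -/

def hEig (q : Charge) : ℝ := 2 * q.n

def h0Eig (P : Params) (q : Charge) : ℝ := (2 - P.s) * q.n₀

/-- The eigenvalue of `h_j`. -/
def hjEig (P : Params) (j : Fin 2) (q : Charge) : ℝ :=
  if j = 0 then (2 - P.s) * q.n₂ else (2 - P.s) * q.n₁

/-! ### Currents and vertex operators -/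

/-- A current `A(z) = ∑_c A_c z^c` with complex exponents `c`, given by its modes `A_c`. -/
abbrev Current := ℂ → Fock → Fock

/-- The product `A(z) B(z)` at the same point (used where it is a finite sum on every vector). -/
def Current.mul (A B : Current) : Current := fun c v => ∑ᶠ d : ℂ, A (c - d) (B d v)

/-- The data of a normally ordered exponential
`exp(∑_{m>0} ∑_a cre a m · a_{-m} z^m) exp(∑_{m>0} ∑_a ann a m · a_m z^{-m}) e^{shift} x^{X} z^{Z}`,
where `X`, `Z` are linear combinations of `P₀, h, h₀, h₁, h₂`, given by their eigenvalues `xExp`,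
`zExp` on a charge. -/
structure Vertex where
  cre : Species → ℕ → ℝ
  ann : Species → ℕ → ℝ
  shift : Charge
  xExp : Charge → ℝ
  zExp : Charge → ℂ

/-- The coefficient of `t^n` in `exp(∑_{m>0} A_m t^m)`. -/
def expCoeff (A : ℕ → Module.End ℂ Fock) (n : ℕ) : Module.End ℂ Fock :=
  ∑ i ∈ Finset.range (n + 1), ((i.factorial : ℂ)⁻¹) •
    PowerSeries.coeff n ((PowerSeries.mk fun m => if m = 0 then 0 else A m) ^ i)

namespace Vertex

/-- Coefficient of `z^n` in the creation exponential. -/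
def creCoeff (P : Params) (V : Vertex) : ℕ → Module.End ℂ Fock :=
  expCoeff fun m => ∑ b : Boson, ∑ j : Fin 2, ((V.cre (b, j) m : ℝ) : ℂ) • mode P (b, j) (-m)

/-- Coefficient of `z^{-n}` in the annihilation exponential. -/
def annCoeff (P : Params) (V : Vertex) : ℕ → Module.End ℂ Fock :=
  expCoeff fun m => ∑ b : Boson, ∑ j : Fin 2, ((V.ann (b, j) m : ℝ) : ℂ) • mode P (b, j) m

/-- Coefficient of `z^c` in `e^{shift} x^{X} z^{Z}`. -/
def zeroMode (P : Params) (V : Vertex) (c : ℂ) : Module.End ℂ Fock :=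
  Finsupp.lsum ℂ fun q =>
    if V.zExp q = c then ((P.x ^ V.xExp q : ℝ) : ℂ) • Finsupp.lsingle (q + V.shift) else 0

/-- The vertex operator of the given data (a finite sum on every vector). -/
def toCurrent (P : Params) (V : Vertex) : Current := fun c v =>
  ∑ᶠ nm : ℕ × ℕ,
    V.creCoeff P nm.1 (V.annCoeff P nm.2 (V.zeroMode P (c - nm.1 + nm.2) v))

/-- The data of the normally ordered product of two exponentials at the same point. -/
def join (V W : Vertex) : Vertex where
  cre a m := V.cre a m + W.cre a m
  ann a m := V.ann a m + W.ann a m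
  shift := V.shift + W.shift
  xExp q := V.xExp q + W.xExp q
  zExp q := V.zExp q + W.zExp q

/-- Coefficient of `z₁^c z₂^d` in the zero-mode part
`e^{shift_V + shift_W} x^{X_V + X_W} z₁^{Z_V} z₂^{Z_W}` of `:V(z₁) W(z₂):`. -/
def zeroMode₂ (P : Params) (V W : Vertex) (c d : ℂ) : Module.End ℂ Fock :=
  Finsupp.lsum ℂ fun q =>
    if V.zExp q = c ∧ W.zExp q = d then
      ((P.x ^ (V.xExp q + W.xExp q) : ℝ) : ℂ) • Finsupp.lsingle (q + (V.shift + W.shift))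
    else 0

/-- Coefficient of `z₁^c z₂^d` in the normally ordered product `:V(z₁) W(z₂):`
(a finite sum on every vector). -/
def normalOrdered (P : Params) (V W : Vertex) (c d : ℂ) (v : Fock) : Fock :=
  ∑ᶠ nm : (ℕ × ℕ) × (ℕ × ℕ),
    V.creCoeff P nm.1.1 (W.creCoeff P nm.2.1
      (V.annCoeff P nm.1.2 (W.annCoeff P nm.2.2
        (zeroMode₂ P V W (c - nm.1.1 + nm.1.2) (d - nm.2.1 + nm.2.2) v))))

end Vertex

/-! ### The currents `C_j`, `C_j†`, `Ψ_j`, `Ψ_j†`, `E_j`, `F_j` -/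

/-- `ε_1 = 1`, `ε_2 = -1`. -/
def eps (j : Fin 2) : ℤ := if j = 0 then 1 else -1

/-- `√(2r / (k(r-k)))` (principal value if `k < 0`). -/
def zeta (P : Params) : ℂ := ((2 * P.r / (P.k * (P.r - P.k)) : ℝ) : ℂ) ^ (1 / 2 : ℂ)

/-- `√(2(r-k) / (kr))` (principal value if `k < 0`). -/
def zetaT (P : Params) : ℂ := ((2 * (P.r - P.k) / (P.k * P.r) : ℝ) : ℂ) ^ (1 / 2 : ℂ)

/-- `C_j(z) = e^{-ε_j ζ iQ₀} e^{-ε_j ζ P₀ log z} :exp(-∑_{m≠0} α_m^j z^{-m}):`. -/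
def cVertex (P : Params) (j : Fin 2) : Vertex where
  cre a _ := if a = (.alpha, j) then -1 else 0
  ann a _ := if a = (.alpha, j) then -1 else 0
  shift := ⟨-eps j * zeta P, 0, 0, 0, 0⟩
  xExp _ := 0
  zExp q := -eps j * zeta P * q.p

/-- `C_j†(z) = e^{ε_j ζ̃ iQ₀} e^{ε_j ζ̃ P₀ log z} :exp(∑_{m≠0} α̃_m^j z^{-m}):`. -/
def cDagVertex (P : Params) (j : Fin 2) : Vertex where
  cre a _ := if a = (.alphaT, j) then 1 else 0
  ann a _ := if a = (.alphaT, j) then 1 else 0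
  shift := ⟨eps j * zetaT P, 0, 0, 0, 0⟩
  xExp _ := 0
  zExp q := eps j * zetaT P * q.p

/-- `Ψ_{j,I}(z)`, with zero modes `e^{ε(α+α₀)+α_j} x^{ε h/2 + h₀ + h_j} z^{-ε h/k}`, `ε = ε_j`. -/
def psiI (P : Params) (j : Fin 2) : Vertex where
  cre a m := if a = (.gamma, j) then -P.x ^ (-(P.k * m / 2)) else 0
  ann a m :=
    if a = (.beta, j) then -(P.x - P.x⁻¹) * (P.x ^ (P.k * m / 2) / qPlus P.x m)
    else if a = (.gamma, j) then
      -(P.x ^ (P.k * m / 2) * (qPlus P.x ((P.k + 1) * m) / qPlus P.x m))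
    else 0
  shift := ⟨0, eps j, eps j, if j = 0 then 1 else 0, if j = 1 then 1 else 0⟩
  xExp q := eps j * (hEig q / 2) + h0Eig P q + hjEig P j q
  zExp q := -eps j * (hEig q / P.k)

/-- `Ψ_{j,II}(z)`, with zero modes `e^{ε(α+α₀)+α_j} x^{-ε h/2 + h₀ - h_j} z^{-ε h/k}`. -/
def psiII (P : Params) (j : Fin 2) : Vertex where
  cre a m :=
    if a = (.beta, j) then (P.x - P.x⁻¹) * (P.x ^ (P.k * m / 2) / qPlus P.x m)
    else if a = (.gamma, j) then
      -(P.x ^ (P.k * m / 2) * (qPlus P.x ((P.k + 1) * m) / qPlus P.x m))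
    else 0
  ann a m := if a = (.gamma, j) then -P.x ^ (-(P.k * m / 2)) else 0
  shift := ⟨0, eps j, eps j, if j = 0 then 1 else 0, if j = 1 then 1 else 0⟩
  xExp q := -eps j * (hEig q / 2) + h0Eig P q - hjEig P j q
  zExp q := -eps j * (hEig q / P.k)

/-- `Ψ_{j,I}†(z)`, with zero modes `e^{-ε(α+α₀)+α_j} x^{ε h/2 - h₀ - h_j} z^{ε h/k}`. -/
def psiDagI (P : Params) (j : Fin 2) : Vertex where
  cre a m := if a = (.gamma, j) then P.x ^ (P.k * m / 2) else 0
  ann a m :=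
    if a = (.beta, j) then (P.x - P.x⁻¹) * (P.x ^ (-(P.k * m / 2)) / qPlus P.x m)
    else if a = (.gamma, j) then
      P.x ^ (-(P.k * m / 2)) * (qPlus P.x ((P.k + 1) * m) / qPlus P.x m)
    else 0
  shift := ⟨0, -eps j, -eps j, if j = 0 then 1 else 0, if j = 1 then 1 else 0⟩
  xExp q := eps j * (hEig q / 2) - h0Eig P q - hjEig P j q
  zExp q := eps j * (hEig q / P.k)

/-- `Ψ_{j,II}†(z)`, with zero modes `e^{-ε(α+α₀)+α_j} x^{-ε h/2 - h₀ + h_j} z^{ε h/k}`. -/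
def psiDagII (P : Params) (j : Fin 2) : Vertex where
  cre a m :=
    if a = (.beta, j) then -(P.x - P.x⁻¹) * (P.x ^ (-(P.k * m / 2)) / qPlus P.x m)
    else if a = (.gamma, j) then
      P.x ^ (-(P.k * m / 2)) * (qPlus P.x ((P.k + 1) * m) / qPlus P.x m)
    else 0
  ann a m := if a = (.gamma, j) then P.x ^ (P.k * m / 2) else 0
  shift := ⟨0, -eps j, -eps j, if j = 0 then 1 else 0, if j = 1 then 1 else 0⟩
  xExp q := -eps j * (hEig q / 2) - h0Eig P q + hjEig P j q
  zExp q := eps j * (hEig q / P.k)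

/-- `Ψ_j(z) = (Ψ_{j,I}(z) - Ψ_{j,II}(z)) / (x - x^{-1})`. -/
def psi (P : Params) (j : Fin 2) : Current := fun c v =>
  (1 / ((P.x - P.x⁻¹ : ℝ) : ℂ)) •
    ((psiI P j).toCurrent P c v - (psiII P j).toCurrent P c v)

/-- `Ψ_j†(z) = -(Ψ_{j,I}†(z) - Ψ_{j,II}†(z)) / (x - x^{-1})`. -/
def psiDag (P : Params) (j : Fin 2) : Current := fun c v =>
  (-1 / ((P.x - P.x⁻¹ : ℝ) : ℂ)) •
    ((psiDagI P j).toCurrent P c v - (psiDagII P j).toCurrent P c v)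

/-- `E_j(z) = C_j(z) Ψ_j(z)`. -/
def currentE (P : Params) (j : Fin 2) : Current :=
  ((cVertex P j).toCurrent P).mul (psi P j)

/-- `F_j(z) = C_j†(z) Ψ_j†(z)`. -/
def currentF (P : Params) (j : Fin 2) : Current :=
  ((cDagVertex P j).toCurrent P).mul (psiDag P j)

/-- Coefficients of `:C_j(z₁) C_j†(z₂) Ψ_{j,I}(z₁) Ψ_{j,I}†(z₂):`. -/
def normalI (P : Params) (j : Fin 2) : ℂ → ℂ → Fock → Fock :=
  Vertex.normalOrdered P ((cVertex P j).join (psiI P j)) ((cDagVertex P j).join (psiDagI P j))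

/-- Coefficients of `:C_j(z₁) C_j†(z₂) Ψ_{j,II}(z₁) Ψ_{j,II}†(z₂):`. -/
def normalII (P : Params) (j : Fin 2) : ℂ → ℂ → Fock → Fock :=
  Vertex.normalOrdered P ((cVertex P j).join (psiII P j)) ((cDagVertex P j).join (psiDagII P j))

/-! ### Meaning of the relations -/

/-- Coefficient of `z₁^c z₂^d` in `N(z₁, z₂) δ(y z₂ / z₁)`, where `δ(z) = ∑_{n ∈ ℤ} z^n`
(a finite sum on every vector for normally ordered `N`). -/
def mulDelta (N : ℂ → ℂ → Fock → Fock) (y : ℝ) (c d : ℂ) (v : Fock) : Fock :=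
  ∑ᶠ n : ℤ, ((y ^ n : ℝ) : ℂ) • N (c + n) (d - n) v

/-- The relation `L(u₁, u₂) A(z₁) B(z₂) = R(u₁, u₂) B(z₂) A(z₁)`, `z_i = x^{2u_i}`, in the sense of
analytic continuation of matrix elements: for some `ρ > 0`, the series of the matrix elements of
`A(z₁) B(z₂)` converge absolutely for `|z₂| < ρ |z₁|`, those of `B(z₂) A(z₁)` for `|z₁| < ρ |z₂|`,
and the two sides are, in these two regions, the restrictions of one meromorphic function `f / g`
on `ℂ²`, with `f` and `g ≢ 0` entire. -/
def ExchangeRelation (x : ℝ) (L R : ℂ → ℂ → ℂ) (A B : Current) : Prop :=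
  ∃ ρ : ℝ, 0 < ρ ∧ ∃ g : ℂ × ℂ → ℂ, Differentiable ℂ g ∧ g ≠ 0 ∧
    ∀ (v : Fock) (q : Charge) (μ : Osc →₀ ℕ), ∃ f : ℂ × ℂ → ℂ, Differentiable ℂ f ∧
      (∀ u₁ u₂ : ℂ, ‖zPow x u₂ 1‖ < ρ * ‖zPow x u₁ 1‖ →
        ∃ S : ℂ, HasSum (fun cd : ℂ × ℂ =>
            Fock.coeff q μ (A cd.1 (B cd.2 v)) * (zPow x u₁ cd.1 * zPow x u₂ cd.2)) S ∧
          g (u₁, u₂) * (L u₁ u₂ * S) = f (u₁, u₂)) ∧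
      (∀ u₁ u₂ : ℂ, ‖zPow x u₁ 1‖ < ρ * ‖zPow x u₂ 1‖ →
        ∃ S : ℂ, HasSum (fun cd : ℂ × ℂ =>
            Fock.coeff q μ (B cd.2 (A cd.1 v)) * (zPow x u₁ cd.1 * zPow x u₂ cd.2)) S ∧
          g (u₁, u₂) * (R u₁ u₂ * S) = f (u₁, u₂))

end LevelK

end

open LevelK

noncomputable section

namespace LevelK

/-! ### Exponentials of power series over a noncommutative algebra -/

section Exp

variable {S T : Type*} [Ring S] [Ring T]

/-! Each current is a multiple of a difference of two vertex operators. Since `C_j` and `Ψ_j`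
involve commuting bosons and zero modes, `E_j` is proportional to `eI - eII` and `F_j` to `fI - fII`
(`currentE_eq`, `currentF_eq`). For two vertex operators Wick's theorem reads `V(z₁) W(z₂) = x^A
z₁^B exp(∑ c_m (z₂/z₁)^m) :V(z₁) W(z₂):`, where `A`, `B` are the values of the zero-mode exponents
of `V` on the charge of `W`, and `c_m = contr P V W m` (`annT_gam`, `osc_osc`, `toLin_toLin`). The
normally ordered product does not depend on the order of its factors, and each of its matrix
elements is a finite sum of monomials in powers of `z₁, z₂`, hence entire in `u₁, u₂`. Both halves
of the proposition thus become statements about scalar factors.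

Exchange relations. The identity `[(k+1)m]_+² - [m]_+² = (x - x⁻¹)² [(k+2)m][km]` lets the `β`
contraction of a term I with a term II reduce the `γ` contraction to a single power of `x^{km}`
(`beta_gamma_sum`). Adding the `α` contraction removes the level `k` and leaves `(a^m + e^m - a^{-m}
- e^{-m}) / (m (1 - q^m))`, with `q = x^{2(r-k)}` for `E` and `q = x^{2r}` for `F`; in the opposite
order there is an extra `q^m`. Exponentiated, this is a quotient of four infinite products.
Multiplying by the two theta functions clears the denominators and gives the same entire function
from both orders (`exchange_left`, `exchange_right`). The contractions of the other pairs differ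
from this one by terms without `1 - q^m`, that is, by rational functions of `z₂/z₁`. Two linear
factors clear their poles, and these form the common denominator `exchangeDenom`. The zero-mode
powers of `x` match the constants produced by `w ↦ w⁻¹` in these rational functions
(`ExchangeContr.contractionsContinue`).

Commutator. For `E_j` and `F_j` the mixed pairs I–II have no contraction and equal zero-mode
factors, so they commute. A pair I–I or II–II contracts to `(1 - c y w) / (1 - y w)` with `w =
z₂/z₁`, and its expansions in the two regions differ by a multiple of `δ(y w)`
(`contractionsDelta_of_contr`, `finsum_delta`). The relation `ζ ζ̃ = 2/k` makes the remaining power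
of `z` trivial. -/

lemma commute_of_coeff {f g : PowerSeries S}
    (h : ∀ m n, Commute (PowerSeries.coeff m f) (PowerSeries.coeff n g)) : Commute f g := by
  refine PowerSeries.ext fun n => ?_
  rw [PowerSeries.coeff_mul, PowerSeries.coeff_mul, ← Finset.Nat.sum_antidiagonal_swap]
  exact Finset.sum_congr rfl fun p _ => (h _ _).eq

lemma coeff_pow_eq_zero {F : PowerSeries S} (hF : PowerSeries.coeff 0 F = 0) {i n : ℕ}
    (h : n < i) : PowerSeries.coeff n (F ^ i) = 0 := by
  induction i generalizing n with
  | zero => omega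
  | succ i ih =>
    rw [pow_succ, PowerSeries.coeff_mul]
    refine Finset.sum_eq_zero fun p hp => ?_
    have hp := Finset.HasAntidiagonal.mem_antidiagonal.mp hp
    rcases Nat.eq_zero_or_pos p.2 with h0 | h0
    · rw [h0, hF, mul_zero]
    · rw [ih (by omega), zero_mul]

variable [Algebra ℂ S] [Algebra ℂ T]

/-- The Euler operator `t d/dt`. -/
def euler (f : PowerSeries S) : PowerSeries S := .mk fun n => (n : ℂ) • PowerSeries.coeff n f

@[simp] lemma coeff_euler (f : PowerSeries S) (n : ℕ) :
    PowerSeries.coeff n (euler f) = (n : ℂ) • PowerSeries.coeff n f := by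
  simp [euler]

lemma euler_add (f g : PowerSeries S) : euler (f + g) = euler f + euler g := by
  ext n; simp

lemma euler_mul (f g : PowerSeries S) : euler (f * g) = euler f * g + f * euler g := by
  ext n
  simp only [coeff_euler, map_add, PowerSeries.coeff_mul, Finset.smul_sum, ← Finset.sum_add_distrib]
  refine Finset.sum_congr rfl fun p hp => ?_
  rw [← Finset.HasAntidiagonal.mem_antidiagonal.mp hp]
  push_cast
  rw [add_smul, smul_mul_assoc, mul_smul_comm]

/-- In a noncommutative algebra the power rule needs `f` to commute with its own derivative. -/
lemma euler_pow {f : PowerSeries S} (h : Commute f (euler f)) (i : ℕ) :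
    euler (f ^ (i + 1)) = ((i + 1 : ℕ) : PowerSeries S) * (euler f * f ^ i) := by
  induction i with
  | zero => simp
  | succ i ih =>
    rw [pow_succ' f (i + 1), euler_mul, ih, ← mul_assoc f, ← (Nat.cast_commute (i + 1) f).eq,
      mul_assoc _ f, ← mul_assoc f, h.eq, mul_assoc _ f, ← pow_succ']
    push_cast
    noncomm_ring

/-- The coefficient of `t^n` in `exp(∑_{m>0} A_m t^m)`. -/
def expC (A : ℕ → S) (n : ℕ) : S :=
  ∑ i ∈ Finset.range (n + 1), ((i.factorial : ℂ)⁻¹) •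
    PowerSeries.coeff n ((PowerSeries.mk fun m => if m = 0 then 0 else A m) ^ i)

lemma expC_map (φ : S →ₐ[ℂ] T) (A : ℕ → S) (n : ℕ) :
    expC (fun m => φ (A m)) n = φ (expC A n) := by
  unfold expC
  rw [map_sum]
  refine Finset.sum_congr rfl fun i _ => ?_
  rw [map_smul]
  congr 1
  have : (PowerSeries.mk fun m => if m = 0 then 0 else φ (A m))
      = PowerSeries.map (φ : S →+* T) (PowerSeries.mk fun m => if m = 0 then 0 else A m) := by
    ext m
    by_cases hm : m = 0 <;> simp [hm]
  rw [this, ← map_pow, PowerSeries.coeff_map]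
  rfl

lemma commute_expC {z : S} {A : ℕ → S} (h : ∀ m, Commute z (A m)) (n : ℕ) :
    Commute z (expC A n) := by
  have key : ∀ i n, Commute z
      (PowerSeries.coeff n ((PowerSeries.mk fun m => if m = 0 then 0 else A m) ^ i)) := by
    intro i
    induction i with
    | zero =>
      intro n
      rw [pow_zero, PowerSeries.coeff_one]
      split_ifs <;> simp
    | succ i ih =>
      intro n
      rw [pow_succ, PowerSeries.coeff_mul]
      refine Commute.sum_right _ _ _ fun p _ => (ih _).mul_right ?_
      rw [PowerSeries.coeff_mk]
      split_ifs
      · simp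
      · exact h _
  exact Commute.sum_right _ _ _ fun i _ => (key i n).smul_right _

/-- `E = exp(∑_{m>0} A_m t^m)`, characterised by its logarithmic derivative. -/
structure IsExp (A : ℕ → S) (E : PowerSeries S) : Prop where
  zero : PowerSeries.coeff 0 E = 1
  eq : euler E = euler (.mk A) * E

/-- Commutativity of the `A m` gives `θ(exp F) = θF · exp F`. From here on exponentials are compared
through this first-order equation, never through their factorial sums. -/
lemma isExp_expC {A : ℕ → S} (h : ∀ m n, Commute (A m) (A n)) :
    IsExp A (.mk (expC A)) := by
  refine ⟨by simp [expC], PowerSeries.ext fun n => ?_⟩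
  set F : PowerSeries S := PowerSeries.mk fun m => if m = 0 then 0 else A m with hF
  have hFc : ∀ m, PowerSeries.coeff m F = if m = 0 then 0 else A m := by simp [hF]
  have hF0 : PowerSeries.coeff 0 F = 0 := by rw [hFc]; simp
  -- The entry `A 0`, which the exponential ignores, is also killed by the Euler operator.
  have heF : euler (.mk A) = euler F := by
    ext m
    by_cases hm : m = 0
    · simp [hm]
    · rw [coeff_euler, coeff_euler, hFc, PowerSeries.coeff_mk, if_neg hm]
  have hcomm : Commute F (euler F) := by
    refine commute_of_coeff fun m n => ?_
    rw [coeff_euler, hFc, hFc]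
    refine Commute.smul_right ?_ _
    split_ifs <;> simp [h]
  -- `F` has no constant term, so extra powers contribute nothing to the coefficient of index `n`.
  -- The enlarged range leaves room for the shift `i ↦ i + 1`.
  have hexp : ∀ N n, n ≤ N → expC A n = ∑ i ∈ Finset.range (N + 1), ((i.factorial : ℂ)⁻¹) •
      PowerSeries.coeff n (F ^ i) := by
    intro N n hn
    refine Finset.sum_subset (fun i hi => ?_) fun i _ hi => ?_
    · simp only [Finset.mem_range] at *; omega
    · rw [coeff_pow_eq_zero hF0 (by simpa using hi), smul_zero]
  rw [heF, coeff_euler, PowerSeries.coeff_mk, PowerSeries.coeff_mul, hexp (n + 1) n (by omega),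
    Finset.sum_range_succ']
  rw [smul_add, Finset.smul_sum]
  have h0 : (n : ℂ) • ((Nat.factorial 0 : ℂ)⁻¹) • PowerSeries.coeff n (F ^ 0) = 0 := by
    rw [pow_zero, PowerSeries.coeff_one]
    split_ifs with hn <;> simp [hn]
  rw [h0, add_zero]
  have h1 : ∀ i, (n : ℂ) • (((i + 1).factorial : ℂ)⁻¹) • PowerSeries.coeff n (F ^ (i + 1))
      = ((i.factorial : ℂ)⁻¹) • PowerSeries.coeff n (euler F * F ^ i) := by
    intro i
    rw [smul_comm, ← coeff_euler, euler_pow hcomm, ← nsmul_eq_mul, map_nsmul,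
      ← Nat.cast_smul_eq_nsmul ℂ, smul_smul]
    congr 1
    rw [Nat.factorial_succ]
    push_cast
    have h2 : (i.factorial : ℂ) ≠ 0 := by exact_mod_cast Nat.factorial_ne_zero i
    have h3 : (i : ℂ) + 1 ≠ 0 := by exact_mod_cast Nat.succ_ne_zero i
    field_simp
  simp_rw [h1, PowerSeries.coeff_mul, Finset.smul_sum]
  rw [Finset.sum_comm]
  refine Finset.sum_congr rfl fun p hp => ?_
  have hp := Finset.HasAntidiagonal.mem_antidiagonal.mp hp
  rw [PowerSeries.coeff_mk, hexp n p.2 (by omega), Finset.mul_sum]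
  simp_rw [mul_smul_comm]

/-- The equation expresses `n E_n` through lower coefficients only, since the constant term of `θA`
vanishes; and `n` is invertible for `n > 0`. -/
lemma IsExp.unique {A : ℕ → S} {E E' : PowerSeries S} (h : IsExp A E) (h' : IsExp A E') :
    E = E' := by
  ext n
  induction n using Nat.strong_induction_on with
  | _ n ih =>
    rcases Nat.eq_zero_or_pos n with rfl | hn
    · rw [h.zero, h'.zero]
    · have key : (n : ℂ) • PowerSeries.coeff n E = (n : ℂ) • PowerSeries.coeff n E' := by
        rw [← coeff_euler, ← coeff_euler, h.eq, h'.eq, PowerSeries.coeff_mul,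
          PowerSeries.coeff_mul]
        refine Finset.sum_congr rfl fun p hp => ?_
        have hp := Finset.HasAntidiagonal.mem_antidiagonal.mp hp
        rcases Nat.eq_zero_or_pos p.1 with h0 | h0
        · simp [h0]
        · rw [ih p.2 (by omega)]
      have hn' : (n : ℂ) ≠ 0 := by exact_mod_cast hn.ne'
      exact smul_right_injective S hn' key

/-- By the Leibniz rule; the hypothesis is what allows `θB` to be moved to the left of `E`. -/
lemma IsExp.mul {A B : ℕ → S} {E F : PowerSeries S} (hE : IsExp A E) (hF : IsExp B F)
    (hc : ∀ m n, Commute (PowerSeries.coeff m E) (B n)) :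
    IsExp (fun m => A m + B m) (E * F) := by
  constructor
  · have h1 := hE.zero
    have h2 := hF.zero
    rw [PowerSeries.coeff_zero_eq_constantCoeff_apply] at *
    rw [map_mul, h1, h2, mul_one]
  · have h1 : euler (.mk fun m => A m + B m) = euler (.mk A) + euler (.mk B) := by
      ext n; simp
    have h2 : Commute E (euler (.mk B)) := by
      refine commute_of_coeff fun m n => ?_
      rw [coeff_euler, PowerSeries.coeff_mk]
      exact (hc m n).smul_right _
    rw [euler_mul, hE.eq, hF.eq, h1, ← mul_assoc E, h2.eq]
    noncomm_ring

lemma IsExp.map {A : ℕ → S} {E : PowerSeries S} (h : IsExp A E) (φ : S →ₐ[ℂ] T) :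
    IsExp (fun m => φ (A m)) (PowerSeries.map (φ : S →+* T) E) := by
  have he : ∀ f : PowerSeries S, euler (PowerSeries.map (φ : S →+* T) f)
      = PowerSeries.map (φ : S →+* T) (euler f) := by
    intro f
    ext n
    simp
  constructor
  · rw [PowerSeries.coeff_map, h.zero, map_one]
  · rw [he, h.eq, map_mul, ← he]
    congr 2

end Exp

/-! ### The oscillator part of a vertex operator -/

abbrev OscPoly := MvPolynomial Osc ℂ

/-- Operators on polynomials act on the Fock space charge by charge. -/
def chargewise : Module.End ℂ OscPoly →ₐ[ℂ] Module.End ℂ Fock :=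
  AlgHom.ofLinearMap
    { toFun := fun T => Finsupp.mapRange.linearMap T
      map_add' := fun S T => by ext; simp
      map_smul' := fun c T => by ext; simp }
    (by ext; simp) (fun S T => by ext; simp)

@[simp] lemma chargewise_single (T : Module.End ℂ OscPoly) (q : Charge) (p : OscPoly) :
    chargewise T (Finsupp.single q p) = Finsupp.single q (T p) := by
  simp [chargewise]

lemma derivation_sum_apply {ι : Type*} (s : Finset ι) (D : ι → Derivation ℂ OscPoly OscPoly)
    (p : OscPoly) : (∑ i ∈ s, D i) p = ∑ i ∈ s, D i p := by
  classical
  induction s using Finset.induction_on with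
  | empty => simp
  | insert i s hi ih => rw [Finset.sum_insert hi, Finset.sum_insert hi, Derivation.add_apply, ih]

lemma expCoeff_eq (A : ℕ → Module.End ℂ Fock) (n : ℕ) : expCoeff A n = expC A n := rfl

namespace Vertex

def creGen (V : Vertex) (m : ℕ) : OscPoly :=
  if h : 0 < m then ∑ a : Species, ((V.cre a m : ℝ) : ℂ) • MvPolynomial.X (a, ⟨m, h⟩) else 0

/-- The creation exponential as a power series in `z`. -/
def gam (V : Vertex) : PowerSeries OscPoly := .mk (expC V.creGen)

lemma isExp_gam (V : Vertex) : IsExp V.creGen V.gam := isExp_expC fun _ _ => Commute.all _ _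

lemma creCoeff_eq (P : Params) (V : Vertex) (n : ℕ) :
    V.creCoeff P n = chargewise (Algebra.lmul ℂ OscPoly (PowerSeries.coeff n V.gam)) := by
  rw [gam, PowerSeries.coeff_mk]
  refine Eq.trans ?_ (expC_map (S := OscPoly) (T := Module.End ℂ Fock)
    (chargewise.comp (Algebra.lmul ℂ OscPoly)) V.creGen n)
  rw [creCoeff, expCoeff_eq]
  congr 1
  funext m
  rw [creGen, ← Fintype.sum_prod_type' (f := fun b j =>
    ((V.cre (b, j) m : ℝ) : ℂ) • mode P (b, j) (-(m : ℤ)))]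
  split_ifs with h
  · rw [map_sum]
    refine Finset.sum_congr rfl fun a _ => ?_
    rw [map_smul]
    congr 1
    rw [mode, dif_pos (by omega)]
    have : (⟨(-(-(m : ℤ))).toNat, by omega⟩ : ℕ+) = ⟨m, h⟩ := by
      ext; simp
    rw [this]
    rfl
  · rw [map_zero]
    refine Finset.sum_eq_zero fun a _ => ?_
    rw [mode, dif_neg (by omega), if_neg (by omega), smul_zero]

/-- The scalar by which the annihilation exponential shifts the generator `b`. -/
def kap (P : Params) (V : Vertex) (b : Osc) : ℂ :=
  ∑ a : Species, ((V.ann a b.2 : ℝ) : ℂ) * ((bosonComm P a b.1 b.2 : ℝ) : ℂ)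

/-- Positive modes act as derivations with constant values on the generators, so all annihilators of
level `m` in `V` combine into one such derivation. -/
def annGen (P : Params) (V : Vertex) (m : ℕ) : Derivation ℂ OscPoly OscPoly :=
  MvPolynomial.mkDerivation ℂ fun b => if (b.2 : ℕ) = m then MvPolynomial.C (V.kap P b) else 0

lemma annGen_X (P : Params) (V : Vertex) (m : ℕ) (b : Osc) :
    V.annGen P m (MvPolynomial.X b) =
      if (b.2 : ℕ) = m then MvPolynomial.C (V.kap P b) else 0 := by
  simp [annGen]

lemma annGen_C (P : Params) (V : Vertex) (m : ℕ) (c : ℂ) :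
    V.annGen P m (MvPolynomial.C c) = 0 := MvPolynomial.derivation_C _ _

/-- The coefficients of the annihilation exponential. -/
def annT (P : Params) (V : Vertex) (n : ℕ) : Module.End ℂ OscPoly :=
  expC (fun m => ((V.annGen P m : OscPoly →ₗ[ℂ] OscPoly) : Module.End ℂ OscPoly)) n

lemma annCoeff_eq (P : Params) (V : Vertex) (n : ℕ) :
    V.annCoeff P n = chargewise (V.annT P n) := by
  refine Eq.trans ?_ (expC_map (S := Module.End ℂ OscPoly) (T := Module.End ℂ Fock) chargewise
    (fun m => ((V.annGen P m : OscPoly →ₗ[ℂ] OscPoly) : Module.End ℂ OscPoly)) n)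
  rw [annCoeff, expCoeff_eq]
  congr 1
  funext m
  rw [← Fintype.sum_prod_type' (f := fun b j =>
    ((V.ann (b, j) m : ℝ) : ℂ) • mode P (b, j) (m : ℤ))]
  rcases Nat.eq_zero_or_pos m with rfl | h
  · have h0 : V.annGen P 0 = 0 := by
      refine MvPolynomial.derivation_ext fun b => ?_
      rw [annGen_X, if_neg b.2.ne_zero]
      rfl
    rw [h0, Finset.sum_eq_zero]
    · ext; simp
    · intro a _
      simp [mode]
  · have hd : V.annGen P m = ∑ a : Species, ((V.ann a m : ℝ) : ℂ) •
        MvPolynomial.mkDerivation ℂ (fun b : Osc =>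
          if (b.2 : ℤ) = m then MvPolynomial.C ((bosonComm P a b.1 m : ℝ) : ℂ) else 0) := by
      refine MvPolynomial.derivation_ext fun b => ?_
      rw [annGen_X]
      rw [derivation_sum_apply]
      by_cases hb : (b.2 : ℕ) = m
      · simp only [hb, if_true, Derivation.coe_smul,
          Pi.smul_apply, MvPolynomial.mkDerivation_X]
        simp only [kap, map_sum, hb]
        refine Finset.sum_congr rfl fun a _ => ?_
        rw [MvPolynomial.smul_eq_C_mul, map_mul]
      · simp [hb]
    have hs : ((V.annGen P m : OscPoly →ₗ[ℂ] OscPoly) : Module.End ℂ OscPoly)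
        = ∑ a : Species, ((V.ann a m : ℝ) : ℂ) • ((MvPolynomial.mkDerivation ℂ (fun b : Osc =>
          if (b.2 : ℤ) = m then MvPolynomial.C ((bosonComm P a b.1 m : ℝ) : ℂ) else 0) :
            Derivation ℂ OscPoly OscPoly).toLinearMap : Module.End ℂ OscPoly) := by
      refine LinearMap.ext fun p => ?_
      rw [hd]
      rw [LinearMap.sum_apply]
      refine (derivation_sum_apply _ _ p).trans ?_
      rfl
    rw [hs, map_sum]
    refine Finset.sum_congr rfl fun a _ => ?_
    rw [map_smul]
    congr 1
    rw [mode, dif_neg (by omega), if_pos (by omega)]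
    rfl

lemma annGen_commute (P : Params) (V W : Vertex) (m n : ℕ) :
    Commute ((V.annGen P m : OscPoly →ₗ[ℂ] OscPoly) : Module.End ℂ OscPoly)
      ((W.annGen P n : OscPoly →ₗ[ℂ] OscPoly) : Module.End ℂ OscPoly) := by
  -- The commutator is again a derivation, and it kills every generator because the inner values are
  -- constants.
  have h : ⁅V.annGen P m, W.annGen P n⁆ = 0 := by
    refine MvPolynomial.derivation_ext fun b => ?_
    rw [Derivation.commutator_apply, annGen_X, annGen_X]
    split_ifs <;> simp
  refine LinearMap.ext fun p => ?_
  have := congrArg (fun D : Derivation ℂ OscPoly OscPoly => D p) h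
  simp only [Derivation.commutator_apply] at this
  exact sub_eq_zero.mp this

lemma isExp_annT (P : Params) (V : Vertex) :
    IsExp (fun m => ((V.annGen P m : OscPoly →ₗ[ℂ] OscPoly) : Module.End ℂ OscPoly))
      (.mk (V.annT P)) := isExp_expC fun _ _ => annGen_commute _ _ _ _ _

lemma annT_commute (P : Params) (V W : Vertex) (m n : ℕ) :
    Commute (V.annT P m) (W.annT P n) :=
  commute_expC (fun _ => (commute_expC (fun _ => annGen_commute _ _ _ _ _) _).symm) _

/-- The annihilation exponential as a substitution homomorphism. -/
def tau (P : Params) (V : Vertex) : OscPoly →ₐ[ℂ] PowerSeries OscPoly :=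
  MvPolynomial.aeval fun b => PowerSeries.C (MvPolynomial.X b) +
    PowerSeries.monomial (b.2 : ℕ) (MvPolynomial.C (V.kap P b))

lemma tau_X (P : Params) (V : Vertex) (b : Osc) :
    V.tau P (MvPolynomial.X b) = PowerSeries.C (MvPolynomial.X b) +
      PowerSeries.monomial (b.2 : ℕ) (MvPolynomial.C (V.kap P b)) := by
  simp [tau]

lemma tau_C (P : Params) (V : Vertex) (c : ℂ) :
    V.tau P (MvPolynomial.C c) = PowerSeries.C (MvPolynomial.C c) := by
  rw [tau, MvPolynomial.aeval_C, PowerSeries.algebraMap_apply]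
  rfl

/-- The derivation `∑ m t^m D_m` of `OscPoly⟦t⟧`, `D_m` the annihilation part of `V`. -/
def annDer (P : Params) (V : Vertex) (f : PowerSeries OscPoly) : PowerSeries OscPoly :=
  .mk fun n => ∑ p ∈ Finset.HasAntidiagonal.antidiagonal n,
    (p.1 : ℂ) • V.annGen P p.1 (PowerSeries.coeff p.2 f)

lemma annDer_add (P : Params) (V : Vertex) (f g : PowerSeries OscPoly) :
    V.annDer P (f + g) = V.annDer P f + V.annDer P g := by
  ext n : 1
  simp only [annDer, PowerSeries.coeff_mk, map_add, smul_add, Finset.sum_add_distrib]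

lemma annDer_C (P : Params) (V : Vertex) (p : OscPoly) :
    V.annDer P (PowerSeries.C p) = .mk fun n => (n : ℂ) • V.annGen P n p := by
  ext n : 1
  simp only [annDer, PowerSeries.coeff_mk, PowerSeries.coeff_C]
  rw [Finset.sum_eq_single (n, 0)]
  · simp
  · intro p hp hne
    have : p.2 ≠ 0 := fun h => hne (by
      have := Finset.HasAntidiagonal.mem_antidiagonal.mp hp
      ext <;> simp_all)
    simp [this]
  · simp

lemma annDer_monomial_C (P : Params) (V : Vertex) (m : ℕ) (c : ℂ) :
    V.annDer P (PowerSeries.monomial m (MvPolynomial.C c)) = 0 := by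
  ext n : 1
  simp only [annDer, PowerSeries.coeff_mk, PowerSeries.coeff_monomial, map_zero]
  refine Finset.sum_eq_zero fun p _ => ?_
  split_ifs <;> simp

/-- Up to degree `N`, `annDer` agrees with a finite sum of derivations, each multiplied by a power
of the variable. The Leibniz rule for the infinite sum is read off coefficient by coefficient from
this truncation. -/
lemma coeff_annDer (P : Params) (V : Vertex) (f : PowerSeries OscPoly) {n N : ℕ} (h : n ≤ N) :
    PowerSeries.coeff n (V.annDer P f) = PowerSeries.coeff n (∑ a ∈ Finset.range (N + 1),
      PowerSeries.X ^ a * ((a : ℂ) • (.mk fun i => V.annGen P a (PowerSeries.coeff i f)) :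
        PowerSeries OscPoly)) := by
  rw [annDer, PowerSeries.coeff_mk, map_sum, Finset.Nat.sum_antidiagonal_eq_sum_range_succ_mk]
  simp only [PowerSeries.coeff_X_pow_mul']
  rw [← Finset.sum_subset (Finset.range_subset_range.mpr (Nat.succ_le_succ h))]
  · refine Finset.sum_congr rfl fun a ha => ?_
    rw [if_pos (by simpa [Nat.lt_succ_iff] using ha)]
    simp
  · intro a _ ha
    rw [if_neg (by simpa using ha)]

lemma annDer_mul (P : Params) (V : Vertex) (f g : PowerSeries OscPoly) :
    V.annDer P (f * g) = V.annDer P f * g + f * V.annDer P g := by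
  ext n : 1
  set Δ : PowerSeries OscPoly → PowerSeries OscPoly := fun f => ∑ a ∈ Finset.range (n + 1),
      PowerSeries.X ^ a * ((a : ℂ) • (.mk fun i => V.annGen P a (PowerSeries.coeff i f)) :
        PowerSeries OscPoly) with hΔ
  have h0 : ∀ (c : ℂ) (Y F G : PowerSeries OscPoly), Y * (c • (F * g + f * G))
      = Y * (c • F) * g + f * (Y * (c • G)) := by
    intro c Y F G
    rw [Algebra.smul_def, Algebra.smul_def, Algebra.smul_def]
    ring
  have h1 : Δ (f * g) = Δ f * g + f * Δ g := by
    simp only [hΔ, Finset.sum_mul, Finset.mul_sum, ← Finset.sum_add_distrib]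
    refine Finset.sum_congr rfl fun a _ => ?_
    have h2 : (PowerSeries.mk fun i => V.annGen P a (PowerSeries.coeff i (f * g)))
        = (.mk fun i => V.annGen P a (PowerSeries.coeff i f)) * g +
          f * (.mk fun i => V.annGen P a (PowerSeries.coeff i g)) := by
      ext i : 1
      simp only [map_add, PowerSeries.coeff_mk, PowerSeries.coeff_mul, map_sum,
        Derivation.leibniz, smul_eq_mul, ← Finset.sum_add_distrib]
      refine Finset.sum_congr rfl fun p _ => ?_
      ring
    rw [h2, h0]
  rw [coeff_annDer P V _ le_rfl]
  change PowerSeries.coeff n (Δ (f * g)) = _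
  rw [h1, map_add, map_add, PowerSeries.coeff_mul, PowerSeries.coeff_mul, PowerSeries.coeff_mul,
    PowerSeries.coeff_mul]
  congr 1 <;> refine Finset.sum_congr rfl fun p hp => ?_ <;>
    have hp := Finset.HasAntidiagonal.mem_antidiagonal.mp hp
  · rw [coeff_annDer P V f (show p.1 ≤ n by omega)]
  · rw [coeff_annDer P V g (show p.2 ≤ n by omega)]

/-- Both sides obey the Leibniz rule along the homomorphism `tau`, so it is enough to look at a
generator of level `m`, where the shift `κ t^m` has Euler derivative `m κ t^m`. -/
lemma euler_tau (P : Params) (V : Vertex) (p : OscPoly) :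
    euler (V.tau P p) = V.annDer P (V.tau P p) := by
  induction p using MvPolynomial.induction_on with
  | C c =>
    rw [tau_C, annDer_C]
    ext n : 1
    rw [coeff_euler, PowerSeries.coeff_mk, annGen_C, PowerSeries.coeff_C]
    split_ifs with h <;> simp [h]
  | add p q hp hq => rw [map_add, euler_add, annDer_add, hp, hq]
  | mul_X p b hp =>
    have h : euler (V.tau P (MvPolynomial.X b)) = V.annDer P (V.tau P (MvPolynomial.X b)) := ?_
    · rw [map_mul, euler_mul, annDer_mul, hp, h]
    rw [tau_X, annDer_add, annDer_monomial_C, add_zero, annDer_C]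
    ext n : 1
    rw [coeff_euler, PowerSeries.coeff_mk, map_add, PowerSeries.coeff_C,
      PowerSeries.coeff_monomial, annGen_X]
    by_cases hn : n = 0
    · simp [hn]
    · simp [hn, eq_comm]

lemma coeff_zero_tau (P : Params) (V : Vertex) (p : OscPoly) :
    PowerSeries.coeff 0 (V.tau P p) = p := by
  have : ((PowerSeries.constantCoeff (R := OscPoly)).comp (V.tau P : OscPoly →+* _))
      = RingHom.id _ := by
    refine MvPolynomial.ringHom_ext (fun c => ?_) fun b => ?_
    · rw [RingHom.comp_apply, RingHom.coe_coe, tau_C, PowerSeries.constantCoeff_C]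
      rfl
    · simp only [RingHom.comp_apply, RingHom.coe_coe, tau_X, map_add,
        ← PowerSeries.coeff_zero_eq_constantCoeff_apply, PowerSeries.coeff_monomial,
        if_neg b.2.ne_zero.symm]
      simp
  rw [PowerSeries.coeff_zero_eq_constantCoeff_apply]
  exact congrArg (fun φ : OscPoly →+* OscPoly => φ p) this

/-- The exponential of a derivation is an algebra homomorphism, here a translation of the
generators. The coefficients of `tau` satisfy the equation that characterises the exponential, and
uniqueness identifies the two. -/
lemma annT_eq (P : Params) (V : Vertex) (n : ℕ) (p : OscPoly) :
    V.annT P n p = PowerSeries.coeff n (V.tau P p) := by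
  let E : PowerSeries (Module.End ℂ OscPoly) := .mk fun n =>
    { toFun := fun p => PowerSeries.coeff n (V.tau P p)
      map_add' := fun p q => by simp
      map_smul' := fun c p => by simp }
  have hE : IsExp (fun m => ((V.annGen P m : OscPoly →ₗ[ℂ] OscPoly) : Module.End ℂ OscPoly)) E := by
    constructor
    · rw [PowerSeries.coeff_mk]
      exact LinearMap.ext fun p => coeff_zero_tau P V p
    · ext n : 1
      refine LinearMap.ext fun p => ?_
      have := congrArg (PowerSeries.coeff n) (euler_tau P V p)
      rw [coeff_euler] at this
      rw [coeff_euler, PowerSeries.coeff_mul, LinearMap.smul_apply, PowerSeries.coeff_mk]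
      refine this.trans ?_
      rw [annDer, PowerSeries.coeff_mk, LinearMap.sum_apply]
      refine Finset.sum_congr rfl fun p _ => ?_
      rw [coeff_euler, PowerSeries.coeff_mk, PowerSeries.coeff_mk]
      rfl
  have := congrArg (PowerSeries.coeff n) ((isExp_annT P V).unique hE)
  rw [PowerSeries.coeff_mk, PowerSeries.coeff_mk] at this
  rw [this]
  rfl

lemma annT_mul (P : Params) (V : Vertex) (n : ℕ) (p g : OscPoly) :
    V.annT P n (p * g) = ∑ i ∈ Finset.HasAntidiagonal.antidiagonal n,
      V.annT P i.1 p * V.annT P i.2 g := by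
  simp only [annT_eq, map_mul, PowerSeries.coeff_mul]

/-- The series `tau p` is a polynomial in `t`. This is the source of finiteness for all sums over
annihilation indices. -/
lemma exists_annT_eq_zero (P : Params) (V : Vertex) (p : OscPoly) :
    ∃ M, ∀ m, M ≤ m → V.annT P m p = 0 := by
  simp only [annT_eq]
  induction p using MvPolynomial.induction_on with
  | C c =>
    refine ⟨1, fun m hm => ?_⟩
    rw [tau_C, PowerSeries.coeff_C, if_neg (by omega)]
  | add p q hp hq =>
    obtain ⟨M, hM⟩ := hp
    obtain ⟨N, hN⟩ := hq
    refine ⟨max M N, fun m hm => ?_⟩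
    rw [map_add, map_add, hM m (by omega), hN m (by omega), add_zero]
  | mul_X p b hp =>
    obtain ⟨M, hM⟩ := hp
    refine ⟨M + b.2 + 1, fun m hm => ?_⟩
    rw [map_mul, PowerSeries.coeff_mul]
    refine Finset.sum_eq_zero fun i hi => ?_
    have hi := Finset.HasAntidiagonal.mem_antidiagonal.mp hi
    by_cases h : M ≤ i.1
    · rw [hM _ h, zero_mul]
    · rw [tau_X, map_add, PowerSeries.coeff_C, PowerSeries.coeff_monomial, if_neg (by omega),
        if_neg (by omega), add_zero, mul_zero]

/-- The exponents of the contraction of `V(z₁) W(z₂)`. -/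
def contr (P : Params) (V W : Vertex) (m : ℕ) : ℝ :=
  ∑ a : Species, ∑ b : Species, V.ann a m * W.cre b m * bosonComm P a b m

/-- The contraction of `V(z₁) W(z₂)` as a power series in `z₂ / z₁`. -/
def con (P : Params) (V W : Vertex) : PowerSeries ℂ := .mk (expC fun m => (contr P V W m : ℂ))

lemma isExp_con (P : Params) (V W : Vertex) :
    IsExp (fun m => (contr P V W m : ℂ)) (con P V W) := isExp_expC fun _ _ => Commute.all _ _

lemma tau_creGen (P : Params) (V W : Vertex) (m : ℕ) :
    V.tau P (W.creGen m) = PowerSeries.C (W.creGen m) +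
      if m = 0 then 0 else PowerSeries.monomial m (MvPolynomial.C (contr P V W m : ℂ)) := by
  by_cases h : 0 < m
  · rw [creGen, dif_pos h, if_neg h.ne']
    rw [map_sum, map_sum]
    have h1 : (PowerSeries.monomial m (MvPolynomial.C (contr P V W m : ℂ)) : PowerSeries OscPoly)
        = ∑ b : Species, PowerSeries.monomial m
          (MvPolynomial.C (((W.cre b m : ℝ) : ℂ) * V.kap P (b, ⟨m, h⟩))) := by
      rw [← map_sum, ← map_sum, contr, Finset.sum_comm]
      congr 2
      push_cast
      refine Finset.sum_congr rfl fun b _ => ?_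
      rw [kap, Finset.mul_sum]
      refine Finset.sum_congr rfl fun a _ => ?_
      simp
      ring
    rw [h1, ← Finset.sum_add_distrib]
    refine Finset.sum_congr rfl fun b _ => ?_
    rw [map_smul, tau_X, smul_add]
    congr 1
    · ext n : 1
      rw [PowerSeries.coeff_smul, PowerSeries.coeff_C, PowerSeries.coeff_C]
      split_ifs <;> simp
    · ext n : 1
      rw [PowerSeries.coeff_smul, PowerSeries.coeff_monomial, PowerSeries.coeff_monomial]
      split_ifs <;> simp_all [MvPolynomial.smul_eq_C_mul]
  · have : m = 0 := by omega
    rw [creGen, dif_neg h, if_pos this]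
    simp

/-- Moving the annihilation exponential of `V` past the creation exponential of `W`. -/
lemma annT_gam (P : Params) (V W : Vertex) (m n : ℕ) :
    V.annT P m (PowerSeries.coeff n W.gam) =
      if m ≤ n then MvPolynomial.C (PowerSeries.coeff m (con P V W)) *
        PowerSeries.coeff (n - m) W.gam else 0 := by
  have h1 := W.isExp_gam.map ((V.tau P).restrictScalars ℂ)
  let ι : OscPoly →ₐ[ℂ] PowerSeries OscPoly :=
    { (PowerSeries.C : OscPoly →+* PowerSeries OscPoly) with
      commutes' := fun c => (PowerSeries.algebraMap_apply (A := OscPoly) (r := c)).symm }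
  have h2 := W.isExp_gam.map ι
  -- The contraction series at the product of two variables: the outer one counts creation degree,
  -- the inner one annihilation degree.
  let G : PowerSeries (PowerSeries OscPoly) :=
    .mk fun n => PowerSeries.monomial n (MvPolynomial.C (PowerSeries.coeff n (con P V W)))
  have h3 : IsExp (fun m => if m = 0 then 0 else
      PowerSeries.monomial m (MvPolynomial.C (contr P V W m : ℂ) : OscPoly)) G := by
    constructor
    · rw [PowerSeries.coeff_mk, (isExp_con P V W).zero]
      simp
    · ext n : 1
      have := congrArg (PowerSeries.coeff n) (isExp_con P V W).eq
      rw [coeff_euler, PowerSeries.coeff_mul] at this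
      rw [coeff_euler, PowerSeries.coeff_mul, PowerSeries.coeff_mk]
      have h4 : (n : ℂ) • (PowerSeries.monomial n
          (MvPolynomial.C (PowerSeries.coeff n (con P V W)) : OscPoly))
          = PowerSeries.monomial n (MvPolynomial.C ((n : ℂ) • PowerSeries.coeff n (con P V W))) := by
        ext k : 1
        rw [PowerSeries.coeff_smul, PowerSeries.coeff_monomial, PowerSeries.coeff_monomial]
        split_ifs <;> simp [MvPolynomial.smul_eq_C_mul]
      rw [h4, this, map_sum, map_sum]
      refine Finset.sum_congr rfl fun p hp => ?_
      have hp := Finset.HasAntidiagonal.mem_antidiagonal.mp hp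
      rw [coeff_euler, coeff_euler, PowerSeries.coeff_mk, PowerSeries.coeff_mk,
        PowerSeries.coeff_mk]
      by_cases h0 : p.1 = 0
      · simp [h0]
      · conv_rhs => rw [if_neg h0, smul_mul_assoc, PowerSeries.monomial_mul_monomial, hp]
        ext k : 1
        rw [PowerSeries.coeff_smul, PowerSeries.coeff_monomial, PowerSeries.coeff_monomial]
        split_ifs <;> simp [MvPolynomial.smul_eq_C_mul, mul_assoc]
  have h5 := h2.mul h3 fun _ _ => Commute.all _ _
  -- The translation sends each exponent `W.creGen m` to itself plus a scalar term, so the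
  -- translated exponential splits into the old one times `G`.
  have h6 := h1.unique (A := fun m => V.tau P (W.creGen m)) (E' := _) (by
    convert h5 using 1
    funext m
    exact tau_creGen P V W m)
  have h7 := congrArg (fun f => PowerSeries.coeff m (PowerSeries.coeff n f)) h6
  simp only [PowerSeries.coeff_map, PowerSeries.coeff_mul] at h7
  rw [annT_eq]
  refine h7.trans ?_
  rw [map_sum]
  have h8 : ∀ p : ℕ × ℕ, PowerSeries.coeff m ((ι : OscPoly →+* PowerSeries OscPoly)
      (PowerSeries.coeff p.1 W.gam) * PowerSeries.coeff p.2 G)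
      = if m = p.2 then MvPolynomial.C (PowerSeries.coeff m (con P V W)) *
        PowerSeries.coeff p.1 W.gam else 0 := by
    intro p
    change PowerSeries.coeff m (PowerSeries.C (PowerSeries.coeff p.1 W.gam) * _) = _
    rw [PowerSeries.coeff_C_mul, PowerSeries.coeff_mk, PowerSeries.coeff_monomial]
    split_ifs with h
    · rw [h, mul_comm]
    · simp
  simp_rw [h8]
  split_ifs with h
  · rw [Finset.sum_eq_single (n - m, m)]
    · simp
    · intro p hp hne
      have hp := Finset.HasAntidiagonal.mem_antidiagonal.mp hp
      rw [if_neg]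
      rintro rfl
      exact hne (by ext <;> simp; omega)
    · intro hn
      exact absurd (Finset.HasAntidiagonal.mem_antidiagonal.mpr (by simp; omega)) hn
  · refine Finset.sum_eq_zero fun p hp => ?_
    have hp := Finset.HasAntidiagonal.mem_antidiagonal.mp hp
    rw [if_neg (by omega)]

lemma gam_join (V W : Vertex) : (V.join W).gam = V.gam * W.gam := by
  refine (V.join W).isExp_gam.unique ?_
  convert V.isExp_gam.mul W.isExp_gam fun _ _ => Commute.all _ _ using 1
  funext m
  unfold creGen
  split_ifs
  · rw [← Finset.sum_add_distrib]
    refine Finset.sum_congr rfl fun a _ => ?_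
    rw [← add_smul]
    simp [join]
  · simp

lemma annT_join (P : Params) (V W : Vertex) (n : ℕ) :
    (V.join W).annT P n = ∑ p ∈ Finset.HasAntidiagonal.antidiagonal n,
      V.annT P p.1 * W.annT P p.2 := by
  have h := (isExp_annT P V).mul (isExp_annT P W) fun m n => by
    rw [PowerSeries.coeff_mk]
    exact (commute_expC (fun _ => annGen_commute _ _ _ _ _) _).symm
  have h2 : (fun m => (((V.join W).annGen P m : OscPoly →ₗ[ℂ] OscPoly) : Module.End ℂ OscPoly))
      = fun m => ((V.annGen P m : OscPoly →ₗ[ℂ] OscPoly) : Module.End ℂ OscPoly)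
        + ((W.annGen P m : OscPoly →ₗ[ℂ] OscPoly) : Module.End ℂ OscPoly) := by
    funext m
    have : (V.join W).annGen P m = V.annGen P m + W.annGen P m := by
      refine MvPolynomial.derivation_ext fun b => ?_
      rw [Derivation.add_apply, annGen_X, annGen_X, annGen_X]
      split_ifs
      · rw [← map_add, kap, kap, kap, ← Finset.sum_add_distrib]
        congr 1
        refine Finset.sum_congr rfl fun a _ => ?_
        simp only [join]
        push_cast
        ring
      · simp
    rw [this]
    rfl
  have h3 := isExp_annT P (V.join W)
  rw [h2] at h3
  have := congrArg (PowerSeries.coeff n) (h3.unique h)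
  simpa only [PowerSeries.coeff_mk, PowerSeries.coeff_mul] using this

end Vertex

/-! ### Finite sums -/

/-- The box `I × J` supports the summand and is covered by the antidiagonals of index below `I + J`.
-/
lemma sum_range_antidiagonal {M : Type*} [AddCommMonoid M] (f : ℕ → ℕ → M) (I J : ℕ)
    (h : ∀ i j, I ≤ i ∨ J ≤ j → f i j = 0) :
    ∑ m ∈ Finset.range (I + J), ∑ p ∈ Finset.HasAntidiagonal.antidiagonal m, f p.1 p.2 =
      ∑ i ∈ Finset.range I, ∑ j ∈ Finset.range J, f i j := by
  rw [← Finset.sum_product', ← Finset.sum_fiberwise_of_maps_to (t := Finset.range (I + J))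
    (g := fun p : ℕ × ℕ => p.1 + p.2)]
  · refine Finset.sum_congr rfl fun m _ => ?_
    symm
    refine Finset.sum_subset (fun p hp => ?_) fun p hp hp' => ?_
    · exact Finset.HasAntidiagonal.mem_antidiagonal.mpr (Finset.mem_filter.mp hp).2
    · have hp := Finset.HasAntidiagonal.mem_antidiagonal.mp hp
      refine h _ _ ?_
      by_contra hc
      push Not at hc
      exact hp' (by simp [hp, hc])
  · intro p hp
    simp only [Finset.mem_product, Finset.mem_range] at *
    omega

lemma single_sum {ι : Type*} (s : Finset ι) (q : Charge) (f : ι → OscPoly) :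
    (Finsupp.single q (∑ i ∈ s, f i) : Fock) = ∑ i ∈ s, Finsupp.single q (f i) :=
  map_sum (Finsupp.singleAddHom q) f s

/-- A locally finite sum of linear operators on the Fock space is determined by its values on
the vectors of a single charge. -/
lemma finsum_eq_of_single {ι : Type*} (F : ι → Fock →ₗ[ℂ] Fock) (L : Fock →ₗ[ℂ] Fock)
    (h : ∀ q p, (Function.support fun i => F i (Finsupp.single q p)).Finite ∧
      ∑ᶠ i, F i (Finsupp.single q p) = L (Finsupp.single q p)) (v : Fock) :
    (Function.support fun i => F i v).Finite ∧ ∑ᶠ i, F i v = L v := by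
  induction v using Finsupp.induction_linear with
  | zero => simp
  | single q p => exact h q p
  | add v w hv hw =>
    simp only [map_add]
    refine ⟨(hv.1.union hw.1).subset fun i hi => ?_, ?_⟩
    · by_contra hc
      simp only [Set.mem_union, Function.mem_support, not_or, not_not] at hc hi
      exact hi (by rw [hc.1, hc.2, add_zero])
    · rw [finsum_add_distrib hv.1 hw.1, hv.2, hw.2]

namespace Vertex

/-! ### Creation coefficients with complex index -/

/-- The coefficient of `z^κ` in the creation exponential, for complex `κ`. -/
def gamHat (V : Vertex) (κ : ℂ) : OscPoly :=
  open Classical in if h : ∃ n : ℕ, (n : ℂ) = κ then PowerSeries.coeff h.choose V.gam else 0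

@[simp] lemma gamHat_natCast (V : Vertex) (n : ℕ) : V.gamHat n = PowerSeries.coeff n V.gam := by
  have h : ∃ m : ℕ, (m : ℂ) = n := ⟨n, rfl⟩
  rw [gamHat, dif_pos h]
  congr 1
  exact congrArg (fun m => PowerSeries.coeff (R := OscPoly) m) (by exact_mod_cast h.choose_spec)

lemma gamHat_eq_zero (V : Vertex) {κ : ℂ} (h : ∀ n : ℕ, κ ≠ n) : V.gamHat κ = 0 := by
  rw [gamHat, dif_neg]
  rintro ⟨n, hn⟩
  exact h n hn.symm

lemma exists_of_gamHat_ne_zero (V : Vertex) {κ : ℂ} (h : V.gamHat κ ≠ 0) : ∃ n : ℕ, κ = n := by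
  by_contra hc
  push Not at hc
  exact h (gamHat_eq_zero V hc)

/-- Converts a sum over natural creation degrees with a constraint on the exponent of `z` into one
coefficient with complex index. The norm bound ensures that the only possible degree lies in the
range. -/
lemma sum_ite_gamHat {M : Type*} [AddCommMonoid M] (V : Vertex) (κ : ℂ) (K : ℕ) (h : ‖κ‖ < K)
    (φ : OscPoly → M) (h0 : φ 0 = 0) :
    ∑ n ∈ Finset.range K, (if κ = n then φ (PowerSeries.coeff n V.gam) else 0) =
      φ (V.gamHat κ) := by
  by_cases hκ : ∃ n : ℕ, κ = n
  · obtain ⟨n, rfl⟩ := hκ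
    rw [Complex.norm_natCast] at h
    have hn : n < K := by exact_mod_cast h
    rw [Finset.sum_eq_single n]
    · simp
    · intro m _ hm
      rw [if_neg]
      exact_mod_cast hm.symm
    · intro hc
      exact absurd (Finset.mem_range.mpr hn) hc
  · push Not at hκ
    rw [gamHat_eq_zero V hκ, h0]
    exact Finset.sum_eq_zero fun n _ => if_neg (hκ n)

/-! ### The oscillator part of the modes -/

/-- The oscillator part of the coefficient of `z^κ` in a vertex operator. -/
def osc (P : Params) (V : Vertex) (κ : ℂ) (p : OscPoly) : OscPoly :=
  ∑ᶠ m : ℕ, V.gamHat (κ + m) * V.annT P m p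

lemma osc_eq_sum (P : Params) (V : Vertex) (κ : ℂ) (p : OscPoly) (M : ℕ)
    (hM : ∀ m, M ≤ m → V.annT P m p = 0) :
    V.osc P κ p = ∑ m ∈ Finset.range M, V.gamHat (κ + m) * V.annT P m p := by
  refine finsum_eq_sum_of_support_subset _ fun m hm => ?_
  by_contra hc
  exact hm (by dsimp only; rw [hM m (by simpa using hc), mul_zero])

/-- `osc` as a linear map. -/
def oscL (P : Params) (V : Vertex) (κ : ℂ) : OscPoly →ₗ[ℂ] OscPoly where
  toFun := V.osc P κ
  map_add' p g := by
    obtain ⟨M, hM⟩ := exists_annT_eq_zero P V p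
    obtain ⟨N, hN⟩ := exists_annT_eq_zero P V g
    rw [osc_eq_sum P V κ p (max M N) fun m hm => hM m (by omega),
      osc_eq_sum P V κ g (max M N) fun m hm => hN m (by omega),
      osc_eq_sum P V κ (p + g) (max M N) fun m hm => by
        rw [map_add, hM m (by omega), hN m (by omega), add_zero], ← Finset.sum_add_distrib]
    exact Finset.sum_congr rfl fun m _ => by rw [map_add, mul_add]
  map_smul' c p := by
    obtain ⟨M, hM⟩ := exists_annT_eq_zero P V p
    rw [osc_eq_sum P V κ p M hM,
      osc_eq_sum P V κ (c • p) M fun m hm => by rw [map_smul, hM m hm, smul_zero],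
      RingHom.id_apply, Finset.smul_sum]
    exact Finset.sum_congr rfl fun m _ => by rw [map_smul, mul_smul_comm]

@[simp] lemma oscL_apply (P : Params) (V : Vertex) (κ : ℂ) (p : OscPoly) :
    V.oscL P κ p = V.osc P κ p := rfl

/-- The coefficient of `z^c` of a vertex operator as a linear map. -/
def toLin (P : Params) (V : Vertex) (c : ℂ) : Fock →ₗ[ℂ] Fock :=
  Finsupp.lsum ℂ fun q => ((P.x ^ V.xExp q : ℝ) : ℂ) •
    (Finsupp.lsingle (q + V.shift) ∘ₗ V.oscL P (c - V.zExp q))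

lemma toLin_single (P : Params) (V : Vertex) (c : ℂ) (q : Charge) (p : OscPoly) :
    V.toLin P c (Finsupp.single q p) =
      Finsupp.single (q + V.shift) (((P.x ^ V.xExp q : ℝ) : ℂ) • V.osc P (c - V.zExp q) p) := by
  rw [toLin, Finsupp.lsum_single, LinearMap.smul_apply, LinearMap.comp_apply,
    Finsupp.lsingle_apply, Finsupp.smul_single, oscL_apply]

/-- On a single charge the zero mode forces the creation degree to equal `c - V.zExp q` plus the
annihilation degree. One summation index disappears and the other runs over a finite range. -/
lemma toCurrent_aux (P : Params) (V : Vertex) (c : ℂ) (v : Fock) :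
    (Function.support fun nm : ℕ × ℕ =>
      V.creCoeff P nm.1 (V.annCoeff P nm.2 (V.zeroMode P (c - nm.1 + nm.2) v))).Finite ∧
    V.toCurrent P c v = V.toLin P c v := by
  refine finsum_eq_of_single (fun nm : ℕ × ℕ => V.creCoeff P nm.1 ∘ₗ V.annCoeff P nm.2 ∘ₗ
    V.zeroMode P (c - nm.1 + nm.2)) (V.toLin P c) (fun q p => ?_) v
  obtain ⟨M, hM⟩ := exists_annT_eq_zero P V p
  have hterm : ∀ nm : ℕ × ℕ, (V.creCoeff P nm.1 ∘ₗ V.annCoeff P nm.2 ∘ₗ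
      V.zeroMode P (c - nm.1 + nm.2)) (Finsupp.single q p) =
      if c - V.zExp q + nm.2 = nm.1 then Finsupp.single (q + V.shift)
        (((P.x ^ V.xExp q : ℝ) : ℂ) • (PowerSeries.coeff nm.1 V.gam * V.annT P nm.2 p)) else 0 := by
    intro nm
    have hiff : V.zExp q = c - nm.1 + nm.2 ↔ c - V.zExp q + nm.2 = nm.1 := by
      constructor <;> intro h <;> linear_combination -h
    simp only [LinearMap.comp_apply, zeroMode, Finsupp.lsum_single, hiff]
    split_ifs
    · rw [LinearMap.smul_apply, Finsupp.lsingle_apply, map_smul, map_smul,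
        annCoeff_eq, creCoeff_eq, chargewise_single, chargewise_single, Finsupp.smul_single]
      rfl
    · simp
  -- The constraint bounds the creation degree by this norm plus the largest annihilation degree.
  obtain ⟨K, hK⟩ := exists_nat_gt (‖c - V.zExp q‖ + M)
  have hsupp : (Function.support fun nm : ℕ × ℕ => (V.creCoeff P nm.1 ∘ₗ V.annCoeff P nm.2 ∘ₗ
      V.zeroMode P (c - nm.1 + nm.2)) (Finsupp.single q p)) ⊆
      (Finset.range K ×ˢ Finset.range M : Finset (ℕ × ℕ)) := by
    intro nm hnm
    rw [Function.mem_support, hterm] at hnm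
    have h1 : c - V.zExp q + nm.2 = nm.1 := by
      by_contra hc
      exact hnm (if_neg hc)
    have h2 : nm.2 < M := by
      by_contra hc
      apply hnm
      rw [hM _ (by omega)]
      simp
    have h3 : (nm.1 : ℝ) < K := by
      rw [← Complex.norm_natCast, ← h1]
      refine (norm_add_le _ _).trans_lt (lt_of_le_of_lt ?_ hK)
      rw [Complex.norm_natCast]
      gcongr
    simp only [Finset.coe_product, Finset.coe_range, Set.mem_prod, Set.mem_Iio]
    exact ⟨by exact_mod_cast h3, h2⟩
  refine ⟨(Finset.finite_toSet _).subset hsupp, ?_⟩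
  rw [finsum_eq_sum_of_support_subset _ hsupp, Finset.sum_product_right, toLin_single,
    osc_eq_sum P V _ p M hM, Finset.smul_sum, single_sum]
  refine Finset.sum_congr rfl fun m hm => ?_
  refine (Finset.sum_congr rfl fun n _ => hterm (n, m)).trans ?_
  refine sum_ite_gamHat V (c - V.zExp q + m) K ?_ (fun g => Finsupp.single (q + V.shift)
    (((P.x ^ V.xExp q : ℝ) : ℂ) • (g * V.annT P m p))) (by simp)
  refine (norm_add_le _ _).trans_lt (lt_of_le_of_lt ?_ hK)
  rw [Complex.norm_natCast]
  have := (Finset.mem_range.mp hm).le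
  gcongr

lemma toCurrent_eq (P : Params) (V : Vertex) (c : ℂ) (v : Fock) :
    V.toCurrent P c v = V.toLin P c v := (toCurrent_aux P V c v).2

/-! ### Normally ordered products -/

/-- The oscillator part of the coefficients of `:V(z₁) W(z₂):`. -/
def nord (P : Params) (V W : Vertex) (a b : ℂ) (p : OscPoly) : OscPoly :=
  ∑ᶠ m : ℕ × ℕ, V.gamHat (a + m.1) * (W.gamHat (b + m.2) * V.annT P m.1 (W.annT P m.2 p))

lemma annT_zero (P : Params) (V : Vertex) (p : OscPoly) : V.annT P 0 p = p := by
  rw [annT_eq, coeff_zero_tau]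

/-- The bound for the outer index depends on the inner one, but only finitely many inner indices
matter; the sum of their bounds dominates each of them. -/
lemma exists_annT_annT_eq_zero (P : Params) (V W : Vertex) (p : OscPoly) :
    ∃ M, ∀ m n, M ≤ m ∨ M ≤ n → V.annT P m (W.annT P n p) = 0 := by
  obtain ⟨M, hM⟩ := exists_annT_eq_zero P W p
  choose N hN using fun n => exists_annT_eq_zero P V (W.annT P n p)
  refine ⟨M + ∑ n ∈ Finset.range M, N n, fun m n h => ?_⟩
  by_cases hn : M ≤ n
  · rw [hM n hn, map_zero]
  · have := Finset.single_le_sum (f := N) (fun _ _ => Nat.zero_le _)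
      (Finset.mem_range.mpr (not_le.mp hn))
    exact hN n m (by omega)

lemma nord_eq_sum (P : Params) (V W : Vertex) (a b : ℂ) (p : OscPoly) (M : ℕ)
    (hM : ∀ m n, M ≤ m ∨ M ≤ n → V.annT P m (W.annT P n p) = 0) :
    nord P V W a b p = ∑ m ∈ Finset.range M, ∑ n ∈ Finset.range M,
      V.gamHat (a + m) * (W.gamHat (b + n) * V.annT P m (W.annT P n p)) := by
  rw [← Finset.sum_product']
  refine finsum_eq_sum_of_support_subset _ fun m hm => ?_
  by_contra hc
  refine hm ?_
  dsimp only
  rw [hM _ _ (by simpa [imp_iff_not_or] using hc), mul_zero, mul_zero]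

/-- Annihilation parts commute with one another, and creation parts act by multiplication in a
commutative ring. This symmetry reduces exchange and commutation relations to scalars. -/
lemma nord_comm (P : Params) (V W : Vertex) (a b : ℂ) (p : OscPoly) :
    nord P V W a b p = nord P W V b a p := by
  have hc : ∀ m n, V.annT P m (W.annT P n p) = W.annT P n (V.annT P m p) := fun m n =>
    LinearMap.congr_fun (annT_commute P V W m n).eq p
  obtain ⟨M, hM⟩ := exists_annT_annT_eq_zero P V W p
  rw [nord_eq_sum P V W a b p M hM, nord_eq_sum P W V b a p M fun m n h => by
    rw [← hc]; exact hM n m h.symm, Finset.sum_comm]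
  refine Finset.sum_congr rfl fun m _ => Finset.sum_congr rfl fun n _ => ?_
  rw [hc, mul_left_comm]

/-- `nord` as a linear map. -/
def nordL (P : Params) (V W : Vertex) (a b : ℂ) : OscPoly →ₗ[ℂ] OscPoly where
  toFun := nord P V W a b
  map_add' p g := by
    obtain ⟨M, hM⟩ := exists_annT_annT_eq_zero P V W p
    obtain ⟨N, hN⟩ := exists_annT_annT_eq_zero P V W g
    rw [nord_eq_sum P V W a b p (max M N) fun m n h => hM m n (by omega),
      nord_eq_sum P V W a b g (max M N) fun m n h => hN m n (by omega),
      nord_eq_sum P V W a b (p + g) (max M N) fun m n h => by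
        rw [map_add, map_add, hM m n (by omega), hN m n (by omega), add_zero],
      ← Finset.sum_add_distrib]
    refine Finset.sum_congr rfl fun m _ => ?_
    rw [← Finset.sum_add_distrib]
    exact Finset.sum_congr rfl fun n _ => by rw [map_add, map_add]; ring
  map_smul' c p := by
    obtain ⟨M, hM⟩ := exists_annT_annT_eq_zero P V W p
    rw [nord_eq_sum P V W a b p M hM,
      nord_eq_sum P V W a b (c • p) M fun m n h => by
        rw [map_smul, map_smul, hM m n h, smul_zero],
      RingHom.id_apply, Finset.smul_sum]
    refine Finset.sum_congr rfl fun m _ => ?_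
    rw [Finset.smul_sum]
    exact Finset.sum_congr rfl fun n _ => by
      rw [map_smul, map_smul, mul_smul_comm, mul_smul_comm]

@[simp] lemma nordL_apply (P : Params) (V W : Vertex) (a b : ℂ) (p : OscPoly) :
    nordL P V W a b p = nord P V W a b p := rfl

/-- Coefficients of the normally ordered product as linear maps. -/
def nordLin (P : Params) (V W : Vertex) (c d : ℂ) : Fock →ₗ[ℂ] Fock :=
  Finsupp.lsum ℂ fun q => ((P.x ^ (V.xExp q + W.xExp q) : ℝ) : ℂ) •
    (Finsupp.lsingle (q + (V.shift + W.shift)) ∘ₗ nordL P V W (c - V.zExp q) (d - W.zExp q))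

lemma nordLin_single (P : Params) (V W : Vertex) (c d : ℂ) (q : Charge) (p : OscPoly) :
    nordLin P V W c d (Finsupp.single q p) =
      Finsupp.single (q + (V.shift + W.shift)) (((P.x ^ (V.xExp q + W.xExp q) : ℝ) : ℂ) •
        nord P V W (c - V.zExp q) (d - W.zExp q) p) := by
  rw [nordLin, Finsupp.lsum_single, LinearMap.smul_apply, LinearMap.comp_apply,
    Finsupp.lsingle_apply, Finsupp.smul_single, nordL_apply]

lemma normalOrdered_eq (P : Params) (V W : Vertex) (c d : ℂ) (v : Fock) :
    normalOrdered P V W c d v = nordLin P V W c d v := by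
  refine (finsum_eq_of_single (fun nm : (ℕ × ℕ) × (ℕ × ℕ) => V.creCoeff P nm.1.1 ∘ₗ
    W.creCoeff P nm.2.1 ∘ₗ V.annCoeff P nm.1.2 ∘ₗ W.annCoeff P nm.2.2 ∘ₗ
    zeroMode₂ P V W (c - nm.1.1 + nm.1.2) (d - nm.2.1 + nm.2.2)) (nordLin P V W c d)
    (fun q p => ?_) v).2
  obtain ⟨M, hM⟩ := exists_annT_annT_eq_zero P V W p
  set s : ℂ := ((P.x ^ (V.xExp q + W.xExp q) : ℝ) : ℂ) with hs
  set q' := q + (V.shift + W.shift) with hq'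
  set a := c - V.zExp q with ha
  set b := d - W.zExp q with hb
  have hterm : ∀ nm : (ℕ × ℕ) × (ℕ × ℕ), (V.creCoeff P nm.1.1 ∘ₗ
      W.creCoeff P nm.2.1 ∘ₗ V.annCoeff P nm.1.2 ∘ₗ W.annCoeff P nm.2.2 ∘ₗ
      zeroMode₂ P V W (c - nm.1.1 + nm.1.2) (d - nm.2.1 + nm.2.2)) (Finsupp.single q p) =
      if a + nm.1.2 = nm.1.1 then if b + nm.2.2 = nm.2.1 then Finsupp.single q'
        (s • (PowerSeries.coeff nm.1.1 V.gam * (PowerSeries.coeff nm.2.1 W.gam *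
          V.annT P nm.1.2 (W.annT P nm.2.2 p)))) else 0 else 0 := by
    intro nm
    have hiff : V.zExp q = c - nm.1.1 + nm.1.2 ↔ a + nm.1.2 = nm.1.1 := by
      constructor <;> intro h <;> linear_combination -h
    have hiff' : W.zExp q = d - nm.2.1 + nm.2.2 ↔ b + nm.2.2 = nm.2.1 := by
      constructor <;> intro h <;> linear_combination -h
    simp only [LinearMap.comp_apply, zeroMode₂, Finsupp.lsum_single, hiff, hiff', ite_and]
    split_ifs
    · rw [LinearMap.smul_apply, Finsupp.lsingle_apply, map_smul, map_smul,
        map_smul, map_smul, annCoeff_eq, creCoeff_eq, annCoeff_eq, creCoeff_eq, chargewise_single,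
        chargewise_single, chargewise_single, chargewise_single, Finsupp.smul_single]
      rfl
    · simp
    · simp
  obtain ⟨K, hK⟩ := exists_nat_gt (‖a‖ + M)
  obtain ⟨L, hL⟩ := exists_nat_gt (‖b‖ + M)
  have hbound : ∀ (e : ℂ) (K m : ℕ), ‖e‖ + M < K → m ≤ M → ‖e + m‖ < K := by
    intro e K m he hm
    refine (norm_add_le _ _).trans_lt (lt_of_le_of_lt ?_ he)
    rw [Complex.norm_natCast]
    gcongr
  have hsupp : (Function.support fun nm : (ℕ × ℕ) × (ℕ × ℕ) => (V.creCoeff P nm.1.1 ∘ₗ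
      W.creCoeff P nm.2.1 ∘ₗ V.annCoeff P nm.1.2 ∘ₗ W.annCoeff P nm.2.2 ∘ₗ
      zeroMode₂ P V W (c - nm.1.1 + nm.1.2) (d - nm.2.1 + nm.2.2)) (Finsupp.single q p)) ⊆
      ((Finset.range K ×ˢ Finset.range M) ×ˢ (Finset.range L ×ˢ Finset.range M) :
        Finset ((ℕ × ℕ) × (ℕ × ℕ))) := by
    intro nm hnm
    rw [Function.mem_support, hterm] at hnm
    have h1 : a + nm.1.2 = nm.1.1 := by
      by_contra hc
      exact hnm (if_neg hc)
    have h2 : b + nm.2.2 = nm.2.1 := by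
      by_contra hc
      rw [if_pos h1, if_neg hc] at hnm
      exact hnm rfl
    have h3 : nm.1.2 < M ∧ nm.2.2 < M := by
      by_contra hc
      apply hnm
      rw [hM _ _ (by omega)]
      simp
    have h4 := hbound a K nm.1.2 hK h3.1.le
    have h5 := hbound b L nm.2.2 hL h3.2.le
    rw [h1, Complex.norm_natCast] at h4
    rw [h2, Complex.norm_natCast] at h5
    simp only [Finset.coe_product, Finset.coe_range, Set.mem_prod, Set.mem_Iio]
    exact ⟨⟨by exact_mod_cast h4, h3.1⟩, by exact_mod_cast h5, h3.2⟩
  refine ⟨(Finset.finite_toSet _).subset hsupp, ?_⟩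
  rw [finsum_eq_sum_of_support_subset _ hsupp, Finset.sum_product, Finset.sum_product_right,
    nordLin_single, nord_eq_sum P V W _ _ p M hM, Finset.smul_sum, single_sum]
  refine Finset.sum_congr rfl fun m hm => ?_
  have h1 : ∀ n : ℕ, ∑ y ∈ Finset.range L ×ˢ Finset.range M, (V.creCoeff P n ∘ₗ
      W.creCoeff P y.1 ∘ₗ V.annCoeff P m ∘ₗ W.annCoeff P y.2 ∘ₗ
      zeroMode₂ P V W (c - n + m) (d - y.1 + y.2)) (Finsupp.single q p) =
      if a + m = n then ∑ m' ∈ Finset.range M, Finsupp.single q'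
        (s • (PowerSeries.coeff n V.gam * (W.gamHat (b + m') *
          V.annT P m (W.annT P m' p)))) else 0 := by
    intro n
    rw [Finset.sum_product_right]
    refine (Finset.sum_congr rfl fun m' _ => Finset.sum_congr rfl fun n' _ =>
      hterm ((n, m), (n', m'))).trans ?_
    dsimp only
    split_ifs
    · refine Finset.sum_congr rfl fun m' hm' => ?_
      exact sum_ite_gamHat W (b + m') L (hbound b L m' hL (Finset.mem_range.mp hm').le)
        (fun g => Finsupp.single q' (s • (PowerSeries.coeff n V.gam * (g *
          V.annT P m (W.annT P m' p))))) (by simp)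
    · simp
  rw [Finset.sum_congr rfl fun n _ => h1 n]
  rw [sum_ite_gamHat V (a + m) K (hbound a K m hK (Finset.mem_range.mp hm).le)
    (fun g => ∑ m' ∈ Finset.range M, Finsupp.single q' (s • (g * (W.gamHat (b + m') *
          V.annT P m (W.annT P m' p))))) (by simp), Finset.smul_sum, single_sum]

end Vertex

namespace Vertex

/-! ### Products of vertex operators -/

/-- The annihilation exponential of `V` is multiplicative. Applied to a product with a creation
coefficient of `W`, it splits, and `annT_gam` extracts the contraction from the first factor. -/
lemma osc_gamHat_mul (P : Params) (V W : Vertex) (a κ : ℂ) (g : OscPoly) (L : ℕ) (hL : ‖κ‖ < L) :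
    V.osc P a (W.gamHat κ * g) = ∑ l ∈ Finset.range L, PowerSeries.coeff l (con P V W) •
      (W.gamHat (κ - l) * V.osc P (a + l) g) := by
  by_cases hκ : ∃ n : ℕ, κ = n
  · obtain ⟨n, rfl⟩ := hκ
    have hnL : n < L := by
      rw [Complex.norm_natCast] at hL
      exact_mod_cast hL
    obtain ⟨M, hM⟩ := exists_annT_eq_zero P V g
    have hT : ∀ i j, n + 1 ≤ i ∨ M ≤ j →
        V.annT P i (PowerSeries.coeff n W.gam) * V.annT P j g = 0 := by
      rintro i j (h | h)
      · rw [annT_gam, if_neg (by omega), zero_mul]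
      · rw [hM j h, mul_zero]
    -- A creation coefficient of degree `n` survives at most `n` steps of annihilation and `g` fewer
    -- than `M`.
    rw [gamHat_natCast, osc_eq_sum P V a _ (n + 1 + M) fun m hm => by
      rw [annT_mul]
      refine Finset.sum_eq_zero fun p hp => hT _ _ ?_
      have hp := Finset.HasAntidiagonal.mem_antidiagonal.mp hp
      omega]
    have h1 : ∀ m : ℕ, V.gamHat (a + m) * V.annT P m (PowerSeries.coeff n W.gam * g) =
        ∑ p ∈ Finset.HasAntidiagonal.antidiagonal m, V.gamHat (a + p.1 + p.2) *
          (V.annT P p.1 (PowerSeries.coeff n W.gam) * V.annT P p.2 g) := by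
      intro m
      rw [annT_mul, Finset.mul_sum]
      refine Finset.sum_congr rfl fun p hp => ?_
      have hp := Finset.HasAntidiagonal.mem_antidiagonal.mp hp
      rw [← hp]
      push_cast
      rw [add_assoc]
    simp only [h1]
    rw [sum_range_antidiagonal (fun i j => V.gamHat (a + i + j) *
          (V.annT P i (PowerSeries.coeff n W.gam) * V.annT P j g)) (n + 1) M fun i j h => by
        rw [hT i j h, mul_zero],
      Finset.sum_subset (Finset.range_subset_range.mpr hnL)]
    · refine Finset.sum_congr rfl fun l _ => ?_
      rw [osc_eq_sum P V _ g M hM, Finset.mul_sum, Finset.smul_sum]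
      refine Finset.sum_congr rfl fun j _ => ?_
      rw [annT_gam]
      split_ifs with hl
      · rw [← Nat.cast_sub hl, gamHat_natCast, MvPolynomial.smul_eq_C_mul]
        ring
      · rw [W.gamHat_eq_zero (κ := (n : ℂ) - l)]
        · simp
        · intro k hk
          have : (n : ℂ) = (k + l : ℕ) := by push_cast; linear_combination hk
          have : n = k + l := by exact_mod_cast this
          omega
    · intro l _ hl
      refine Finset.sum_eq_zero fun j _ => ?_
      rw [hT l j (Or.inl (by simpa using hl)), mul_zero]
  · push Not at hκ
    rw [gamHat_eq_zero W hκ, zero_mul, ← oscL_apply, map_zero]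
    symm
    refine Finset.sum_eq_zero fun l _ => ?_
    rw [gamHat_eq_zero W fun k hk => hκ (k + l) (by push_cast; linear_combination hk), zero_mul,
      smul_zero]

/-- Wick's theorem for single modes. Any large enough cutoff may be used, because for large `l` the
index `b - l` is out of reach of the creation part of `W`; the freedom lets several cutoffs be
merged later. -/
lemma osc_osc (P : Params) (V W : Vertex) (a b : ℂ) (p : OscPoly) :
    ∃ L₀ : ℕ, ∀ L, L₀ ≤ L → V.osc P a (W.osc P b p) = ∑ l ∈ Finset.range L,
      PowerSeries.coeff l (con P V W) • nord P V W (a + l) (b - l) p := by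
  obtain ⟨M, hM⟩ := exists_annT_annT_eq_zero P V W p
  obtain ⟨K, hK⟩ := exists_nat_gt (‖b‖ + M)
  refine ⟨K, fun L hL => ?_⟩
  -- Annihilation index `0` of `V` is the identity, so the joint bound also bounds `W` alone.
  have hW : ∀ n, M ≤ n → W.annT P n p = 0 := fun n hn => by
    rw [← annT_zero P V (W.annT P n p), hM 0 n (Or.inr hn)]
  have hnL : ∀ n ∈ Finset.range M, ‖b + (n : ℂ)‖ < L := by
    intro n hn
    refine (norm_add_le _ _).trans_lt ?_
    rw [Complex.norm_natCast]
    have h1 : (n : ℝ) ≤ M := by exact_mod_cast (Finset.mem_range.mp hn).le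
    have h2 : (K : ℝ) ≤ L := by exact_mod_cast hL
    linarith
  rw [osc_eq_sum P W b p M hW, ← oscL_apply, map_sum]
  simp only [oscL_apply]
  rw [Finset.sum_congr rfl fun (n : ℕ) hn =>
      osc_gamHat_mul P V W a (b + n) (W.annT P n p) L (hnL n hn),
    Finset.sum_comm]
  refine Finset.sum_congr rfl fun l _ => ?_
  rw [← Finset.smul_sum, nord_eq_sum P V W _ _ p M hM, Finset.sum_comm]
  congr 1
  refine Finset.sum_congr rfl fun n _ => ?_
  rw [osc_eq_sum P V _ _ M fun m hm => hM m n (Or.inl hm), Finset.mul_sum]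
  refine Finset.sum_congr rfl fun m _ => ?_
  rw [mul_left_comm, add_sub_right_comm]

/-- A nonzero coefficient needs natural creation degrees at both points, so the indices are bounded
below by `-M`. -/
lemma nord_ne_zero (P : Params) (V W : Vertex) (p : OscPoly) :
    ∃ M : ℕ, ∀ a b, nord P V W a b p ≠ 0 →
      ∃ m n k l : ℕ, m < M ∧ n < M ∧ a + m = k ∧ b + n = l := by
  obtain ⟨M, hM⟩ := exists_annT_annT_eq_zero P V W p
  refine ⟨M, fun a b h => ?_⟩
  rw [nord_eq_sum P V W a b p M hM] at h
  obtain ⟨m, hm, h⟩ := Finset.exists_ne_zero_of_sum_ne_zero h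
  obtain ⟨n, hn, h⟩ := Finset.exists_ne_zero_of_sum_ne_zero h
  obtain ⟨k, hk⟩ := V.exists_of_gamHat_ne_zero (left_ne_zero_of_mul h)
  obtain ⟨l, hl⟩ := W.exists_of_gamHat_ne_zero (left_ne_zero_of_mul (right_ne_zero_of_mul h))
  exact ⟨m, n, k, l, Finset.mem_range.mp hm, Finset.mem_range.mp hn, hk, hl⟩

/-- The antidiagonals of a normally ordered product are finitely supported. -/
lemma exists_nord_eq_zero (P : Params) (V W : Vertex) (a b : ℂ) (p : OscPoly) :
    ∃ K : ℕ, ∀ n : ℤ, (K : ℤ) ≤ |n| → nord P V W (a + n) (b - n) p = 0 := by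
  obtain ⟨M, hM⟩ := nord_ne_zero P V W p
  -- For `|n|` beyond this bound, one of the real parts of `a + n` and `b - n` drops below `-M`.
  obtain ⟨K, hK⟩ := exists_nat_gt (|a.re| + |b.re| + M)
  refine ⟨K, fun n hn => ?_⟩
  by_contra hc
  obtain ⟨m, m', k, l, hm, hm', h1, h2⟩ := hM _ _ hc
  have h1 := congrArg Complex.re h1
  have h2 := congrArg Complex.re h2
  simp only [Complex.add_re, Complex.sub_re, Complex.natCast_re, Complex.intCast_re] at h1 h2
  have hk : (0 : ℝ) ≤ k := Nat.cast_nonneg k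
  have hl : (0 : ℝ) ≤ l := Nat.cast_nonneg l
  have hm : (m : ℝ) < M := by exact_mod_cast hm
  have hm' : (m' : ℝ) < M := by exact_mod_cast hm'
  have hn : (K : ℝ) ≤ |(n : ℝ)| := by exact_mod_cast hn
  have ha := abs_le.mp (le_refl |a.re|)
  have hb := abs_le.mp (le_refl |b.re|)
  rcases abs_cases (n : ℝ) with h | h <;> linarith [abs_nonneg a.re, abs_nonneg b.re]

/-! ### Weights -/

abbrev oscWeight : Osc → ℕ := fun b => b.2

lemma gam_homogeneous (V : Vertex) (n : ℕ) :
    MvPolynomial.IsWeightedHomogeneous oscWeight (PowerSeries.coeff n V.gam) n := by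
  have hgen : ∀ m, MvPolynomial.IsWeightedHomogeneous oscWeight (V.creGen m) m := by
    intro m
    unfold creGen
    split_ifs with h
    · refine MvPolynomial.IsWeightedHomogeneous.sum _ _ _ fun a _ => ?_
      rw [MvPolynomial.smul_eq_C_mul]
      have := (MvPolynomial.isWeightedHomogeneous_C oscWeight ((V.cre a m : ℝ) : ℂ)).mul
        (MvPolynomial.isWeightedHomogeneous_X ℂ oscWeight (a, (⟨m, h⟩ : ℕ+)))
      rwa [zero_add] at this
    · exact MvPolynomial.isWeightedHomogeneous_zero _ _ _
  have hsmul : ∀ (c : ℂ) (p : OscPoly) (m : ℕ), MvPolynomial.IsWeightedHomogeneous oscWeight p m →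
      MvPolynomial.IsWeightedHomogeneous oscWeight (c • p) m := by
    intro c p m h
    rw [MvPolynomial.smul_eq_C_mul]
    simpa using (MvPolynomial.isWeightedHomogeneous_C oscWeight c).mul h
  induction n using Nat.strong_induction_on with
  | _ n ih =>
    rcases Nat.eq_zero_or_pos n with rfl | hn
    · rw [V.isExp_gam.zero]
      exact MvPolynomial.isWeightedHomogeneous_one _ _
    · have h := congrArg (PowerSeries.coeff n) V.isExp_gam.eq
      rw [coeff_euler, PowerSeries.coeff_mul] at h
      have hn' : (n : ℂ) ≠ 0 := by exact_mod_cast hn.ne'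
      rw [← inv_smul_smul₀ hn' (PowerSeries.coeff n V.gam), h]
      refine hsmul _ _ _ (MvPolynomial.IsWeightedHomogeneous.sum _ _ _ fun p hp => ?_)
      have hp := Finset.HasAntidiagonal.mem_antidiagonal.mp hp
      rw [coeff_euler, PowerSeries.coeff_mk]
      rcases Nat.eq_zero_or_pos p.1 with h0 | h0
      · rw [h0]
        simpa using MvPolynomial.isWeightedHomogeneous_zero _ _ _
      · rw [← hp]
        exact (hsmul _ _ _ (hgen _)).mul (ih p.2 (by omega))

/-- Multiplication by a creation coefficient of degree `n` raises weights by `n`. For a fixed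
monomial this bounds the creation degrees, as `exists_annT_eq_zero` bounds the annihilation degrees.
-/
lemma coeff_gam_mul_eq_zero (V : Vertex) (n : ℕ) (g : OscPoly) (μ : Osc →₀ ℕ)
    (h : Finsupp.weight oscWeight μ < n) :
    MvPolynomial.coeff μ (PowerSeries.coeff n V.gam * g) = 0 := by
  classical
  rw [MvPolynomial.coeff_mul]
  refine Finset.sum_eq_zero fun p hp => ?_
  have hp := Finset.HasAntidiagonal.mem_antidiagonal.mp hp
  rw [(gam_homogeneous V n).coeff_eq_zero, zero_mul]
  rw [← hp, map_add] at h
  omega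

lemma exists_of_coeff_gamHat_mul_ne_zero (V : Vertex) (κ : ℂ) (g : OscPoly) (μ : Osc →₀ ℕ)
    (h : MvPolynomial.coeff μ (V.gamHat κ * g) ≠ 0) :
    ∃ n : ℕ, κ = n ∧ n ≤ Finsupp.weight oscWeight μ := by
  obtain ⟨n, rfl⟩ := V.exists_of_gamHat_ne_zero (κ := κ) (by rintro hc; simp [hc] at h)
  refine ⟨n, rfl, ?_⟩
  by_contra hc
  rw [gamHat_natCast] at h
  exact h (coeff_gam_mul_eq_zero V n g μ (not_le.mp hc))

/-- Matrix elements of normally ordered products are Laurent polynomials. -/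
lemma finite_coeff_nord (P : Params) (V W : Vertex) (p : OscPoly) (μ : Osc →₀ ℕ) :
    (Function.support fun ab : ℂ × ℂ =>
      MvPolynomial.coeff μ (nord P V W ab.1 ab.2 p)).Finite := by
  obtain ⟨M, hM⟩ := exists_annT_annT_eq_zero P V W p
  set w := Finsupp.weight oscWeight μ with hw
  have hfin : ((fun i : (ℕ × ℕ) × (ℕ × ℕ) => ((i.1.1 : ℂ) - i.1.2, (i.2.1 : ℂ) - i.2.2)) ''
      ((Finset.range (w + 1) ×ˢ Finset.range M) ×ˢ (Finset.range (w + 1) ×ˢ Finset.range M) :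
        Finset ((ℕ × ℕ) × (ℕ × ℕ)))).Finite := (Finset.finite_toSet _).image _
  refine hfin.subset ?_
  rintro ⟨a, b⟩ h
  rw [Function.mem_support, nord_eq_sum P V W a b p M hM, MvPolynomial.coeff_sum] at h
  obtain ⟨m, hm, h⟩ := Finset.exists_ne_zero_of_sum_ne_zero h
  rw [MvPolynomial.coeff_sum] at h
  obtain ⟨n, hn, h⟩ := Finset.exists_ne_zero_of_sum_ne_zero h
  obtain ⟨k, hk, hk'⟩ := exists_of_coeff_gamHat_mul_ne_zero V _ _ _ h
  rw [mul_left_comm] at h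
  obtain ⟨l, hl, hl'⟩ := exists_of_coeff_gamHat_mul_ne_zero W _ _ _ h
  refine ⟨((k, m), (l, n)), ?_, ?_⟩
  · simp only [Finset.mem_range] at hm hn
    simp only [Finset.coe_product, Finset.coe_range, Set.mem_prod, Set.mem_Iio]
    omega
  · dsimp only at hk hl ⊢
    rw [← hk, ← hl]
    simp

/-! ### Normally ordered products at one point -/

lemma coeff_con_of_contr_eq_zero {P : Params} {V W : Vertex} (h : ∀ m, 0 < m → contr P V W m = 0) (l : ℕ) :
    PowerSeries.coeff l (con P V W) = if l = 0 then 1 else 0 := by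
  have h1 : IsExp (fun m => (contr P V W m : ℂ)) (1 : PowerSeries ℂ) := by
    constructor
    · simp
    · ext n
      have h0 : euler (.mk fun m => (contr P V W m : ℂ)) = 0 := by
        ext m
        rcases Nat.eq_zero_or_pos m with rfl | hm
        · simp
        · simp [h m hm]
      rw [h0, coeff_euler, PowerSeries.coeff_one]
      split_ifs with hn <;> simp [hn]
  rw [(isExp_con P V W).unique h1, PowerSeries.coeff_one]

/-- The index set is left free so that translates of one finite set can serve for all annihilation
degrees in `osc_join`. -/
lemma gamHat_join (V W : Vertex) (κ : ℂ) (s : Finset ℂ) (hs : ∀ n : ℕ, (n : ℝ) ≤ ‖κ‖ → (n : ℂ) ∈ s) :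
    (V.join W).gamHat κ = ∑ d ∈ s, V.gamHat (κ - d) * W.gamHat d := by
  by_cases hκ : ∃ n : ℕ, κ = n
  · obtain ⟨n, rfl⟩ := hκ
    rw [gamHat_natCast, gam_join, PowerSeries.coeff_mul, ← Finset.Nat.sum_antidiagonal_swap,
      Finset.Nat.sum_antidiagonal_eq_sum_range_succ_mk]
    rw [← Finset.sum_subset (s₁ := (Finset.range (n + 1)).map Nat.castEmbedding) (s₂ := s)]
    · rw [Finset.sum_map]
      refine Finset.sum_congr rfl fun l hl => ?_
      have hl : l ≤ n := by simpa [Nat.lt_succ_iff] using hl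
      simp only [Nat.castEmbedding_apply, Prod.fst_swap, Prod.snd_swap]
      rw [← Nat.cast_sub hl, gamHat_natCast, gamHat_natCast]
    · intro d hd
      obtain ⟨l, hl, rfl⟩ := Finset.mem_map.mp hd
      refine hs l ?_
      rw [Complex.norm_natCast]
      have hl : l ≤ n := by simpa [Nat.lt_succ_iff] using hl
      exact_mod_cast hl
    · intro d _ hd
      by_contra hc
      obtain ⟨l, hl⟩ := W.exists_of_gamHat_ne_zero (right_ne_zero_of_mul hc)
      obtain ⟨k, hk⟩ := V.exists_of_gamHat_ne_zero (left_ne_zero_of_mul hc)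
      refine hd (Finset.mem_map.mpr ⟨l, ?_, hl.symm⟩)
      have : (n : ℂ) = (k + l : ℕ) := by push_cast; linear_combination hk + hl
      have : n = k + l := by exact_mod_cast this
      simp only [Finset.mem_range]
      omega
  · push Not at hκ
    rw [gamHat_eq_zero _ hκ]
    symm
    refine Finset.sum_eq_zero fun d _ => ?_
    by_contra hc
    obtain ⟨l, hl⟩ := W.exists_of_gamHat_ne_zero (right_ne_zero_of_mul hc)
    obtain ⟨k, hk⟩ := V.exists_of_gamHat_ne_zero (left_ne_zero_of_mul hc)
    exact hκ (k + l) (by push_cast; linear_combination hk + hl)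

/-- Setting `z₁ = z₂` in a normally ordered product multiplies the creation exponentials and the
annihilation exponentials separately. The total exponent and the vector allow only finitely many
ways to distribute the exponent. -/
lemma osc_join (P : Params) (V W : Vertex) (κ : ℂ) (p : OscPoly) :
    (Function.support fun e : ℂ => nord P V W (κ - e) e p).Finite ∧
      ∑ᶠ e : ℂ, nord P V W (κ - e) e p = (V.join W).osc P κ p := by
  classical
  obtain ⟨M, hM⟩ := exists_annT_annT_eq_zero P V W p
  obtain ⟨B, hB⟩ := exists_nat_gt (‖κ‖ + (M + M : ℕ))
  set s : Finset ℂ := (Finset.range B ×ˢ Finset.range M).image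
    (fun i : ℕ × ℕ => (i.1 : ℂ) - i.2) with hs
  have hnorm : ∀ m ∈ Finset.range M, ∀ n ∈ Finset.range M, ‖κ + (m + n : ℕ)‖ < B := by
    intro m hm n hn
    refine (norm_add_le _ _).trans_lt (lt_of_le_of_lt ?_ hB)
    rw [Complex.norm_natCast]
    have h1 := Finset.mem_range.mp hm
    have h2 := Finset.mem_range.mp hn
    gcongr
  have hsupp : (Function.support fun e : ℂ => nord P V W (κ - e) e p) ⊆ s := by
    intro e he
    rw [Function.mem_support, nord_eq_sum P V W _ _ p M hM] at he
    obtain ⟨m, hm, he⟩ := Finset.exists_ne_zero_of_sum_ne_zero he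
    obtain ⟨n, hn, he⟩ := Finset.exists_ne_zero_of_sum_ne_zero he
    obtain ⟨k, hk⟩ := V.exists_of_gamHat_ne_zero (left_ne_zero_of_mul he)
    obtain ⟨l, hl⟩ := W.exists_of_gamHat_ne_zero (left_ne_zero_of_mul (right_ne_zero_of_mul he))
    refine Finset.mem_coe.mpr (Finset.mem_image.mpr ⟨(l, n), ?_, ?_⟩)
    · refine Finset.mem_product.mpr ⟨Finset.mem_range.mpr ?_, hn⟩
      have h1 : κ + (m + n : ℕ) = (k + l : ℕ) := by push_cast; linear_combination hk + hl
      have h2 := hnorm m hm n hn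
      rw [h1, Complex.norm_natCast] at h2
      have h2 : k + l < B := by exact_mod_cast h2
      dsimp only
      omega
    · dsimp only
      rw [← hl]
      ring
  refine ⟨(Finset.finite_toSet _).subset hsupp, ?_⟩
  have hT : ∀ m, (V.join W).annT P m p = ∑ i ∈ Finset.HasAntidiagonal.antidiagonal m,
      V.annT P i.1 (W.annT P i.2 p) := by
    intro m
    rw [annT_join, LinearMap.sum_apply]
    rfl
  rw [finsum_eq_sum_of_support_subset _ hsupp, osc_eq_sum P (V.join W) κ p (M + M) fun m hm => by
    rw [hT]
    refine Finset.sum_eq_zero fun i hi => hM _ _ ?_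
    have hi := Finset.HasAntidiagonal.mem_antidiagonal.mp hi
    omega]
  have h1 : ∀ m : ℕ, (V.join W).gamHat (κ + m) * (V.join W).annT P m p =
      ∑ i ∈ Finset.HasAntidiagonal.antidiagonal m, (V.join W).gamHat (κ + (i.1 + i.2 : ℕ)) *
        V.annT P i.1 (W.annT P i.2 p) := by
    intro m
    rw [hT, Finset.mul_sum]
    refine Finset.sum_congr rfl fun i hi => ?_
    rw [Finset.HasAntidiagonal.mem_antidiagonal.mp hi]
  simp only [h1]
  rw [sum_range_antidiagonal (fun i j => (V.join W).gamHat (κ + (i + j : ℕ)) *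
    V.annT P i (W.annT P j p)) M M fun i j h => by rw [hM i j h, mul_zero]]
  rw [Finset.sum_congr rfl fun e _ => nord_eq_sum P V W (κ - e) e p M hM, Finset.sum_comm]
  refine Finset.sum_congr rfl fun m hm => ?_
  rw [Finset.sum_comm]
  refine Finset.sum_congr rfl fun n hn => ?_
  rw [gamHat_join V W _ (s.map (addRightEmbedding (n : ℂ))), Finset.sum_map, Finset.sum_mul]
  · refine Finset.sum_congr rfl fun e _ => ?_
    rw [← mul_assoc]
    congr 3
    simp only [addRightEmbedding_apply]
    push_cast
    ring
  · intro l hl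
    refine Finset.mem_map.mpr ⟨(l : ℂ) - n, Finset.mem_image.mpr ⟨(l, n), ?_, rfl⟩, by simp⟩
    have h2 := hl.trans_lt (hnorm m hm n hn)
    exact Finset.mem_product.mpr ⟨Finset.mem_range.mpr (by exact_mod_cast h2), hn⟩

end Vertex

instance : AddCommSemigroup Charge where
  add_assoc a b c := by
    ext
    · exact add_assoc a.p b.p c.p
    · exact add_assoc a.n b.n c.n
    · exact add_assoc a.n₀ b.n₀ c.n₀
    · exact add_assoc a.n₁ b.n₁ c.n₁
    · exact add_assoc a.n₂ b.n₂ c.n₂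
  add_comm a b := by
    ext
    · exact add_comm a.p b.p
    · exact add_comm a.n b.n
    · exact add_comm a.n₀ b.n₀
    · exact add_comm a.n₁ b.n₁
    · exact add_comm a.n₂ b.n₂

namespace Vertex

/-- The zero mode exponents are linear in the charge. -/
structure IsLinear (V : Vertex) : Prop where
  x_add : ∀ q q', V.xExp (q + q') = V.xExp q + V.xExp q'
  z_add : ∀ q q', V.zExp (q + q') = V.zExp q + V.zExp q'

/-- `V` acts on a charge already shifted by `W`. Linearity of the exponents separates the extra
factor `x^{V.xExp W.shift}` and the extra power of `z₁` from the zero modes of `:V(z₁) W(z₂):`. -/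
lemma toLin_toLin {P : Params} (hx : 0 < P.x) {V W : Vertex} (hV : V.IsLinear) (c d : ℂ)
    (q : Charge) (p : OscPoly) :
    ∃ L₀ : ℕ, ∀ L, L₀ ≤ L → V.toLin P c (W.toLin P d (Finsupp.single q p)) =
      Finsupp.single (q + (V.shift + W.shift))
        ((((P.x ^ V.xExp W.shift : ℝ) : ℂ) * ((P.x ^ (V.xExp q + W.xExp q) : ℝ) : ℂ)) •
          ∑ l ∈ Finset.range L, PowerSeries.coeff l (con P V W) •
            nord P V W (c - V.zExp W.shift - V.zExp q + l) (d - W.zExp q - l) p) := by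
  obtain ⟨L₀, hL⟩ := osc_osc P V W (c - V.zExp W.shift - V.zExp q) (d - W.zExp q) p
  refine ⟨L₀, fun L h => ?_⟩
  rw [← hL L h, toLin_single, toLin_single, ← oscL_apply P V, map_smul, smul_smul, oscL_apply,
    add_assoc q, add_comm W.shift, hV.x_add, hV.z_add, ← Complex.ofReal_mul, ← Complex.ofReal_mul,
    ← Real.rpow_add hx, ← Real.rpow_add hx,
    show V.xExp q + V.xExp W.shift + W.xExp q = V.xExp W.shift + (V.xExp q + W.xExp q) by ring,
    show c - (V.zExp q + V.zExp W.shift) = c - V.zExp W.shift - V.zExp q by ring]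

/-- A product at one point of vertex operators without contraction is normally ordered. -/
lemma toCurrent_mul {P : Params} (hx : 0 < P.x) {V W : Vertex} (hV : V.IsLinear)
    (h : ∀ m, 0 < m → contr P V W m = 0) (hx0 : V.xExp W.shift = 0) (hz0 : V.zExp W.shift = 0)
    (c : ℂ) (v : Fock) :
    (Function.support fun d : ℂ => V.toLin P (c - d) (W.toLin P d v)).Finite ∧
      ∑ᶠ d : ℂ, V.toLin P (c - d) (W.toLin P d v) = (V.join W).toLin P c v := by
  refine finsum_eq_of_single (fun d : ℂ => V.toLin P (c - d) ∘ₗ W.toLin P d) _ (fun q p => ?_) v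
  set s : ℂ := ((P.x ^ (V.xExp q + W.xExp q) : ℝ) : ℂ) with hs
  set φ : OscPoly →+ Fock := (Finsupp.singleAddHom (q + (V.shift + W.shift))).comp
    (DistribSMul.toAddMonoidHom OscPoly s) with hφ
  have hterm : ∀ d, (V.toLin P (c - d) ∘ₗ W.toLin P d) (Finsupp.single q p) =
      φ (nord P V W (c - V.zExp q - W.zExp q - (d - W.zExp q)) (d - W.zExp q) p) := by
    intro d
    obtain ⟨L, hL⟩ := toLin_toLin (W := W) hx hV (c - d) d q p
    -- The cutoff `L + 1` makes sure that the term `l = 0`, the only one that survives, is in the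
    -- range.
    rw [LinearMap.comp_apply, hL (L + 1) (by omega), Finset.sum_range_succ']
    simp only [coeff_con_of_contr_eq_zero h]
    rw [Finset.sum_eq_zero fun l _ => by rw [if_neg (by omega), zero_smul], hx0, hz0]
    simp only [if_true, Real.rpow_zero, Complex.ofReal_one, one_mul, one_smul, zero_add, sub_zero,
      Nat.cast_zero, add_zero]
    rw [show c - V.zExp q - W.zExp q - (d - W.zExp q) = c - d - V.zExp q by ring]
    rfl
  obtain ⟨h1, h2⟩ := osc_join P V W (c - V.zExp q - W.zExp q) p
  have h3 : (Function.support fun d : ℂ =>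
      nord P V W (c - V.zExp q - W.zExp q - (d - W.zExp q)) (d - W.zExp q) p).Finite :=
    h1.preimage (f := fun d : ℂ => d - W.zExp q) (sub_left_injective.injOn)
  constructor
  · refine h3.subset fun d hd => ?_
    rw [Function.mem_support, hterm] at hd
    exact fun hc => hd (by dsimp only at hc; rw [hc, map_zero])
  · simp only [hterm]
    rw [← AddMonoidHom.map_finsum φ h3, toLin_single]
    have h4 := finsum_comp_equiv (Equiv.subRight (W.zExp q))
      (f := fun e => nord P V W (c - V.zExp q - W.zExp q - e) e p)
    simp only [Equiv.subRight_apply] at h4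
    rw [h4, h2, sub_sub]
    rfl

end Vertex

/-! ### The functions `z^c` -/

section zPow

variable {x : ℝ} (hx : 0 < x)
include hx

lemma zPow_eq (u c : ℂ) : zPow x u c = Complex.exp (Real.log x * (2 * u * c)) := by
  have h : (x : ℂ) ≠ 0 := by exact_mod_cast hx.ne'
  rw [zPow, Complex.cpow_def_of_ne_zero h, Complex.ofReal_log hx.le]

lemma zPow_add (u c d : ℂ) : zPow x u (c + d) = zPow x u c * zPow x u d := by
  rw [zPow_eq hx, zPow_eq hx, zPow_eq hx, ← Complex.exp_add]
  ring_nf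

lemma zPow_ne_zero (u c : ℂ) : zPow x u c ≠ 0 := by
  rw [zPow_eq hx]
  exact Complex.exp_ne_zero _

lemma zPow_natCast (u : ℂ) (n : ℕ) : zPow x u n = zPow x u 1 ^ n := by
  rw [zPow_eq hx, zPow_eq hx, ← Complex.exp_nat_mul]
  ring_nf

lemma zPow_neg (u c : ℂ) : zPow x u (-c) = (zPow x u c)⁻¹ := by
  rw [zPow_eq hx, zPow_eq hx, ← Complex.exp_neg]
  ring_nf

lemma differentiable_zPow_fst (c : ℂ) : Differentiable ℂ fun u : ℂ × ℂ => zPow x u.1 c := by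
  simp only [zPow_eq hx]
  fun_prop

lemma differentiable_zPow_snd (c : ℂ) : Differentiable ℂ fun u : ℂ × ℂ => zPow x u.2 c := by
  simp only [zPow_eq hx]
  fun_prop

end zPow

lemma hasSum_congr_fun {ι : Type*} {f g : ι → ℂ} {a : ℂ} (h : ∀ i, f i = g i) :
    HasSum f a ↔ HasSum g a := by
  rw [funext h]

lemma Fock.coeff_add (q : Charge) (μ : Osc →₀ ℕ) (v w : Fock) :
    Fock.coeff q μ (v + w) = Fock.coeff q μ v + Fock.coeff q μ w := by
  simp [Fock.coeff]

lemma Fock.coeff_sub (q : Charge) (μ : Osc →₀ ℕ) (v w : Fock) :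
    Fock.coeff q μ (v - w) = Fock.coeff q μ v - Fock.coeff q μ w := by
  simp [Fock.coeff]

lemma Fock.coeff_smul (q : Charge) (μ : Osc →₀ ℕ) (c : ℂ) (v : Fock) :
    Fock.coeff q μ (c • v) = c * Fock.coeff q μ v := by
  simp [Fock.coeff]

namespace Vertex

/-! ### Matrix elements of products -/

/-- The matrix elements of `:V(z₁) W(z₂):` on `p`, without the powers of `x`. -/
def laurent (P : Params) (V W : Vertex) (q : Charge) (p : OscPoly) (μ : Osc →₀ ℕ) (u₁ u₂ : ℂ) : ℂ :=
  ∑ᶠ ab : ℂ × ℂ, MvPolynomial.coeff μ (nord P V W ab.1 ab.2 p) *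
    (zPow P.x u₁ (ab.1 + V.zExp q) * zPow P.x u₂ (ab.2 + W.zExp q))

lemma laurent_eq_sum (P : Params) (V W : Vertex) (q : Charge) (p : OscPoly) (μ : Osc →₀ ℕ)
    (u₁ u₂ : ℂ) : laurent P V W q p μ u₁ u₂ =
      ∑ ab ∈ (finite_coeff_nord P V W p μ).toFinset,
        MvPolynomial.coeff μ (nord P V W ab.1 ab.2 p) *
          (zPow P.x u₁ (ab.1 + V.zExp q) * zPow P.x u₂ (ab.2 + W.zExp q)) := by
  refine finsum_eq_sum_of_support_subset _ fun ab hab => ?_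
  simp only [Set.Finite.coe_toFinset]
  exact left_ne_zero_of_mul hab

lemma laurent_comm (P : Params) (V W : Vertex) (q : Charge) (p : OscPoly) (μ : Osc →₀ ℕ)
    (u₁ u₂ : ℂ) : laurent P V W q p μ u₁ u₂ = laurent P W V q p μ u₂ u₁ := by
  rw [laurent, laurent, ← finsum_comp_equiv (Equiv.prodComm ℂ ℂ)]
  refine finsum_congr fun ab => ?_
  rw [nord_comm]
  simp only [Equiv.prodComm_apply, Prod.fst_swap, Prod.snd_swap]
  ring

lemma differentiable_laurent {P : Params} (hx : 0 < P.x) (V W : Vertex) (q : Charge) (p : OscPoly)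
    (μ : Osc →₀ ℕ) : Differentiable ℂ fun u : ℂ × ℂ => laurent P V W q p μ u.1 u.2 := by
  simp only [laurent_eq_sum]
  refine Differentiable.fun_sum fun ab _ => ?_
  exact ((differentiable_zPow_fst hx _).mul (differentiable_zPow_snd hx _)).const_mul _

/-- A matrix element of the normally ordered product has finitely many exponent pairs, and each is
spread by the contraction series along a ray. So the two-variable series is a finite sum of copies
of the series for `Φ`, with the same convergence. -/
lemma hasSum_matrixElement {P : Params} (hx : 0 < P.x) {V W : Vertex} (hV : V.IsLinear)
    (q : Charge) (p : OscPoly) (μ : Osc →₀ ℕ) (u₁ u₂ : ℂ) {Φ : ℂ}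
    (hΦ : HasSum (fun l => PowerSeries.coeff l (con P V W) *
      (zPow P.x u₂ 1 / zPow P.x u₁ 1) ^ l) Φ) :
    HasSum (fun cd : ℂ × ℂ => Fock.coeff (q + (V.shift + W.shift)) μ
        (V.toLin P cd.1 (W.toLin P cd.2 (Finsupp.single q p))) *
        (zPow P.x u₁ cd.1 * zPow P.x u₂ cd.2))
      (((P.x ^ V.xExp W.shift : ℝ) : ℂ) * ((P.x ^ (V.xExp q + W.xExp q) : ℝ) : ℂ) *
        (laurent P V W q p μ u₁ u₂ * (zPow P.x u₁ (V.zExp W.shift) * Φ))) := by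
  classical
  set s : ℂ := ((P.x ^ V.xExp W.shift : ℝ) : ℂ) * ((P.x ^ (V.xExp q + W.xExp q) : ℝ) : ℂ)
  set T := (finite_coeff_nord P V W p μ).toFinset with hT
  set ζ := V.zExp W.shift
  set K : ℂ × ℂ → ℂ := fun ab => MvPolynomial.coeff μ (nord P V W ab.1 ab.2 p) with hK
  set e : ℕ → ℂ := fun l => PowerSeries.coeff l (con P V W) with he
  -- The exponents of `z₁, z₂` reached from the pair `ab` by the term `(z₂/z₁)^l` of the
  -- contraction.
  let h : ℂ × ℂ → ℕ → ℂ × ℂ := fun ab l => (ab.1 + V.zExp q + ζ - l, ab.2 + W.zExp q + l)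
  have hinj : ∀ ab, Function.Injective (h ab) := by
    intro ab l l' hl
    have := congrArg Prod.snd hl
    simp only [h, add_right_inj] at this
    exact_mod_cast this
  have hK0 : ∀ ab, ab ∉ T → K ab = 0 := by
    intro ab hab
    by_contra hc
    exact hab ((finite_coeff_nord P V W p μ).mem_toFinset.mpr hc)
  have hone : ∀ ab, HasSum (fun cd : ℂ × ℂ => Function.extend (h ab) e 0 cd *
      (zPow P.x u₁ cd.1 * zPow P.x u₂ cd.2))
      (zPow P.x u₁ (ab.1 + V.zExp q) * zPow P.x u₂ (ab.2 + W.zExp q) * (zPow P.x u₁ ζ * Φ)) := by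
    intro ab
    rw [← (hinj ab).hasSum_iff]
    · rw [← mul_assoc]
      refine (hasSum_congr_fun fun l => ?_).mpr (hΦ.mul_left _)
      simp only [Function.comp_apply, (hinj ab).extend_apply]
      simp only [h, e, sub_eq_add_neg _ (l : ℂ), zPow_add hx, zPow_neg hx, zPow_natCast hx, div_pow]
      ring
    · intro cd hcd
      rw [Function.extend_apply' _ _ _ (by simpa using hcd)]
      simp
  have hsum := (hasSum_sum (s := T) fun ab _ => (hone ab).mul_left (K ab)).mul_left s
  have hval : s * ∑ ab ∈ T, K ab * (zPow P.x u₁ (ab.1 + V.zExp q) * zPow P.x u₂ (ab.2 + W.zExp q) *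
      (zPow P.x u₁ ζ * Φ)) = s * (laurent P V W q p μ u₁ u₂ * (zPow P.x u₁ ζ * Φ)) := by
    rw [laurent_eq_sum, Finset.sum_mul]
    congr 1
    exact Finset.sum_congr rfl fun ab _ => (mul_assoc _ _ _).symm
  rw [hval] at hsum
  refine (hasSum_congr_fun fun cd => ?_).mpr hsum
  · obtain ⟨L₀, hL₀⟩ := toLin_toLin (W := W) hx hV cd.1 cd.2 q p
    -- If a ray passes through `cd`, its parameter is the difference of the second exponents; this
    -- bound covers all rays at once.
    obtain ⟨L₁, hL₁⟩ := exists_nat_gt (‖cd.2 - W.zExp q‖ + ∑ ab ∈ T, ‖ab.2‖)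
    rw [hL₀ (max L₀ L₁) (le_max_left _ _), Fock.coeff, Finsupp.single_eq_same,
      MvPolynomial.coeff_smul, MvPolynomial.coeff_sum, smul_eq_mul, mul_assoc]
    congr 1
    have h1 : ∀ l : ℕ, MvPolynomial.coeff μ (PowerSeries.coeff l (con P V W) •
        nord P V W (cd.1 - ζ - V.zExp q + l) (cd.2 - W.zExp q - l) p) =
        ∑ ab ∈ T, K ab * if h ab l = cd then e l else 0 := by
      intro l
      rw [MvPolynomial.coeff_smul, smul_eq_mul]
      change e l * K (cd.1 - ζ - V.zExp q + l, cd.2 - W.zExp q - l) = _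
      have hiff : ∀ ab, h ab l = cd ↔ ab = (cd.1 - ζ - V.zExp q + l, cd.2 - W.zExp q - l) := by
        intro ab
        constructor
        · rintro rfl
          simp only [h]
          ext <;> dsimp only <;> ring
        · rintro rfl
          simp only [h]
          ext <;> dsimp only <;> ring
      simp only [hiff]
      rw [Finset.sum_eq_single (cd.1 - ζ - V.zExp q + l, cd.2 - W.zExp q - l)]
      · rw [if_pos rfl, mul_comm]
      · intro ab _ hab
        rw [if_neg hab, mul_zero]
      · intro hc
        rw [hK0 _ hc, zero_mul]
    rw [Finset.sum_congr rfl fun l _ => h1 l, Finset.sum_comm, Finset.sum_mul]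
    refine Finset.sum_congr rfl fun ab hab => ?_
    rw [← Finset.mul_sum, mul_assoc]
    congr 2
    by_cases hc : ∃ l, h ab l = cd
    · obtain ⟨l, rfl⟩ := hc
      rw [(hinj ab).extend_apply, Finset.sum_eq_single l]
      · rw [if_pos rfl]
      · intro l' _ hl'
        rw [if_neg fun hc => hl' (hinj ab hc)]
      · intro hc
        exfalso
        refine hc (Finset.mem_range.mpr (lt_max_of_lt_right ?_))
        have h2 : (l : ℂ) = ((h ab l).2 - W.zExp q) - ab.2 := by
          simp only [h]
          ring
        have h3 : (l : ℝ) < L₁ := by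
          rw [← Complex.norm_natCast, h2]
          refine (norm_sub_le _ _).trans_lt (lt_of_le_of_lt ?_ hL₁)
          gcongr
          exact Finset.single_le_sum (f := fun ab : ℂ × ℂ => ‖ab.2‖)
            (fun _ _ => norm_nonneg _) hab
        exact_mod_cast h3
    · rw [Function.extend_apply' _ _ _ hc]
      push Not at hc
      exact Finset.sum_eq_zero fun l _ => if_neg (hc l)

end Vertex

/-! ### Exchange relations -/

/-- The exchange relation for one pair of matrix elements, with given denominator `g`. -/
def Continues (x : ℝ) (L R : ℂ → ℂ → ℂ) (ρ : ℝ) (g : ℂ × ℂ → ℂ) (a b : ℂ × ℂ → ℂ) : Prop :=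
  ∃ f : ℂ × ℂ → ℂ, Differentiable ℂ f ∧
    (∀ u₁ u₂ : ℂ, ‖zPow x u₂ 1‖ < ρ * ‖zPow x u₁ 1‖ →
      ∃ S : ℂ, HasSum (fun cd => a cd * (zPow x u₁ cd.1 * zPow x u₂ cd.2)) S ∧
        g (u₁, u₂) * (L u₁ u₂ * S) = f (u₁, u₂)) ∧
    (∀ u₁ u₂ : ℂ, ‖zPow x u₁ 1‖ < ρ * ‖zPow x u₂ 1‖ →
      ∃ S : ℂ, HasSum (fun cd => b cd * (zPow x u₁ cd.1 * zPow x u₂ cd.2)) S ∧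
        g (u₁, u₂) * (R u₁ u₂ * S) = f (u₁, u₂))

namespace Continues

variable {x : ℝ} {L R : ℂ → ℂ → ℂ} {ρ : ℝ} {g : ℂ × ℂ → ℂ} {a b a' b' : ℂ × ℂ → ℂ}

lemma zero : Continues x L R ρ g (fun _ => 0) (fun _ => 0) :=
  ⟨0, differentiable_const 0, fun _ _ _ => ⟨0, by simp [hasSum_zero], by simp⟩,
    fun _ _ _ => ⟨0, by simp [hasSum_zero], by simp⟩⟩

lemma add (h : Continues x L R ρ g a b) (h' : Continues x L R ρ g a' b') :
    Continues x L R ρ g (fun cd => a cd + a' cd) (fun cd => b cd + b' cd) := by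
  obtain ⟨f, hf, h1, h2⟩ := h
  obtain ⟨f', hf', h1', h2'⟩ := h'
  refine ⟨f + f', hf.add hf', fun u₁ u₂ hu => ?_, fun u₁ u₂ hu => ?_⟩
  · obtain ⟨S, hS, hS1⟩ := h1 u₁ u₂ hu
    obtain ⟨S', hS', hS1'⟩ := h1' u₁ u₂ hu
    refine ⟨S + S', ?_, by rw [Pi.add_apply, ← hS1, ← hS1']; ring⟩
    simpa only [add_mul] using hS.add hS'
  · obtain ⟨S, hS, hS1⟩ := h2 u₁ u₂ hu
    obtain ⟨S', hS', hS1'⟩ := h2' u₁ u₂ hu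
    refine ⟨S + S', ?_, by rw [Pi.add_apply, ← hS1, ← hS1']; ring⟩
    simpa only [add_mul] using hS.add hS'

lemma smul (h : Continues x L R ρ g a b) (s : ℂ) :
    Continues x L R ρ g (fun cd => s * a cd) (fun cd => s * b cd) := by
  obtain ⟨f, hf, h1, h2⟩ := h
  refine ⟨fun u => s * f u, hf.const_mul s, fun u₁ u₂ hu => ?_, fun u₁ u₂ hu => ?_⟩
  · obtain ⟨S, hS, hS1⟩ := h1 u₁ u₂ hu
    refine ⟨s * S, ?_, by dsimp only; rw [← hS1]; ring⟩
    simpa only [mul_assoc] using hS.mul_left s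
  · obtain ⟨S, hS, hS1⟩ := h2 u₁ u₂ hu
    refine ⟨s * S, ?_, by dsimp only; rw [← hS1]; ring⟩
    simpa only [mul_assoc] using hS.mul_left s

end Continues

/-- Analytic continuation of the contractions of a pair of vertex operators. -/
def ContractionsContinue (P : Params) (L R : ℂ → ℂ → ℂ) (ρ : ℝ) (g : ℂ × ℂ → ℂ) (V W : Vertex) :
    Prop :=
  ∃ F : ℂ × ℂ → ℂ, Differentiable ℂ F ∧
    (∀ u₁ u₂ : ℂ, ‖zPow P.x u₂ 1‖ < ρ * ‖zPow P.x u₁ 1‖ →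
      ∃ Φ : ℂ, HasSum (fun l => PowerSeries.coeff l (Vertex.con P V W) *
          (zPow P.x u₂ 1 / zPow P.x u₁ 1) ^ l) Φ ∧
        g (u₁, u₂) * (L u₁ u₂ * (((P.x ^ V.xExp W.shift : ℝ) : ℂ) *
          (zPow P.x u₁ (V.zExp W.shift) * Φ))) = F (u₁, u₂)) ∧
    (∀ u₁ u₂ : ℂ, ‖zPow P.x u₁ 1‖ < ρ * ‖zPow P.x u₂ 1‖ →
      ∃ Φ : ℂ, HasSum (fun l => PowerSeries.coeff l (Vertex.con P W V) *
          (zPow P.x u₁ 1 / zPow P.x u₂ 1) ^ l) Φ ∧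
        g (u₁, u₂) * (R u₁ u₂ * (((P.x ^ W.xExp V.shift : ℝ) : ℂ) *
          (zPow P.x u₂ (W.zExp V.shift) * Φ))) = F (u₁, u₂))

/-- Both orders give the same finite sum of monomials, from the common normally ordered product,
times a scalar. The entire function continuing the scalar therefore continues every matrix element,
with the same `g` and `ρ`. -/
lemma ContractionsContinue.continues {P : Params} (hx : 0 < P.x) {L R : ℂ → ℂ → ℂ} {ρ : ℝ}
    {g : ℂ × ℂ → ℂ} {V W : Vertex} (hV : V.IsLinear) (hW : W.IsLinear)
    (h : ContractionsContinue P L R ρ g V W) (v : Fock) (q : Charge) (μ : Osc →₀ ℕ) :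
    Continues P.x L R ρ g (fun cd => Fock.coeff q μ (V.toLin P cd.1 (W.toLin P cd.2 v)))
      (fun cd => Fock.coeff q μ (W.toLin P cd.2 (V.toLin P cd.1 v))) := by
  induction v using Finsupp.induction_linear with
  | zero => simpa [Fock.coeff] using Continues.zero
  | add v w hv hw => simpa only [map_add, Fock.coeff_add] using hv.add hw
  | single q₀ p =>
    by_cases hq : q = q₀ + (V.shift + W.shift)
    · subst hq
      obtain ⟨F, hF, h1, h2⟩ := h
      refine ⟨fun u => ((P.x ^ (V.xExp q₀ + W.xExp q₀) : ℝ) : ℂ) *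
        (Vertex.laurent P V W q₀ p μ u.1 u.2 * F u),
        ((Vertex.differentiable_laurent hx V W q₀ p μ).mul hF).const_mul _,
        fun u₁ u₂ hu => ?_, fun u₁ u₂ hu => ?_⟩
      · obtain ⟨Φ, hΦ, hΦ1⟩ := h1 u₁ u₂ hu
        refine ⟨_, Vertex.hasSum_matrixElement hx hV q₀ p μ u₁ u₂ hΦ, ?_⟩
        dsimp only
        rw [← hΦ1]
        ring
      · obtain ⟨Φ, hΦ, hΦ1⟩ := h2 u₁ u₂ hu
        have h3 := Vertex.hasSum_matrixElement hx hW q₀ p μ u₂ u₁ hΦ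
        rw [← (Equiv.prodComm ℂ ℂ).hasSum_iff, add_comm W.shift] at h3
        refine ⟨_, (hasSum_congr_fun fun cd => ?_).mp h3, ?_⟩
        · simp only [Function.comp_apply, Equiv.prodComm_apply, Prod.fst_swap, Prod.snd_swap]
          ring
        · dsimp only
          rw [← hΦ1, Vertex.laurent_comm P W V, add_comm (W.xExp q₀)]
          ring
    · have h1 : ∀ cd : ℂ × ℂ, Fock.coeff q μ
          (V.toLin P cd.1 (W.toLin P cd.2 (Finsupp.single q₀ p))) = 0 := by
        intro cd
        obtain ⟨L, hL⟩ := Vertex.toLin_toLin (W := W) hx hV cd.1 cd.2 q₀ p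
        rw [hL L le_rfl, Fock.coeff, Finsupp.single_eq_of_ne hq, MvPolynomial.coeff_zero]
      have h2 : ∀ cd : ℂ × ℂ, Fock.coeff q μ
          (W.toLin P cd.2 (V.toLin P cd.1 (Finsupp.single q₀ p))) = 0 := by
        intro cd
        obtain ⟨L, hL⟩ := Vertex.toLin_toLin (W := V) hx hW cd.2 cd.1 q₀ p
        rw [hL L le_rfl, add_comm W.shift, Fock.coeff, Finsupp.single_eq_of_ne hq,
          MvPolynomial.coeff_zero]
      simpa only [h1, h2] using Continues.zero

/-- Continuation is linear in the matrix elements once `g` and `ρ` are fixed, so the four pairs of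
terms add up with their signs. -/
theorem exchangeRelation_of_contractions {P : Params} (hx : 0 < P.x) {L R : ℂ → ℂ → ℂ} {ρ : ℝ}
    (hρ : 0 < ρ) {g : ℂ × ℂ → ℂ} (hg : Differentiable ℂ g) (hg0 : g ≠ 0) {A B : Current}
    {V₁ V₂ W₁ W₂ : Vertex} {s t : ℂ}
    (hA : ∀ c v, A c v = s • (V₁.toLin P c v - V₂.toLin P c v))
    (hB : ∀ c v, B c v = t • (W₁.toLin P c v - W₂.toLin P c v))
    (hV₁ : V₁.IsLinear) (hV₂ : V₂.IsLinear) (hW₁ : W₁.IsLinear) (hW₂ : W₂.IsLinear)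
    (h11 : ContractionsContinue P L R ρ g V₁ W₁) (h12 : ContractionsContinue P L R ρ g V₁ W₂)
    (h21 : ContractionsContinue P L R ρ g V₂ W₁) (h22 : ContractionsContinue P L R ρ g V₂ W₂) :
    ExchangeRelation P.x L R A B := by
  refine ⟨ρ, hρ, g, hg, hg0, fun v q μ => ?_⟩
  have h := ((((h11.continues hx hV₁ hW₁ v q μ).add ((h12.continues hx hV₁ hW₂ v q μ).smul (-1))).add
    ((h21.continues hx hV₂ hW₁ v q μ).smul (-1))).add (h22.continues hx hV₂ hW₂ v q μ)).smul (s * t)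
  obtain ⟨f, hf, h1, h2⟩ := h
  refine ⟨f, hf, fun u₁ u₂ hu => ?_, fun u₁ u₂ hu => ?_⟩
  · obtain ⟨S, hS, hS1⟩ := h1 u₁ u₂ hu
    refine ⟨S, ?_, hS1⟩
    refine (hasSum_congr_fun fun cd => ?_).mpr hS
    simp only [hA, hB, map_smul, map_sub, Fock.coeff_smul, Fock.coeff_sub, smul_sub]
    ring
  · obtain ⟨S, hS, hS1⟩ := h2 u₁ u₂ hu
    refine ⟨S, ?_, hS1⟩
    refine (hasSum_congr_fun fun cd => ?_).mpr hS
    simp only [hA, hB, map_smul, map_sub, Fock.coeff_smul, Fock.coeff_sub, smul_sub]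
    ring

/-! ### Commutators -/

lemma finsum_int_eq_sum {M : Type*} [AddCommMonoid M] (f : ℤ → M) (N : ℕ)
    (h : ∀ n : ℤ, (N : ℤ) ≤ |n| → f n = 0) :
    ∑ᶠ n, f n = ∑ l ∈ Finset.range N, f l + ∑ l ∈ Finset.range N, f (-((l : ℤ) + 1)) := by
  classical
  rw [finsum_eq_sum_of_support_subset f (s := (Finset.range N).image (fun l : ℕ => (l : ℤ)) ∪
    (Finset.range N).image (fun l : ℕ => -((l : ℤ) + 1)))]
  · rw [Finset.sum_union, Finset.sum_image, Finset.sum_image]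
    · intro l _ l' _ hl
      dsimp only at hl
      omega
    · intro l _ l' _ hl
      dsimp only at hl
      omega
    · refine Finset.disjoint_left.mpr fun n hn hn' => ?_
      obtain ⟨l, _, rfl⟩ := Finset.mem_image.mp hn
      obtain ⟨l', _, hl⟩ := Finset.mem_image.mp hn'
      omega
  · intro n hn
    have hn : |n| < N := by
      by_contra hc
      exact hn (h n (not_lt.mp hc))
    rw [abs_lt] at hn
    simp only [Finset.coe_union, Finset.coe_image, Finset.coe_range, Set.mem_union, Set.mem_image,
      Set.mem_Iio]
    rcases le_or_gt 0 n with h0 | h0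
    · exact Or.inl ⟨n.toNat, by omega, by omega⟩
    · exact Or.inr ⟨(-n - 1).toNat, by omega, by omega⟩

/-- By Wick's theorem both products are combinations of the same normally ordered coefficients along
one antidiagonal. The product `V W` supplies the indices `n > 0`, the product `W V` the indices `n <
0`, and `n = 0` carries the difference of the two zero-mode factors. -/
lemma Vertex.finsum_delta {P : Params} (hx : 0 < P.x) {V W : Vertex} (hV : V.IsLinear)
    (hW : W.IsLinear) (hVW : V.zExp W.shift = 0) (hWV : W.zExp V.shift = 0) {κ : ℂ} {y : ℝ}
    (h0 : ((P.x ^ V.xExp W.shift : ℝ) : ℂ) - ((P.x ^ W.xExp V.shift : ℝ) : ℂ) = κ)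
    (hpos : ∀ l : ℕ, 0 < l → ((P.x ^ V.xExp W.shift : ℝ) : ℂ) *
      PowerSeries.coeff l (con P V W) = κ * ((y ^ (l : ℤ) : ℝ) : ℂ))
    (hneg : ∀ l : ℕ, 0 < l → ((P.x ^ W.xExp V.shift : ℝ) : ℂ) *
      PowerSeries.coeff l (con P W V) = -(κ * ((y ^ (-(l : ℤ)) : ℝ) : ℂ)))
    (c d : ℂ) (v : Fock) :
    ∑ᶠ n : ℤ, (κ * ((y ^ n : ℝ) : ℂ)) • nordLin P V W (c + n) (d - n) v =
      V.toLin P c (W.toLin P d v) - W.toLin P d (V.toLin P c v) := by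
  refine (finsum_eq_of_single (fun n : ℤ => (κ * ((y ^ n : ℝ) : ℂ)) • nordLin P V W (c + n) (d - n))
    (V.toLin P c ∘ₗ W.toLin P d - W.toLin P d ∘ₗ V.toLin P c) (fun q p => ?_) v).2
  obtain ⟨L₁, hL₁⟩ := toLin_toLin (W := W) hx hV c d q p
  obtain ⟨L₂, hL₂⟩ := toLin_toLin (W := V) hx hW d c q p
  set a := c - V.zExp q with ha
  set b := d - W.zExp q with hb
  obtain ⟨K, hK⟩ := exists_nord_eq_zero P V W a b p
  set s : ℂ := ((P.x ^ (V.xExp q + W.xExp q) : ℝ) : ℂ) with hs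
  set q' := q + (V.shift + W.shift) with hq'
  set N := L₁ + L₂ + K with hN
  have hterm : ∀ n : ℤ, ((κ * ((y ^ n : ℝ) : ℂ)) • nordLin P V W (c + n) (d - n))
      (Finsupp.single q p) = Finsupp.single q' ((κ * ((y ^ n : ℝ) : ℂ)) •
        s • nord P V W (a + n) (b - n) p) := by
    intro n
    rw [LinearMap.smul_apply, nordLin_single, Finsupp.smul_single, ha, hb, add_sub_right_comm,
      sub_right_comm]
  have hzero : ∀ n : ℤ, (N : ℤ) ≤ |n| → ((κ * ((y ^ n : ℝ) : ℂ)) • nordLin P V W (c + n) (d - n))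
      (Finsupp.single q p) = 0 := by
    intro n hn
    rw [hterm, hK n (by omega)]
    simp
  refine ⟨(Set.finite_Icc (-(N : ℤ)) N).subset fun n hn => ?_, ?_⟩
  · rw [Set.mem_Icc, ← abs_le]
    by_contra hc
    exact hn (hzero n (by omega))
  rw [finsum_int_eq_sum _ N hzero]
  simp only [hterm]
  -- The cutoff for `W V` is one larger because its term `l = 0` is split off; the others correspond
  -- to `n = -(l + 1)`.
  rw [LinearMap.sub_apply, LinearMap.comp_apply, LinearMap.comp_apply, hL₁ N (by omega),
    hL₂ (N + 1) (by omega), add_comm W.shift, ← single_sum, ← single_sum, ← Finsupp.single_add,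
    ← Finsupp.single_sub, add_comm (W.xExp q), hVW, hWV, Finset.sum_range_succ' _ N]
  congr 1
  have e0 : ∀ A B : Vertex, PowerSeries.coeff 0 (con P A B) = 1 := fun A B => (isExp_con P A B).zero
  rw [smul_add, Finset.smul_sum, Finset.smul_sum, e0]
  have hN0 : (1 : ℂ) • nord P W V (d - 0 - W.zExp q + (0 : ℕ)) (c - V.zExp q - (0 : ℕ)) p
      = nord P V W a b p := by
    rw [one_smul, nord_comm, Nat.cast_zero, add_zero, sub_zero, sub_zero]
  rw [hN0]
  have hneg' : ∀ l : ℕ, (((P.x ^ W.xExp V.shift : ℝ) : ℂ) * s) •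
      (PowerSeries.coeff (l + 1) (con P W V) • nord P W V (d - 0 - W.zExp q + (l + 1 : ℕ))
        (c - V.zExp q - (l + 1 : ℕ)) p) = -((κ * ((y ^ (-((l : ℤ) + 1)) : ℝ) : ℂ)) •
        s • nord P V W (a + (-((l : ℤ) + 1) : ℤ)) (b - (-((l : ℤ) + 1) : ℤ)) p) := by
    intro l
    rw [nord_comm, smul_smul, smul_smul, ← neg_smul, mul_right_comm, hneg (l + 1) (by omega)]
    congr 1
    · push_cast
      ring
    · congr 1
      · push_cast
        ring
      · push_cast
        ring
  -- At `l = 0` the factor of `V W` is `κ` plus the factor of `W V`. The surplus cancels the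
  -- split-off term of `W V`.
  have hpos' : ∀ l : ℕ, (((P.x ^ V.xExp W.shift : ℝ) : ℂ) * s) •
      (PowerSeries.coeff l (con P V W) • nord P V W (c - 0 - V.zExp q + l)
        (d - W.zExp q - l) p) = (κ * ((y ^ (l : ℤ) : ℝ) : ℂ)) •
        s • nord P V W (a + (l : ℤ)) (b - (l : ℤ)) p + if l = 0 then
          (((P.x ^ W.xExp V.shift : ℝ) : ℂ) * s) • nord P V W a b p else 0 := by
    intro l
    rw [sub_zero, smul_smul, smul_smul, mul_right_comm]
    rcases Nat.eq_zero_or_pos l with rfl | hl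
    · rw [if_pos rfl, ← h0, e0]
      simp only [Nat.cast_zero, Int.cast_zero, add_zero, sub_zero, zpow_zero, Complex.ofReal_one,
        ← add_smul]
      congr 1
      ring
    · rw [if_neg hl.ne', hpos l hl, add_zero]
      simp only [Int.cast_natCast]
      rfl
  rw [Finset.sum_congr rfl fun l _ => hneg' l, Finset.sum_congr rfl fun l _ => hpos' l,
    Finset.sum_add_distrib, Finset.sum_neg_distrib]
  have hlast : ∑ l ∈ Finset.range N, (if l = 0 then
      (((P.x ^ W.xExp V.shift : ℝ) : ℂ) * s) • nord P V W a b p else 0) =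
      (((P.x ^ W.xExp V.shift : ℝ) : ℂ) * s) • nord P V W a b p := by
    rcases Nat.eq_zero_or_pos N with hN0 | hN0
    · have := hK 0 (by simp; omega)
      simp only [Int.cast_zero, add_zero, sub_zero] at this
      rw [this, smul_zero]
      simp
    · rw [Finset.sum_ite_eq' (Finset.range N) 0, if_pos (by simpa using hN0)]
  rw [hlast]
  abel

lemma mulDelta_eq {P : Params} (V W : Vertex) (κ : ℂ) (y : ℝ) (c d : ℂ) (v : Fock) :
    κ • mulDelta (V.normalOrdered P W) y c d v =
      ∑ᶠ n : ℤ, (κ * ((y ^ n : ℝ) : ℂ)) • Vertex.nordLin P V W (c + n) (d - n) v := by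
  rw [mulDelta, smul_finsum]
  exact finsum_congr fun n => by rw [Vertex.normalOrdered_eq, smul_smul]

/-- The contractions of `V(z₁) W(z₂)` and `W(z₂) V(z₁)` differ by `κ δ(y z₂ / z₁)`. -/
structure ContractionsDelta (P : Params) (V W : Vertex) (κ : ℂ) (y : ℝ) : Prop where
  left : V.zExp W.shift = 0
  right : W.zExp V.shift = 0
  zero : ((P.x ^ V.xExp W.shift : ℝ) : ℂ) - ((P.x ^ W.xExp V.shift : ℝ) : ℂ) = κ
  pos : ∀ l : ℕ, 0 < l → ((P.x ^ V.xExp W.shift : ℝ) : ℂ) *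
    PowerSeries.coeff l (Vertex.con P V W) = κ * ((y ^ (l : ℤ) : ℝ) : ℂ)
  neg : ∀ l : ℕ, 0 < l → ((P.x ^ W.xExp V.shift : ℝ) : ℂ) *
    PowerSeries.coeff l (Vertex.con P W V) = -(κ * ((y ^ (-(l : ℤ)) : ℝ) : ℂ))

lemma ContractionsDelta.commutator {P : Params} (hx : 0 < P.x) {V W : Vertex} {κ : ℂ} {y : ℝ}
    (h : ContractionsDelta P V W κ y) (hV : V.IsLinear) (hW : W.IsLinear) (c d : ℂ) (v : Fock) :
    V.toLin P c (W.toLin P d v) - W.toLin P d (V.toLin P c v) =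
      κ • mulDelta (V.normalOrdered P W) y c d v := by
  rw [mulDelta_eq, Vertex.finsum_delta hx hV hW h.left h.right h.zero h.pos h.neg]

/-! ### Convergence of exponential series -/

lemma hasSum_coeff_pow {𝕜 : Type*} [RCLike 𝕜] (F : PowerSeries 𝕜) (w S : 𝕜)
    (h : HasSum (fun n => PowerSeries.coeff n F * w ^ n) S)
    (hn : Summable fun n => ‖PowerSeries.coeff n F * w ^ n‖) (i : ℕ) :
    HasSum (fun n => PowerSeries.coeff n (F ^ i) * w ^ n) (S ^ i) ∧
      Summable fun n => ‖PowerSeries.coeff n (F ^ i) * w ^ n‖ := by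
  induction i with
  | zero =>
    have h1 : (fun n => PowerSeries.coeff n (F ^ 0) * w ^ n) = fun n => if n = 0 then 1 else 0 := by
      funext n
      rw [pow_zero, PowerSeries.coeff_one]
      split_ifs with h <;> simp [h]
    rw [h1, pow_zero]
    refine ⟨hasSum_ite_eq 0 1, ?_⟩
    refine summable_of_ne_finset_zero (s := {0}) fun n hn => ?_
    rw [congrFun h1 n, if_neg (by simpa using hn), norm_zero]
  | succ i ih =>
    have h1 : ∀ n, PowerSeries.coeff n (F ^ (i + 1)) * w ^ n =
        ∑ p ∈ Finset.HasAntidiagonal.antidiagonal n,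
          (PowerSeries.coeff p.1 (F ^ i) * w ^ p.1) * (PowerSeries.coeff p.2 F * w ^ p.2) := by
      intro n
      rw [pow_succ, PowerSeries.coeff_mul, Finset.sum_mul]
      refine Finset.sum_congr rfl fun p hp => ?_
      rw [← Finset.HasAntidiagonal.mem_antidiagonal.mp hp, pow_add]
      ring
    have h2 := summable_norm_sum_mul_antidiagonal_of_summable_norm ih.2 hn
    have h3 := tsum_mul_tsum_eq_tsum_sum_antidiagonal_of_summable_norm ih.2 hn
    simp only [← h1] at h2 h3
    refine ⟨?_, h2⟩
    rw [ih.1.tsum_eq, h.tsum_eq] at h3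
    rw [pow_succ S i, h3]
    exact h2.of_norm.hasSum

lemma norm_coeff_pow_le (F : PowerSeries ℂ) (G : PowerSeries ℝ)
    (h : ∀ n, ‖PowerSeries.coeff n F‖ ≤ PowerSeries.coeff n G) (i n : ℕ) :
    ‖PowerSeries.coeff n (F ^ i)‖ ≤ PowerSeries.coeff n (G ^ i) := by
  induction i generalizing n with
  | zero =>
    rw [pow_zero, pow_zero, PowerSeries.coeff_one, PowerSeries.coeff_one]
    split_ifs <;> simp
  | succ i ih =>
    rw [pow_succ, pow_succ, PowerSeries.coeff_mul, PowerSeries.coeff_mul]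
    refine (norm_sum_le _ _).trans (Finset.sum_le_sum fun p _ => ?_)
    rw [norm_mul]
    exact mul_le_mul (ih _) (h _) (norm_nonneg _) ((norm_nonneg _).trans (ih _))

lemma hasSum_exp_series (z : ℂ) :
    HasSum (fun i : ℕ => ((i.factorial : ℂ)⁻¹) * z ^ i) (Complex.exp z) := by
  have := NormedSpace.expSeries_div_hasSum_exp z
  rw [← Complex.exp_eq_exp_ℂ] at this
  simpa only [div_eq_inv_mul] using this

lemma summable_prod_of_hasSum (G : ℕ → ℕ → ℝ) (c S : ℕ → ℝ) (hc : ∀ i, 0 ≤ c i)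
    (hG0 : ∀ i n, 0 ≤ G i n) (hG : ∀ i, HasSum (G i) (S i)) (hS : Summable fun i => c i * S i) :
    Summable fun p : ℕ × ℕ => c p.1 * G p.1 p.2 := by
  rw [summable_prod_of_nonneg fun p => mul_nonneg (hc p.1) (hG0 p.1 p.2)]
  refine ⟨fun i => ?_, ?_⟩
  · exact (hG i).summable.mul_left (c i)
  · refine hS.congr fun i => ?_
    exact ((hG i).mul_left (c i)).tsum_eq.symm

lemma exists_hasSum_of_summable_prod (T : ℕ → ℕ → ℂ) (a b : ℕ → ℂ)
    (h : Summable fun p : ℕ × ℕ => T p.1 p.2) (ha : ∀ j, HasSum (T j) (a j))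
    (hb : ∀ n, HasSum (fun j => T j n) (b n)) : ∃ S, HasSum a S ∧ HasSum b S :=
  ⟨_, h.hasSum.prod_fiberwise ha,
    ((Equiv.prodComm ℕ ℕ).hasSum_iff.mpr h.hasSum).prod_fiberwise hb⟩

lemma hasSum_of_hasSum_prod (G : ℕ → ℕ → ℂ) (c S e : ℕ → ℂ) {E : ℂ}
    (hG : ∀ i, HasSum (G i) (S i)) (hE : HasSum (fun i => c i * S i) E)
    (h : Summable fun p : ℕ × ℕ => c p.1 * G p.1 p.2)
    (he : ∀ l, HasSum (fun i => c i * G i l) (e l)) : HasSum e E := by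
  have h4 := h.hasSum
  have h5 := h4.prod_fiberwise fun i => (hG i).mul_left (c i)
  rw [h5.unique hE, ← (Equiv.prodComm ℕ ℕ).hasSum_iff] at h4
  exact h4.prod_fiberwise he

/-- The absolute values of the coefficients form a majorant series with some sum `B` at `‖w‖`, and
the double series of its exponential is dominated by `∑ B^i / i!`. This permits interchanging the
sums over powers and over degrees. -/
lemma summable_exp_coeff_pow (F : PowerSeries ℂ) (w : ℂ)
    (h : Summable fun n => ‖PowerSeries.coeff n F * w ^ n‖) :
    Summable fun p : ℕ × ℕ => ((p.1.factorial : ℂ)⁻¹) *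
      (PowerSeries.coeff p.2 (F ^ p.1) * w ^ p.2) := by
  obtain ⟨G, hG⟩ : ∃ G : PowerSeries ℝ, ∀ n, PowerSeries.coeff n G = ‖PowerSeries.coeff n F‖ :=
    ⟨.mk fun n => ‖PowerSeries.coeff n F‖, fun n => PowerSeries.coeff_mk _ _⟩
  have h2n : Summable fun n => ‖PowerSeries.coeff n G * ‖w‖ ^ n‖ := by
    refine h.congr fun n => ?_
    rw [hG, norm_mul, norm_mul, norm_pow, norm_pow, norm_norm, norm_norm]
  have hFG := norm_coeff_pow_le F G fun n => (hG n).ge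
  obtain ⟨B, hB⟩ := h2n.of_norm
  have hs := summable_prod_of_hasSum (fun i n => PowerSeries.coeff n (G ^ i) * ‖w‖ ^ n)
    (fun i => (i.factorial : ℝ)⁻¹) (fun i => B ^ i) (fun i => inv_nonneg.mpr (Nat.cast_nonneg _))
    (fun i n => mul_nonneg ((norm_nonneg _).trans (hFG i n)) (pow_nonneg (norm_nonneg _) _))
    (fun i => (hasSum_coeff_pow G ‖w‖ B hB h2n i).1)
    ((Real.summable_pow_div_factorial B).congr fun i => (div_eq_inv_mul _ _))
  refine Summable.of_norm_bounded hs fun p => ?_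
  rw [norm_mul, norm_inv, Complex.norm_natCast, norm_mul, norm_pow]
  exact mul_le_mul_of_nonneg_left (mul_le_mul_of_nonneg_right (hFG _ _)
    (pow_nonneg (norm_nonneg _) _)) (inv_nonneg.mpr (Nat.cast_nonneg _))

/-- The sum of the exponential of a power series. -/
lemma hasSum_expC {a : ℕ → ℂ} {w S : ℂ} (h : HasSum (fun m => a (m + 1) * w ^ (m + 1)) S) :
    HasSum (fun l => expC a l * w ^ l) (Complex.exp S) := by
  obtain ⟨F, hF⟩ : ∃ F : PowerSeries ℂ, F = PowerSeries.mk fun m => if m = 0 then 0 else a m :=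
    ⟨_, rfl⟩
  have hF0 : PowerSeries.coeff 0 F = 0 := by rw [hF, PowerSeries.coeff_mk, if_pos rfl]
  have hFs : ∀ m, PowerSeries.coeff (m + 1) F = a (m + 1) := fun m => by
    rw [hF, PowerSeries.coeff_mk, if_neg (Nat.succ_ne_zero m)]
  have h1 : HasSum (fun n => PowerSeries.coeff n F * w ^ n) S := by
    rw [← hasSum_nat_add_iff' 1]
    simpa [hFs, hF0] using h
  have h1n : Summable fun n => ‖PowerSeries.coeff n F * w ^ n‖ := h1.summable.norm
  refine hasSum_of_hasSum_prod (fun i n => PowerSeries.coeff n (F ^ i) * w ^ n) _ _ _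
    (fun i => (hasSum_coeff_pow F w S h1 h1n i).1) (hasSum_exp_series S)
    (summable_exp_coeff_pow F w h1n) fun l => ?_
  have h6 : expC a l * w ^ l = ∑ i ∈ Finset.range (l + 1),
      ((i.factorial : ℂ)⁻¹) * (PowerSeries.coeff l (F ^ i) * w ^ l) := by
    rw [expC, Finset.sum_mul, hF]
    exact Finset.sum_congr rfl fun i _ => by rw [smul_eq_mul, mul_assoc]
  rw [h6]
  -- In degree `l` only the powers `i ≤ l` contribute, since `F` has no constant term.
  refine hasSum_sum_of_ne_finset_zero fun i hi => ?_
  rw [coeff_pow_eq_zero hF0 (by simpa using hi), zero_mul, mul_zero]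

/-- `exp(∑_{m>0} a_m w^m) = φ`, with convergence. -/
def ExpSum (a : ℕ → ℂ) (w φ : ℂ) : Prop :=
  ∃ S, HasSum (fun m => a (m + 1) * w ^ (m + 1)) S ∧ Complex.exp S = φ

namespace ExpSum

variable {a b : ℕ → ℂ} {w φ ψ : ℂ}

lemma hasSum (h : ExpSum a w φ) : HasSum (fun l => expC a l * w ^ l) φ := by
  obtain ⟨S, hS, rfl⟩ := h
  exact hasSum_expC hS

lemma ne_zero (h : ExpSum a w φ) : φ ≠ 0 := by
  obtain ⟨S, hS, rfl⟩ := h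
  exact Complex.exp_ne_zero S

lemma add (h : ExpSum a w φ) (h' : ExpSum b w ψ) : ExpSum (fun m => a m + b m) w (φ * ψ) := by
  obtain ⟨S, hS, rfl⟩ := h
  obtain ⟨T, hT, rfl⟩ := h'
  refine ⟨S + T, ?_, Complex.exp_add _ _⟩
  simpa only [add_mul] using hS.add hT

lemma sub (h : ExpSum a w φ) (h' : ExpSum b w ψ) : ExpSum (fun m => a m - b m) w (φ / ψ) := by
  obtain ⟨S, hS, rfl⟩ := h
  obtain ⟨T, hT, rfl⟩ := h'
  refine ⟨S - T, ?_, Complex.exp_sub _ _⟩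
  simpa only [sub_mul] using hS.sub hT

lemma congr (h : ExpSum a w φ) (hab : ∀ m, 0 < m → b m = a m) : ExpSum b w φ := by
  obtain ⟨S, hS, rfl⟩ := h
  exact ⟨S, (hasSum_congr_fun fun m => by rw [hab _ (Nat.succ_pos m)]).mpr hS, rfl⟩

lemma geom {y : ℂ} (h : ‖y * w‖ < 1) : ExpSum (fun m => y ^ m / m) w (1 - y * w)⁻¹ := by
  have h1 := Complex.hasSum_taylorSeries_neg_log h
  rw [← hasSum_nat_add_iff' 1] at h1
  refine ⟨_, (hasSum_congr_fun fun m => ?_).mp (by simpa using h1), ?_⟩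
  · push_cast
    rw [mul_pow]
    ring
  · have h0 : (1 : ℂ) - y * w ≠ 0 := by
      intro hc
      rw [← sub_eq_zero.mp hc] at h
      simp at h
    rw [Complex.exp_neg, Complex.exp_log h0]

end ExpSum

/-! ### Infinite products -/

lemma summable_geometric_mul_geometric {a b : ℝ} (ha : 0 ≤ a) (ha1 : a < 1) (hb : 0 ≤ b)
    (hb1 : b < 1) : Summable fun p : ℕ × ℕ => a ^ p.1 * b ^ p.2 := by
  have h : Summable fun j : ℕ => a ^ j := summable_geometric_of_lt_one ha ha1
  have h' : Summable fun j : ℕ => b ^ j := summable_geometric_of_lt_one hb hb1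
  exact h.mul_of_nonneg h' (fun j => pow_nonneg ha j) (fun j => pow_nonneg hb j)

section qPoch

variable {q : ℂ} (hq : ‖q‖ < 1)
include hq

lemma summable_norm_qPoch (z : ℂ) : Summable fun j : ℕ => ‖-(q ^ j * z)‖ := by
  simp only [norm_neg, norm_mul, norm_pow]
  exact (summable_geometric_of_lt_one (norm_nonneg _) hq).mul_right _

lemma qPoch_eq_mul (z : ℂ) : qPoch z q = (1 - z) * qPoch (q * z) q := by
  obtain ⟨f, hf⟩ : ∃ f : ℕ → ℂ, ∀ j, f j = 1 - q ^ j * z := ⟨_, fun _ => rfl⟩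
  have h1 : (fun j : ℕ => 1 + -(q ^ j * (q * z))) = fun j => f (j + 1) :=
    funext fun j => by rw [hf]; ring
  have h2 : Multipliable fun j : ℕ => f (j + 1) := by
    rw [← h1]
    exact multipliable_one_add_of_summable (summable_norm_qPoch hq (q * z))
  have h3 : qPoch z q = ∏' j, f j := tprod_congr fun j => (hf j).symm
  have h4 : qPoch (q * z) q = ∏' j, f (j + 1) :=
    tprod_congr fun j => by rw [hf]; ring
  rw [h3, h4, tprod_eq_zero_mul' h2, hf 0, pow_zero, one_mul]

/-- The product converges locally uniformly, dominated on compact sets by a geometric series. -/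
lemma differentiable_qPoch : Differentiable ℂ fun z => qPoch z q := by
  have h : HasProdLocallyUniformlyOn (fun (j : ℕ) z => 1 + -(q ^ j * z))
      (fun z => ∏' j : ℕ, (1 + -(q ^ j * z))) Set.univ := by
    refine hasProdLocallyUniformlyOn_of_forall_compact isOpen_univ fun K _ hK => ?_
    obtain ⟨C, hC⟩ := hK.isBounded.exists_norm_le
    refine ((summable_geometric_of_lt_one (norm_nonneg _) hq).mul_right C).hasProdUniformlyOn_nat_one_add
      hK (.of_forall fun n x hx => ?_) fun _ => by fun_prop
    rw [norm_neg, norm_mul, norm_pow]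
    exact mul_le_mul_of_nonneg_left (hC x hx) (by positivity)
  have h2 := h.differentiableOn (.of_forall fun s => by
    simpa [Finset.prod_fn] using DifferentiableOn.finsetProd (fun _ _ => by fun_prop)) isOpen_univ
  rw [differentiableOn_univ] at h2
  have h3 : (fun z => qPoch z q) = fun z => ∏' j : ℕ, (1 + -(q ^ j * z)) :=
    funext fun z => tprod_congr fun j => by ring
  rw [h3]
  exact h2

lemma norm_qPoch_term_le {z : ℂ} (h : ‖z‖ < 1) (j n : ℕ) :
    ‖(q ^ j * z) ^ (n + 1) / (n + 1 : ℕ)‖ ≤ ‖q‖ ^ j * ‖z‖ ^ n := by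
  have hd : (1 : ℝ) ≤ ‖((n + 1 : ℕ) : ℂ)‖ := by
    rw [Complex.norm_natCast]
    exact_mod_cast Nat.le_add_left 1 n
  have h1 : ‖q ^ j * z‖ ^ (n + 1) ≤ ‖q‖ ^ j * ‖z‖ ^ n := by
    rw [norm_mul, norm_pow, mul_pow, ← pow_mul]
    refine mul_le_mul ?_ ?_ (pow_nonneg (norm_nonneg _) _) (pow_nonneg (norm_nonneg _) _)
    · exact pow_le_pow_of_le_one (norm_nonneg _) hq.le (Nat.le_mul_of_pos_right _ (Nat.succ_pos _))
    · exact pow_le_pow_of_le_one (norm_nonneg _) h.le (Nat.le_succ _)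
  rw [norm_div, norm_pow]
  exact (div_le_self (pow_nonneg (norm_nonneg _) _) hd).trans h1

lemma summable_qPoch_terms {z : ℂ} (h : ‖z‖ < 1) (T : ℕ → ℕ → ℂ)
    (hT : ∀ j n, T j n = (q ^ j * z) ^ (n + 1) / (n + 1 : ℕ)) :
    Summable fun p : ℕ × ℕ => T p.1 p.2 := by
  have h1 := summable_geometric_mul_geometric (norm_nonneg q) hq (norm_nonneg z) h
  have h2 : ∀ p : ℕ × ℕ, ‖T p.1 p.2‖ ≤ ‖q‖ ^ p.1 * ‖z‖ ^ p.2 := fun p => by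
    rw [hT]
    exact norm_qPoch_term_le hq h p.1 p.2
  exact Summable.of_norm_bounded h1 h2

/-- Expanding `1 / (1 - q^m)` as a geometric series gives a double sum. Summed over `m` first it is
`-∑ log(1 - q^j y w)`, whose exponential is the inverse infinite product. -/
lemma ExpSum.qPoch {y w : ℂ} (h : ‖y * w‖ < 1) :
    ExpSum (fun m => y ^ m / (m * (1 - q ^ m))) w (LevelK.qPoch (y * w) q)⁻¹ := by
  obtain ⟨T, hT⟩ : ∃ T : ℕ → ℕ → ℂ, ∀ j n, T j n = (q ^ j * (y * w)) ^ (n + 1) / (n + 1 : ℕ) :=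
    ⟨_, fun _ _ => rfl⟩
  have hqj : ∀ j : ℕ, ‖q ^ j * (y * w)‖ < 1 := by
    intro j
    rw [norm_mul, norm_pow]
    exact (mul_le_of_le_one_left (norm_nonneg _) (pow_le_one₀ (norm_nonneg _) hq.le)).trans_lt h
  have hj : ∀ j : ℕ, HasSum (T j) (-Complex.log (1 - q ^ j * (y * w))) := by
    intro j
    have h1 := Complex.hasSum_taylorSeries_neg_log (hqj j)
    rw [← hasSum_nat_add_iff' 1] at h1
    refine (hasSum_congr_fun fun n => hT j n).mpr ?_
    simpa using h1
  have hn : ∀ n : ℕ, HasSum (fun j => T j n)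
      (y ^ (n + 1) / ((n + 1 : ℕ) * (1 - q ^ (n + 1))) * w ^ (n + 1)) := by
    intro n
    have h1 : ‖q ^ (n + 1)‖ < 1 := by
      rw [norm_pow]
      exact pow_lt_one₀ (norm_nonneg _) hq (Nat.succ_ne_zero n)
    have h2 := (hasSum_geometric_of_norm_lt_one h1).mul_right ((y * w) ^ (n + 1) / (n + 1 : ℕ))
    have h3 : (1 - q ^ (n + 1))⁻¹ * ((y * w) ^ (n + 1) / (n + 1 : ℕ)) =
        y ^ (n + 1) / ((n + 1 : ℕ) * (1 - q ^ (n + 1))) * w ^ (n + 1) := by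
      rw [mul_pow, ← div_div]
      ring
    rw [← h3]
    refine (hasSum_congr_fun fun j => ?_).mp h2
    rw [hT, mul_pow (q ^ j), ← pow_mul, ← pow_mul, mul_comm (n + 1) j]
    ring
  obtain ⟨S, h1, h2⟩ := exists_hasSum_of_summable_prod T _ _
    (summable_qPoch_terms hq h T hT) hj hn
  refine ⟨_, h2, ?_⟩
  -- The exponential turns the sum of logarithms into a convergent product, so no choice of branch
  -- for the total logarithm is needed.
  have h3 := h1.neg.cexp
  have h4 : (Complex.exp ∘ fun j : ℕ => -(-Complex.log (1 - q ^ j * (y * w))))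
      = fun j : ℕ => 1 - q ^ j * (y * w) := by
    funext j
    have h0 : (1 : ℂ) - q ^ j * (y * w) ≠ 0 := by
      intro hc
      have := hqj j
      rw [← sub_eq_zero.mp hc, norm_one] at this
      exact lt_irrefl _ this
    simp only [Function.comp_apply, neg_neg, Complex.exp_log h0]
  rw [h4] at h3
  rw [LevelK.qPoch, h3.tprod_eq, Complex.exp_neg, inv_inv]

lemma qPoch_ne_zero {z : ℂ} (h : ‖z‖ < 1) : qPoch z q ≠ 0 := by
  have := (ExpSum.qPoch hq (y := z) (w := 1) (by simpa using h)).ne_zero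
  rw [mul_one] at this
  exact fun hc => this (by rw [hc, inv_zero])

end qPoch

open Vertex

/-! ### Contractions of the vertex operators -/

lemma contr_join_left (P : Params) (V V' W : Vertex) (m : ℕ) :
    contr P (V.join V') W m = contr P V W m + contr P V' W m := by
  simp only [contr, join, add_mul, Finset.sum_add_distrib]

lemma contr_join_right (P : Params) (V W W' : Vertex) (m : ℕ) :
    contr P V (W.join W') m = contr P V W m + contr P V W' m := by
  simp only [contr, join, mul_add, add_mul, Finset.sum_add_distrib]

/-- `[2m]` for `i = j` and `-([sm] + [(s-2)m])` for `i ≠ j`. -/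
def qCartan (P : Params) (i j : Fin 2) (m : ℕ) : ℝ :=
  if i = j then qInt P.x (2 * m) else -(qInt P.x (P.s * m) + qInt P.x ((P.s - 2) * m))

lemma qInt_mul_neg (x a m : ℝ) : qInt x (a * -m) = -qInt x (a * m) := by
  rw [qInt, qInt, mul_neg, neg_neg]
  ring

/-- The defining scalar for the pair `(1, 2)` is odd in `m`, so the value `-g(-m)` for `(2, 1)` is
again `g(m)`. The same holds for `γ`, but not for `α` and `α̃`. -/
lemma bosonComm_beta (P : Params) (i j : Fin 2) (m : ℕ) :
    bosonComm P (.beta, i) (.beta, j) m =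
      qCartan P i j m * qInt P.x ((P.k + 2) * m) / m := by
  simp only [bosonComm, sameKind, qCartan]
  push_cast
  split_ifs
  · rfl
  · ring
  · simp only [qInt_mul_neg, div_neg]
    ring

lemma bosonComm_gamma (P : Params) (i j : Fin 2) (m : ℕ) :
    bosonComm P (.gamma, i) (.gamma, j) m =
      qCartan P i j m / (m * qInt P.x (P.k * m)) := by
  simp only [bosonComm, sameKind, qCartan]
  push_cast
  split_ifs
  · ring
  · ring
  · simp only [qInt_mul_neg, div_neg]
    ring

lemma bosonComm_alpha_alphaT (P : Params) (i : Fin 2) (m : ℕ) :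
    bosonComm P (.alpha, i) (.alphaT, i) m =
      -(qCartan P i i m / (m * qInt P.x (P.k * m))) := by
  simp only [bosonComm, qCartan, if_true]
  push_cast
  ring

lemma bosonComm_alphaT_alpha (P : Params) (i : Fin 2) (m : ℕ) :
    bosonComm P (.alphaT, i) (.alpha, i) m =
      -(qCartan P i i m / (m * qInt P.x (P.k * m))) := by
  simp only [bosonComm, qCartan, if_true]
  push_cast
  ring

lemma contr_of_alpha {P : Params} {V W : Vertex} {a b : Species} {A B : ℝ} {m : ℕ}
    (hV : ∀ c, V.ann c m = if c = a then A else 0) (hW : ∀ c, W.cre c m = if c = b then B else 0) :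
    contr P V W m = A * B * bosonComm P a b m := by
  simp only [contr, hV, hW, ite_mul, mul_ite, zero_mul, mul_zero, Finset.sum_ite_eq',
    Finset.mem_univ, if_true]

lemma ite_ite_eq_add (a b c : Species) (hab : a ≠ b) (A B : ℝ) :
    (if c = a then A else if c = b then B else 0) =
      (if c = a then A else 0) + (if c = b then B else 0) := by
  by_cases h : c = a
  · rw [if_pos h, if_pos h, if_neg (h ▸ hab), add_zero]
  · rw [if_neg h, if_neg h, zero_add]

lemma contr_of_beta_gamma {P : Params} {V W : Vertex} {i j : Fin 2} {A G A' G' : ℝ} {m : ℕ}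
    (hV : ∀ c, V.ann c m = if c = (.beta, i) then A else if c = (.gamma, i) then G else 0)
    (hW : ∀ c, W.cre c m = if c = (.beta, j) then A' else if c = (.gamma, j) then G' else 0) :
    contr P V W m = A * A' * bosonComm P (.beta, i) (.beta, j) m +
      G * G' * bosonComm P (.gamma, i) (.gamma, j) m := by
  have h : ∀ i, ((Boson.beta, i) : Species) ≠ (.gamma, i) := by simp
  have h1 : bosonComm P (.beta, i) (.gamma, j) m = 0 := rfl
  have h2 : bosonComm P (.gamma, i) (.beta, j) m = 0 := rfl
  simp only [contr, hV, hW, ite_ite_eq_add _ _ _ (h _), add_mul, mul_add, ite_mul, mul_ite,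
    zero_mul, mul_zero, Finset.sum_add_distrib, Finset.sum_ite_eq', Finset.mem_univ, if_true, h1, h2]
  ring

section

variable {P : Params} (hx0 : 0 < P.x) (hx1 : P.x < 1)
include hx0

lemma rpow_add_mul (a b m : ℝ) : P.x ^ ((a + b) * m) = P.x ^ (a * m) * P.x ^ (b * m) := by
  rw [add_mul, Real.rpow_add hx0]

lemma rpow_sub_mul (a b m : ℝ) : P.x ^ ((a - b) * m) = P.x ^ (a * m) / P.x ^ (b * m) := by
  rw [sub_mul, Real.rpow_sub hx0]

lemma rpow_mul_natCast (a : ℝ) (m : ℕ) : P.x ^ (a * m) = (P.x ^ a) ^ m := by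
  rw [Real.rpow_mul hx0.le, Real.rpow_natCast]

lemma qInt_eq (a m : ℝ) : qInt P.x (a * m) = (P.x ^ (a * m) - (P.x ^ (a * m))⁻¹) / (P.x - P.x⁻¹) := by
  rw [qInt, Real.rpow_neg hx0.le]

lemma qPlus_eq (a : ℝ) : qPlus P.x a = P.x ^ a + (P.x ^ a)⁻¹ := by
  rw [qPlus, Real.rpow_neg hx0.le]

include hx1

lemma x_sub_inv_ne_zero : P.x - P.x⁻¹ ≠ 0 := by
  have : P.x < P.x⁻¹ := hx1.trans (one_lt_inv_iff₀.mpr ⟨hx0, hx1⟩)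
  exact (sub_neg.mpr this).ne

lemma rpow_ne_one {a : ℝ} (ha : a ≠ 0) : P.x ^ a ≠ 1 := by
  rcases lt_or_gt_of_ne ha with h | h
  · exact (Real.one_lt_rpow_of_pos_of_lt_one_of_neg hx0 hx1 h).ne'
  · exact (Real.rpow_lt_one hx0.le hx1 h).ne

lemma sub_inv_rpow_ne_zero {a : ℝ} (ha : a ≠ 0) : P.x ^ a - (P.x ^ a)⁻¹ ≠ 0 := by
  have h := Real.rpow_pos_of_pos hx0 a
  intro hc
  have h1 : (P.x ^ a) * (P.x ^ a) = 1 := by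
    field_simp at hc
    nlinarith
  rw [← Real.rpow_add hx0] at h1
  exact rpow_ne_one hx0 hx1 (a := a + a) (by intro h; exact ha (by linarith)) h1

/-- The contractions of `Ψ_{i,I}` with `Ψ_{j,II}` and of `Ψ†_{i,I}` with `Ψ†_{j,II}`. -/
lemma beta_gamma_identity {K X : ℝ} (hK : 0 < K) (hX : 0 < X) (hK1 : K - K⁻¹ ≠ 0) (σ m c : ℝ) :
    -(P.x - P.x⁻¹) * (c / (X + X⁻¹)) * ((P.x - P.x⁻¹) * (c / (X + X⁻¹))) *
      (σ * ((K * X ^ 2 - (K * X ^ 2)⁻¹) / (P.x - P.x⁻¹)) / m) +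
      c * ((K * X + (K * X)⁻¹) / (X + X⁻¹)) * (c * ((K * X + (K * X)⁻¹) / (X + X⁻¹))) *
      (σ / (m * ((K - K⁻¹) / (P.x - P.x⁻¹)))) =
      c ^ 2 * (σ / (m * ((K - K⁻¹) / (P.x - P.x⁻¹)))) := by
  have hd := x_sub_inv_ne_zero hx0 hx1
  set d := P.x - P.x⁻¹
  -- At `m = 0` both sides vanish because division by zero gives zero.
  rcases eq_or_ne m 0 with rfl | hm
  · simp
  have h2 : X + X⁻¹ ≠ 0 := by positivity
  -- With `K = x^{km}` and `X = x^m` this is `[(k+1)m]_+² = [m]_+² + (x - x⁻¹)² [(k+2)m][km]`, the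
  -- reason for the chosen coefficients of `β` and `γ`.
  have h3 : (K * X + (K * X)⁻¹) ^ 2 = (X + X⁻¹) ^ 2 + (K * X ^ 2 - (K * X ^ 2)⁻¹) * (K - K⁻¹) := by
    field_simp
    ring
  calc _ = c ^ 2 * σ * d / m / (X + X⁻¹) ^ 2 / (K - K⁻¹) *
        ((K * X + (K * X)⁻¹) ^ 2 - (K * X ^ 2 - (K * X ^ 2)⁻¹) * (K - K⁻¹)) := by
        generalize (K * X + (K * X)⁻¹) = A
        generalize (K * X ^ 2 - (K * X ^ 2)⁻¹) = B
        generalize (K - K⁻¹) = C at *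
        generalize X + X⁻¹ = D at *
        field_simp
        ring
    _ = _ := by
        rw [h3]
        generalize (K * X ^ 2 - (K * X ^ 2)⁻¹) = B
        generalize (K - K⁻¹) = C at *
        generalize X + X⁻¹ = D at *
        field_simp
        ring

end

/-- The scalars `[γ_m^i, γ_{-m}^j]`. -/
def gammaComm (P : Params) (i j : Fin 2) (m : ℕ) : ℝ :=
  qCartan P i j m / (m * qInt P.x (P.k * m))

/-- `[(k+1)m]_+ / [m]_+`. -/
def plusRatio (P : Params) (m : ℕ) : ℝ := qPlus P.x ((P.k + 1) * m) / qPlus P.x m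

/-! ### Contractions among the terms of `Ψ_j` and `Ψ_j†` -/

section

variable {P : Params}

/-- The `β` part of `V` finds nothing to contract with, since `W` creates only `γ`. -/
lemma contr_of_gamma {V W : Vertex} {i j : Fin 2} {G G' : ℝ} {m : ℕ}
    (hV : ∃ A, ∀ c, V.ann c m = if c = (.beta, i) then A else if c = (.gamma, i) then G else 0)
    (hW : ∀ c, W.cre c m = if c = (.gamma, j) then G' else 0) :
    contr P V W m = G * G' * gammaComm P i j m := by
  obtain ⟨A, hV⟩ := hV
  have hW' : ∀ c, W.cre c m = if c = (.beta, j) then 0 else if c = (.gamma, j) then G' else 0 := by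
    intro c
    rw [hW]
    by_cases h : c = (.beta, j)
    · rw [if_pos h, h, if_neg (by simp)]
    · rw [if_neg h]
  rw [contr_of_beta_gamma hV hW', bosonComm_gamma, gammaComm]
  ring

lemma contr_of_gamma' {V W : Vertex} {i j : Fin 2} {G G' : ℝ} {m : ℕ}
    (hV : ∀ c, V.ann c m = if c = (.gamma, i) then G else 0)
    (hW : ∃ A, ∀ c, W.cre c m = if c = (.beta, j) then A else if c = (.gamma, j) then G' else 0) :
    contr P V W m = G * G' * gammaComm P i j m := by
  obtain ⟨A, hW⟩ := hW
  have hV' : ∀ c, V.ann c m = if c = (.beta, i) then 0 else if c = (.gamma, i) then G else 0 := by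
    intro c
    rw [hV]
    by_cases h : c = (.beta, i)
    · rw [if_pos h, h, if_neg (by simp)]
    · rw [if_neg h]
  rw [contr_of_beta_gamma hV' hW, bosonComm_gamma, gammaComm]
  ring

lemma contr_of_gamma'' {V W : Vertex} {i j : Fin 2} {G G' : ℝ} {m : ℕ}
    (hV : ∀ c, V.ann c m = if c = (.gamma, i) then G else 0)
    (hW : ∀ c, W.cre c m = if c = (.gamma, j) then G' else 0) :
    contr P V W m = G * G' * gammaComm P i j m := by
  rw [contr_of_alpha hV hW, bosonComm_gamma, gammaComm]

variable (hx0 : 0 < P.x) (i j : Fin 2) {m : ℕ}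
include hx0

lemma half_mul_half (m : ℕ) :
    P.x ^ (P.k * m / 2) * P.x ^ (P.k * m / 2) = P.x ^ (P.k * m) := by
  rw [← Real.rpow_add hx0, add_halves]

lemma half_mul_neg_half (m : ℕ) : P.x ^ (P.k * m / 2) * P.x ^ (-(P.k * m / 2)) = 1 := by
  rw [← Real.rpow_add hx0, add_neg_cancel, Real.rpow_zero]

lemma neg_half_mul_half (m : ℕ) : P.x ^ (-(P.k * m / 2)) * P.x ^ (P.k * m / 2) = 1 := by
  rw [mul_comm, half_mul_neg_half hx0]

lemma neg_half_mul_neg_half (m : ℕ) :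
    P.x ^ (-(P.k * m / 2)) * P.x ^ (-(P.k * m / 2)) = (P.x ^ (P.k * m))⁻¹ := by
  rw [← Real.rpow_add hx0, ← neg_add, add_halves, Real.rpow_neg hx0.le]

lemma contr_psiI_psiI : contr P (psiI P i) (psiI P j) m = plusRatio P m * gammaComm P i j m := by
  rw [contr_of_gamma ⟨_, fun _ => rfl⟩ fun _ => rfl, plusRatio]
  linear_combination
    (qPlus P.x ((P.k + 1) * m) / qPlus P.x m * gammaComm P i j m) * half_mul_neg_half hx0 m

lemma contr_psiII_psiII :
    contr P (psiII P i) (psiII P j) m = plusRatio P m * gammaComm P i j m := by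
  rw [contr_of_gamma' (fun _ => rfl) ⟨_, fun _ => rfl⟩, plusRatio]
  linear_combination
    (qPlus P.x ((P.k + 1) * m) / qPlus P.x m * gammaComm P i j m) * half_mul_neg_half hx0 m

lemma contr_psiII_psiI :
    contr P (psiII P i) (psiI P j) m = (P.x ^ (P.k * m))⁻¹ * gammaComm P i j m := by
  rw [contr_of_gamma'' (fun _ => rfl) fun _ => rfl]
  linear_combination (gammaComm P i j m) * neg_half_mul_neg_half hx0 m

lemma contr_psiDagI_psiDagI :
    contr P (psiDagI P i) (psiDagI P j) m = plusRatio P m * gammaComm P i j m := by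
  rw [contr_of_gamma ⟨_, fun _ => rfl⟩ fun _ => rfl, plusRatio]
  linear_combination
    (qPlus P.x ((P.k + 1) * m) / qPlus P.x m * gammaComm P i j m) * half_mul_neg_half hx0 m

lemma contr_psiDagII_psiDagII :
    contr P (psiDagII P i) (psiDagII P j) m = plusRatio P m * gammaComm P i j m := by
  rw [contr_of_gamma' (fun _ => rfl) ⟨_, fun _ => rfl⟩, plusRatio]
  linear_combination
    (qPlus P.x ((P.k + 1) * m) / qPlus P.x m * gammaComm P i j m) * half_mul_neg_half hx0 m

lemma contr_psiDagII_psiDagI :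
    contr P (psiDagII P i) (psiDagI P j) m = P.x ^ (P.k * m) * gammaComm P i j m := by
  rw [contr_of_gamma'' (fun _ => rfl) fun _ => rfl]
  linear_combination (gammaComm P i j m) * half_mul_half hx0 m

lemma contr_psiI_psiDagI : contr P (psiI P i) (psiDagI P j) m =
    -(P.x ^ (P.k * m) * plusRatio P m * gammaComm P i j m) := by
  rw [contr_of_gamma ⟨_, fun _ => rfl⟩ fun _ => rfl, plusRatio]
  linear_combination
    (-(qPlus P.x ((P.k + 1) * m) / qPlus P.x m) * gammaComm P i j m) * half_mul_half hx0 m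

lemma contr_psiII_psiDagII : contr P (psiII P i) (psiDagII P j) m =
    -((P.x ^ (P.k * m))⁻¹ * plusRatio P m * gammaComm P i j m) := by
  rw [contr_of_gamma' (fun _ => rfl) ⟨_, fun _ => rfl⟩, plusRatio]
  linear_combination
    (-(qPlus P.x ((P.k + 1) * m) / qPlus P.x m) * gammaComm P i j m) * neg_half_mul_neg_half hx0 m

lemma contr_psiII_psiDagI :
    contr P (psiII P i) (psiDagI P j) m = -gammaComm P i j m := by
  rw [contr_of_gamma'' (fun _ => rfl) fun _ => rfl]
  linear_combination (-gammaComm P i j m) * half_mul_neg_half hx0 m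

lemma contr_psiDagI_psiI : contr P (psiDagI P i) (psiI P j) m =
    -((P.x ^ (P.k * m))⁻¹ * plusRatio P m * gammaComm P i j m) := by
  rw [contr_of_gamma ⟨_, fun _ => rfl⟩ fun _ => rfl, plusRatio]
  linear_combination
    (-(qPlus P.x ((P.k + 1) * m) / qPlus P.x m) * gammaComm P i j m) * neg_half_mul_neg_half hx0 m

lemma contr_psiDagII_psiII : contr P (psiDagII P i) (psiII P j) m =
    -(P.x ^ (P.k * m) * plusRatio P m * gammaComm P i j m) := by
  rw [contr_of_gamma' (fun _ => rfl) ⟨_, fun _ => rfl⟩, plusRatio]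
  linear_combination
    (-(qPlus P.x ((P.k + 1) * m) / qPlus P.x m) * gammaComm P i j m) * half_mul_half hx0 m

lemma contr_psiDagII_psiI :
    contr P (psiDagII P i) (psiI P j) m = -gammaComm P i j m := by
  rw [contr_of_gamma'' (fun _ => rfl) fun _ => rfl]
  linear_combination (-gammaComm P i j m) * half_mul_neg_half hx0 m

variable (hx1 : P.x < 1) (hk : P.k ≠ 0) (hm : 0 < m)
include hx1 hk hm

lemma beta_gamma_sum (c : ℝ) :
    -(P.x - P.x⁻¹) * (c / qPlus P.x m) * ((P.x - P.x⁻¹) * (c / qPlus P.x m)) *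
      bosonComm P (.beta, i) (.beta, j) m +
      c * plusRatio P m * (c * plusRatio P m) * bosonComm P (.gamma, i) (.gamma, j) m =
      c ^ 2 * gammaComm P i j m := by
  have hm' : (m : ℝ) ≠ 0 := by exact_mod_cast hm.ne'
  have hK : 0 < P.x ^ (P.k * m) := Real.rpow_pos_of_pos hx0 _
  have hX : 0 < P.x ^ (m : ℝ) := Real.rpow_pos_of_pos hx0 _
  have h := beta_gamma_identity hx0 hx1 hK hX (sub_inv_rpow_ne_zero hx0 hx1 (mul_ne_zero hk hm'))
    (qCartan P i j m) m c
  have h2 : P.x ^ ((P.k + 2) * m) = P.x ^ (P.k * m) * (P.x ^ (m : ℝ)) ^ 2 := by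
    rw [rpow_add_mul hx0, two_mul, Real.rpow_add hx0, pow_two]
  have h3 : P.x ^ ((P.k + 1) * m) = P.x ^ (P.k * m) * P.x ^ (m : ℝ) := by
    rw [rpow_add_mul hx0, one_mul]
  rw [bosonComm_beta, bosonComm_gamma, plusRatio, gammaComm, qPlus_eq hx0, qPlus_eq hx0,
    qInt_eq hx0, qInt_eq hx0, h2, h3]
  exact h

lemma contr_psiI_psiII :
    contr P (psiI P i) (psiII P j) m = P.x ^ (P.k * m) * gammaComm P i j m := by
  rw [contr_of_beta_gamma (fun _ => rfl) fun _ => rfl]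
  have h := beta_gamma_sum hx0 i j hx1 hk hm (P.x ^ (P.k * m / 2))
  rw [pow_two, half_mul_half hx0] at h
  rw [← h, plusRatio]
  ring

lemma contr_psiDagI_psiDagII :
    contr P (psiDagI P i) (psiDagII P j) m = (P.x ^ (P.k * m))⁻¹ * gammaComm P i j m := by
  rw [contr_of_beta_gamma (fun _ => rfl) fun _ => rfl]
  have h := beta_gamma_sum hx0 i j hx1 hk hm (P.x ^ (-(P.k * m / 2)))
  rw [pow_two, neg_half_mul_neg_half hx0] at h
  rw [← h, plusRatio]
  ring

/-- For `Ψ` against `Ψ†` the half-powers of `x^{km}` cancel. What remains is exactly opposite to the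
contraction of `C_j` with `C_j†`, so the mixed terms of the commutator have no contraction. -/
lemma beta_gamma_sum_mixed {c c' : ℝ} (hc : c * c' = 1) :
    -(P.x - P.x⁻¹) * (c / qPlus P.x m) * (-(P.x - P.x⁻¹) * (c' / qPlus P.x m)) *
      bosonComm P (.beta, i) (.beta, j) m +
      -(c * plusRatio P m) * (c' * plusRatio P m) * bosonComm P (.gamma, i) (.gamma, j) m =
      -gammaComm P i j m := by
  have h := beta_gamma_sum hx0 i j hx1 hk hm 1
  have h1 : c / qPlus P.x m * (c' / qPlus P.x m) = 1 / qPlus P.x m * (1 / qPlus P.x m) := by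
    rw [div_mul_div_comm, hc, div_mul_div_comm, one_mul]
  linear_combination -h + ((P.x - P.x⁻¹) ^ 2 * bosonComm P (.beta, i) (.beta, j) m) * h1 -
    plusRatio P m ^ 2 * bosonComm P (.gamma, i) (.gamma, j) m * hc

lemma contr_psiI_psiDagII :
    contr P (psiI P i) (psiDagII P j) m = -gammaComm P i j m := by
  rw [contr_of_beta_gamma (fun _ => rfl) fun _ => rfl,
    ← beta_gamma_sum_mixed hx0 i j hx1 hk hm (half_mul_neg_half hx0 m), plusRatio]

lemma contr_psiDagI_psiII :
    contr P (psiDagI P i) (psiII P j) m = -gammaComm P i j m := by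
  rw [contr_of_beta_gamma (fun _ => rfl) fun _ => rfl,
    ← beta_gamma_sum_mixed hx0 i j hx1 hk hm (neg_half_mul_half hx0 m), plusRatio]
  ring

end

/-! ### Cancellation of the level `k` between the `α` and `γ` contractions -/

lemma base_jj {K T d m : ℝ} (Y : ℝ) (hK : K ≠ 0) (hT : T ≠ 0) (hd : d ≠ 0) (hm : m ≠ 0)
    (hK1 : K - K⁻¹ ≠ 0) (hT1 : T - T⁻¹ ≠ 0) :
    -(1 / m) * ((Y / d) * ((K * T - (K * T)⁻¹) / d)) / ((K - K⁻¹) / d * ((T - T⁻¹) / d)) +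
      K * (Y / d / (m * ((K - K⁻¹) / d))) = Y / (m * (1 - T ^ 2)) := by
  have e1 : K * (K - K⁻¹) = K ^ 2 - 1 := by field_simp
  have e2 : T * (T - T⁻¹) = T ^ 2 - 1 := by field_simp
  have hK2 : K ^ 2 - 1 ≠ 0 := e1 ▸ mul_ne_zero hK hK1
  have hT2 : T ^ 2 - 1 ≠ 0 := e2 ▸ mul_ne_zero hT hT1
  have hT3 : 1 - T ^ 2 ≠ 0 := by rwa [← neg_sub, neg_ne_zero]
  rw [show K - K⁻¹ = (K ^ 2 - 1) / K by rw [← e1]; field_simp,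
    show T - T⁻¹ = (T ^ 2 - 1) / T by rw [← e2]; field_simp]
  field_simp
  ring

lemma base_ij {T d m : ℝ} (D : ℝ) (hT : T ≠ 0) (hd : d ≠ 0) (hm : m ≠ 0) (hT1 : T - T⁻¹ ≠ 0) :
    1 / m * (T⁻¹ * (D / d) / ((T - T⁻¹) / d)) = -D / (m * (1 - T ^ 2)) ∧
    1 / m * (T * (D / d) / ((T - T⁻¹) / d)) = T ^ 2 * -D / (m * (1 - T ^ 2)) := by
  have e2 : T * (T - T⁻¹) = T ^ 2 - 1 := by field_simp
  have hT2 : T ^ 2 - 1 ≠ 0 := e2 ▸ mul_ne_zero hT hT1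
  have hT3 : 1 - T ^ 2 ≠ 0 := by rwa [← neg_sub, neg_ne_zero]
  rw [show T - T⁻¹ = (T ^ 2 - 1) / T by rw [← e2]; field_simp]
  constructor
  · field_simp
    ring
  · field_simp
    ring

/-- Subtracting `K` or `K⁻¹` from `[(k+1)m]_+ / [m]_+` produces a factor `K - K⁻¹`, which cancels
the `[km]` in the `γ` commutator. -/
lemma ratio_sub {K X d m : ℝ} (σ : ℝ) (hK : K ≠ 0) (hX : 0 < X) (hd : d ≠ 0) (hm : m ≠ 0)
    (hK1 : K - K⁻¹ ≠ 0) :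
    ((K * X + (K * X)⁻¹) / (X + X⁻¹) - K) * (σ / (m * ((K - K⁻¹) / d))) =
      -(σ * d / (m * (1 + X ^ 2))) ∧
    ((K * X + (K * X)⁻¹) / (X + X⁻¹) - K⁻¹) * (σ / (m * ((K - K⁻¹) / d))) =
      X ^ 2 * (σ * d) / (m * (1 + X ^ 2)) := by
  have e1 : K * (K - K⁻¹) = K ^ 2 - 1 := by field_simp
  have hK2 : K ^ 2 - 1 ≠ 0 := e1 ▸ mul_ne_zero hK hK1
  have h2 : X ^ 2 + 1 ≠ 0 := by positivity
  have h3 : 1 + X ^ 2 ≠ 0 := by positivity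
  rw [show K - K⁻¹ = (K ^ 2 - 1) / K by rw [← e1]; field_simp,
    show X + X⁻¹ = (X ^ 2 + 1) / X by field_simp]
  constructor
  · field_simp
    ring
  · field_simp
    ring

/-- The numerator `a^m + e^m - a^{-m} - e^{-m}`. -/
def powerDiff (a e : ℝ) (m : ℕ) : ℝ := a ^ m + e ^ m - a⁻¹ ^ m - e⁻¹ ^ m

/-- The contractions between `V₁ - V₂` and `W₁ - W₂` in an exchange relation. -/
structure ExchangeContr (P : Params) (q a b e : ℝ) (V₁ V₂ W₁ W₂ : Vertex) : Prop where
  h12 : ∀ m, 0 < m → contr P V₁ W₂ m = powerDiff a e m / (m * (1 - q ^ m))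
  h11 : ∀ m, 0 < m → contr P V₁ W₁ m =
    powerDiff a e m / (m * (1 - q ^ m)) - (a ^ m - b ^ m) / m
  h22 : ∀ m, 0 < m → contr P V₂ W₂ m =
    powerDiff a e m / (m * (1 - q ^ m)) - (a ^ m - b ^ m) / m
  h21 : ∀ m, 0 < m → contr P V₂ W₁ m =
    powerDiff a e m / (m * (1 - q ^ m)) - powerDiff a b⁻¹ m / m
  k21 : ∀ m, 0 < m → contr P W₂ V₁ m = q ^ m * powerDiff a e m / (m * (1 - q ^ m))
  k11 : ∀ m, 0 < m → contr P W₁ V₁ m =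
    q ^ m * powerDiff a e m / (m * (1 - q ^ m)) + (b⁻¹ ^ m - a⁻¹ ^ m) / m
  k22 : ∀ m, 0 < m → contr P W₂ V₂ m =
    q ^ m * powerDiff a e m / (m * (1 - q ^ m)) + (b⁻¹ ^ m - a⁻¹ ^ m) / m
  k12 : ∀ m, 0 < m → contr P W₁ V₂ m =
    q ^ m * powerDiff a e m / (m * (1 - q ^ m)) + powerDiff a b⁻¹ m / m

/-- The terms of `E_j`. -/
abbrev eI (P : Params) (j : Fin 2) : Vertex := (cVertex P j).join (psiI P j)

abbrev eII (P : Params) (j : Fin 2) : Vertex := (cVertex P j).join (psiII P j)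

/-- The terms of `F_j`. -/
abbrev fI (P : Params) (j : Fin 2) : Vertex := (cDagVertex P j).join (psiDagI P j)

abbrev fII (P : Params) (j : Fin 2) : Vertex := (cDagVertex P j).join (psiDagII P j)

/-- Vertex operators in the bosons `α`, `α̃` only. -/
def IsAlpha (V : Vertex) : Prop :=
  ∀ i m, V.ann (.beta, i) m = 0 ∧ V.ann (.gamma, i) m = 0 ∧
    V.cre (.beta, i) m = 0 ∧ V.cre (.gamma, i) m = 0

/-- Vertex operators in the bosons `β`, `γ` only. -/
def IsBetaGamma (V : Vertex) : Prop :=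
  ∀ i m, V.ann (.alpha, i) m = 0 ∧ V.ann (.alphaT, i) m = 0 ∧
    V.cre (.alpha, i) m = 0 ∧ V.cre (.alphaT, i) m = 0

lemma isAlpha_cVertex (P : Params) (j : Fin 2) : IsAlpha (cVertex P j) := by
  intro i m
  simp [cVertex]

lemma isAlpha_cDagVertex (P : Params) (j : Fin 2) : IsAlpha (cDagVertex P j) := by
  intro i m
  simp [cDagVertex]

lemma isBetaGamma_psiI (P : Params) (j : Fin 2) : IsBetaGamma (psiI P j) := by
  intro i m
  simp [psiI]

lemma isBetaGamma_psiII (P : Params) (j : Fin 2) : IsBetaGamma (psiII P j) := by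
  intro i m
  simp [psiII]

lemma isBetaGamma_psiDagI (P : Params) (j : Fin 2) : IsBetaGamma (psiDagI P j) := by
  intro i m
  simp [psiDagI]

lemma isBetaGamma_psiDagII (P : Params) (j : Fin 2) : IsBetaGamma (psiDagII P j) := by
  intro i m
  simp [psiDagII]

lemma IsAlpha.contr_eq_zero {P : Params} {V W : Vertex} (hV : IsAlpha V) (hW : IsBetaGamma W)
    (m : ℕ) : contr P V W m = 0 := by
  refine Finset.sum_eq_zero fun a _ => Finset.sum_eq_zero fun b _ => ?_
  obtain ⟨a, i⟩ := a
  obtain ⟨b, j⟩ := b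
  cases a <;> cases b <;> simp [bosonComm, hV i m, hW j m]

lemma IsBetaGamma.contr_eq_zero {P : Params} {V W : Vertex} (hV : IsBetaGamma V) (hW : IsAlpha W)
    (m : ℕ) : contr P V W m = 0 := by
  refine Finset.sum_eq_zero fun a _ => Finset.sum_eq_zero fun b _ => ?_
  obtain ⟨a, i⟩ := a
  obtain ⟨b, j⟩ := b
  cases a <;> cases b <;> simp [bosonComm, hV i m, hW j m]

lemma contr_join_join {P : Params} {V V' W W' : Vertex} (hV : IsAlpha V) (hV' : IsBetaGamma V')
    (hW : IsAlpha W) (hW' : IsBetaGamma W') (m : ℕ) :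
    contr P (V.join V') (W.join W') m = contr P V W m + contr P V' W' m := by
  rw [contr_join_left, contr_join_right, contr_join_right, hV.contr_eq_zero hW',
    hV'.contr_eq_zero hW, add_zero, zero_add]

lemma contr_cVertex_cVertex (P : Params) (i j : Fin 2) (m : ℕ) :
    contr P (cVertex P i) (cVertex P j) m = bosonComm P (.alpha, i) (.alpha, j) m := by
  rw [contr_of_alpha (fun _ => rfl) fun _ => rfl]
  ring

lemma contr_cDagVertex_cDagVertex (P : Params) (i j : Fin 2) (m : ℕ) :
    contr P (cDagVertex P i) (cDagVertex P j) m = bosonComm P (.alphaT, i) (.alphaT, j) m := by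
  rw [contr_of_alpha (fun _ => rfl) fun _ => rfl]
  ring

lemma contr_cVertex_cDagVertex (P : Params) (j : Fin 2) (m : ℕ) :
    contr P (cVertex P j) (cDagVertex P j) m = gammaComm P j j m := by
  rw [contr_of_alpha (fun _ => rfl) fun _ => rfl, bosonComm_alpha_alphaT, gammaComm]
  ring

lemma contr_cDagVertex_cVertex (P : Params) (j : Fin 2) (m : ℕ) :
    contr P (cDagVertex P j) (cVertex P j) m = gammaComm P j j m := by
  rw [contr_of_alpha (fun _ => rfl) fun _ => rfl, bosonComm_alphaT_alpha, gammaComm]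
  ring

lemma gammaComm_comm (P : Params) (i j : Fin 2) (m : ℕ) : gammaComm P i j m = gammaComm P j i m := by
  simp only [gammaComm, qCartan, eq_comm]

section

variable {P : Params} (hx0 : 0 < P.x) (hx1 : P.x < 1) (hk : P.k ≠ 0)
include hx0

lemma rpow_two_mul_natCast (m : ℕ) : P.x ^ (2 * (m : ℝ)) = (P.x ^ 2) ^ m := by
  rw [rpow_mul_natCast hx0, Real.rpow_two]

include hx1

/-- The factor `1 + x^{2m}` is exposed because it cancels the denominator left over from `[m]_+` in
`ratio_sub`. The bases are `1, x⁻²` here and `x^{-s}, x^{s-2}` in the off-diagonal case. -/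
lemma qCartan_self (i : Fin 2) (m : ℕ) : qCartan P i i m * (P.x - P.x⁻¹) =
    (1 + (P.x ^ 2) ^ m) * (1 ^ m - ((P.x ^ 2)⁻¹) ^ m) := by
  have h : 0 < P.x ^ 2 := by positivity
  rw [qCartan, if_pos rfl, qInt_eq hx0, div_mul_cancel₀ _ (x_sub_inv_ne_zero hx0 hx1),
    rpow_two_mul_natCast hx0, one_pow, inv_pow]
  field_simp
  ring

lemma qCartan_ne {i j : Fin 2} (hij : i ≠ j) (m : ℕ) : qCartan P i j m * (P.x - P.x⁻¹) =
    (1 + (P.x ^ 2) ^ m) * (((P.x ^ P.s)⁻¹) ^ m - (P.x ^ P.s / P.x ^ 2) ^ m) := by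
  have h : 0 < P.x ^ 2 := by positivity
  have h' : 0 < P.x ^ P.s := Real.rpow_pos_of_pos hx0 _
  have hd := x_sub_inv_ne_zero hx0 hx1
  rw [qCartan, if_neg hij, qInt_eq hx0, qInt_eq hx0, rpow_sub_mul hx0, rpow_two_mul_natCast hx0,
    rpow_mul_natCast hx0, inv_pow, div_pow]
  rw [← add_div, ← neg_div, div_mul_cancel₀ _ hd]
  field_simp
  ring

include hk

/-- The relation `x² a = b⁻¹` also gives `x² b = a⁻¹`. Thus the factor `x^{2m}` in the second
difference turns `a, b` into `b⁻¹, a⁻¹`, and both differences become logarithms of rational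
functions. -/
lemma gammaComm_sub {i j : Fin 2} {a b : ℝ} (hb : b ≠ 0) (hab : P.x ^ 2 * a = b⁻¹) {m : ℕ}
    (hm : 0 < m)
    (hσ : qCartan P i j m * (P.x - P.x⁻¹) = (1 + (P.x ^ 2) ^ m) * (a ^ m - b ^ m)) :
    (plusRatio P m - P.x ^ (P.k * m)) * gammaComm P i j m = -((a ^ m - b ^ m) / m) ∧
    (plusRatio P m - (P.x ^ (P.k * m))⁻¹) * gammaComm P i j m = (b⁻¹ ^ m - a⁻¹ ^ m) / m := by
  have hm' : (m : ℝ) ≠ 0 := by exact_mod_cast hm.ne'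
  have hK : 0 < P.x ^ (P.k * m) := Real.rpow_pos_of_pos hx0 _
  have hX : 0 < P.x ^ (m : ℝ) := Real.rpow_pos_of_pos hx0 _
  obtain ⟨h1, h2⟩ := ratio_sub (qCartan P i j m) hK.ne' hX (x_sub_inv_ne_zero hx0 hx1) hm'
    (sub_inv_rpow_ne_zero hx0 hx1 (mul_ne_zero hk hm'))
  have hX2 : (P.x ^ (m : ℝ)) ^ 2 = (P.x ^ 2) ^ m := by
    rw [Real.rpow_natCast, ← pow_mul, ← pow_mul, mul_comm]
  have h3 : P.x ^ ((P.k + 1) * m) = P.x ^ (P.k * m) * P.x ^ (m : ℝ) := by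
    rw [rpow_add_mul hx0, one_mul]
  have h0 : (1 + (P.x ^ 2) ^ m) ≠ 0 := by positivity
  have hab' : P.x ^ 2 * b = a⁻¹ := by
    have ha : a ≠ 0 := by
      rintro rfl
      rw [mul_zero] at hab
      exact inv_ne_zero hb hab.symm
    field_simp at hab ⊢
    linarith
  rw [hσ, hX2] at h1 h2
  rw [plusRatio, gammaComm, qPlus_eq hx0, qPlus_eq hx0, qInt_eq hx0, h3]
  refine ⟨h1.trans ?_, h2.trans ?_⟩
  · field_simp
  · rw [← hab, ← hab', mul_pow, mul_pow]
    field_simp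

end

section

variable {P : Params} (hx0 : 0 < P.x) (hx1 : P.x < 1)
include hx0

lemma sq_rpow_mul (t : ℝ) (m : ℕ) : (P.x ^ (t * m)) ^ 2 = (P.x ^ (2 * t)) ^ m := by
  rw [← rpow_mul_natCast hx0, ← Real.rpow_natCast, ← Real.rpow_mul hx0.le]
  congr 1
  push_cast
  ring

lemma qInt_two (m : ℕ) : qInt P.x (2 * m) =
    ((P.x ^ 2) ^ m - ((P.x ^ 2)⁻¹) ^ m) / (P.x - P.x⁻¹) := by
  rw [qInt_eq hx0, rpow_two_mul_natCast hx0, inv_pow]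

lemma qInt_sub (m : ℕ) : qInt P.x (P.s * m) - qInt P.x ((P.s - 2) * m) =
    -powerDiff (P.x ^ P.s)⁻¹ (P.x ^ P.s / P.x ^ 2) m / (P.x - P.x⁻¹) := by
  rw [qInt_eq hx0, qInt_eq hx0, rpow_sub_mul hx0, rpow_two_mul_natCast hx0,
    rpow_mul_natCast hx0, powerDiff]
  simp only [inv_pow, div_pow, inv_div, inv_inv]
  ring

include hx1

lemma one_sub_pow_ne_zero {t : ℝ} (ht : t ≠ 0) {m : ℕ} (hm : 0 < m) :
    1 - (P.x ^ (2 * t)) ^ m ≠ 0 := by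
  rw [← rpow_mul_natCast hx0]
  have hm' : (m : ℝ) ≠ 0 := by exact_mod_cast hm.ne'
  exact sub_ne_zero.mpr (rpow_ne_one hx0 hx1 (mul_ne_zero (mul_ne_zero two_ne_zero ht) hm')).symm

/-- Since `[rm] = [km + (r-k)m]`, the partial fraction expansion of the `α` commutator has a pole
term in `[km]`, which the `γ` contraction removes. Only `q = x^{2(r-k)}` is left. -/
lemma base_E_self (hk : P.k ≠ 0) (ht : P.r - P.k ≠ 0) (j : Fin 2) {m : ℕ} (hm : 0 < m) :
    bosonComm P (.alpha, j) (.alpha, j) m + P.x ^ (P.k * m) * gammaComm P j j m =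
      powerDiff 1 (P.x ^ 2) m / (m * (1 - (P.x ^ (2 * (P.r - P.k))) ^ m)) := by
  have hm' : (m : ℝ) ≠ 0 := by exact_mod_cast hm.ne'
  have h := base_jj ((P.x ^ 2) ^ m - ((P.x ^ 2)⁻¹) ^ m) (Real.rpow_pos_of_pos hx0 (P.k * m)).ne'
    (Real.rpow_pos_of_pos hx0 ((P.r - P.k) * m)).ne' (x_sub_inv_ne_zero hx0 hx1) hm'
    (sub_inv_rpow_ne_zero hx0 hx1 (mul_ne_zero hk hm'))
    (sub_inv_rpow_ne_zero hx0 hx1 (mul_ne_zero ht hm'))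
  rw [sq_rpow_mul hx0, ← Real.rpow_add hx0, ← add_mul, add_sub_cancel, ← qInt_two hx0,
    ← qInt_eq hx0, ← qInt_eq hx0, ← qInt_eq hx0] at h
  rw [gammaComm, qCartan, if_pos rfl]
  simp only [bosonComm, sameKind, if_true, Int.cast_natCast]
  rw [h, powerDiff]
  simp

lemma base_F_self (hk : P.k ≠ 0) (hr : P.r ≠ 0) (j : Fin 2) {m : ℕ} (hm : 0 < m) :
    bosonComm P (.alphaT, j) (.alphaT, j) m + (P.x ^ (P.k * m))⁻¹ * gammaComm P j j m =
      powerDiff 1 (P.x ^ 2)⁻¹ m / (m * (1 - (P.x ^ (2 * P.r)) ^ m)) := by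
  have hm' : (m : ℝ) ≠ 0 := by exact_mod_cast hm.ne'
  have hK : 0 < P.x ^ (P.k * m) := Real.rpow_pos_of_pos hx0 (P.k * m)
  have h1 := sub_inv_rpow_ne_zero hx0 hx1 (mul_ne_zero hk hm')
  -- The identity is used with `K` inverted, because for `α̃` the product `x^{-km} x^{rm}` is
  -- `x^{(r-k)m}`.
  have h := base_jj ((P.x ^ 2) ^ m - ((P.x ^ 2)⁻¹) ^ m) (inv_pos.mpr hK).ne'
    (Real.rpow_pos_of_pos hx0 (P.r * m)).ne' (x_sub_inv_ne_zero hx0 hx1) hm'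
    (by rwa [inv_inv, ← neg_sub, neg_ne_zero])
    (sub_inv_rpow_ne_zero hx0 hx1 (mul_ne_zero hr hm'))
  have h2 : (P.x ^ (P.k * m))⁻¹ * P.x ^ (P.r * m) = P.x ^ ((P.r - P.k) * m) := by
    rw [rpow_sub_mul hx0]
    ring
  have h3 : (P.x ^ (P.k * m))⁻¹ - P.x ^ (P.k * m) = -(P.x ^ (P.k * m) - (P.x ^ (P.k * m))⁻¹) := by
    ring
  rw [sq_rpow_mul hx0, h2, inv_inv, h3, neg_div, ← qInt_two hx0,
    ← qInt_eq hx0, ← qInt_eq hx0, ← qInt_eq hx0] at h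
  rw [gammaComm, qCartan, if_pos rfl]
  simp only [bosonComm, sameKind, if_true, Int.cast_natCast]
  have h4 : powerDiff 1 (P.x ^ 2)⁻¹ m = -((P.x ^ 2) ^ m - ((P.x ^ 2)⁻¹) ^ m) := by
    simp [powerDiff]
  rw [h4, neg_div, ← h]
  simp only [neg_mul, mul_neg, div_neg, neg_div, neg_neg, neg_add]

/-- The `S_m` part of the `α` commutator cancels against `γ` and only `D_m` is left. The sign of the
exponent of `x^{(r-k)m}` depends on the order, whence the factor `q^m` for `(2, 1)`. -/
lemma base_E_ne (ht : P.r - P.k ≠ 0) {m : ℕ} (hm : 0 < m) :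
    bosonComm P (.alpha, 0) (.alpha, 1) m + P.x ^ (P.k * m) * gammaComm P 0 1 m =
      powerDiff (P.x ^ P.s)⁻¹ (P.x ^ P.s / P.x ^ 2) m /
        (m * (1 - (P.x ^ (2 * (P.r - P.k))) ^ m)) ∧
    bosonComm P (.alpha, 1) (.alpha, 0) m + (P.x ^ (P.k * m))⁻¹ * gammaComm P 1 0 m =
      (P.x ^ (2 * (P.r - P.k))) ^ m * powerDiff (P.x ^ P.s)⁻¹ (P.x ^ P.s / P.x ^ 2) m /
        (m * (1 - (P.x ^ (2 * (P.r - P.k))) ^ m)) := by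
  have hm' : (m : ℝ) ≠ 0 := by exact_mod_cast hm.ne'
  obtain ⟨h1, h2⟩ := base_ij (-powerDiff (P.x ^ P.s)⁻¹ (P.x ^ P.s / P.x ^ 2) m)
    (Real.rpow_pos_of_pos hx0 ((P.r - P.k) * m)).ne' (x_sub_inv_ne_zero hx0 hx1) hm'
    (sub_inv_rpow_ne_zero hx0 hx1 (mul_ne_zero ht hm'))
  rw [neg_neg, sq_rpow_mul hx0, ← qInt_sub hx0, ← qInt_eq hx0] at h1 h2
  rw [← h1, ← h2]
  simp only [bosonComm, sameKind, gammaComm, qCartan]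
  push_cast
  have e : P.x ^ ((-P.r + P.k) * m) = (P.x ^ ((P.r - P.k) * m))⁻¹ := by
    rw [← Real.rpow_neg hx0.le]
    congr 1
    ring
  have e1 : P.x ^ ((-P.r + P.k) * -m) = P.x ^ ((P.r - P.k) * m) := by
    congr 1
    ring
  have e2 : P.x ^ (P.k * -m) = (P.x ^ (P.k * m))⁻¹ := by
    rw [mul_neg, Real.rpow_neg hx0.le]
  constructor
  · rw [e]
    ring
  · rw [e1, e2]
    simp only [qInt_mul_neg, div_neg]
    ring

/-- As for `E`, but the exponent of `x^{rm}` has the opposite sign, so the factor `q^m` now belongs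
to the order `(1, 2)`. -/
lemma base_F_ne (hr : P.r ≠ 0) {m : ℕ} (hm : 0 < m) :
    bosonComm P (.alphaT, 1) (.alphaT, 0) m + (P.x ^ (P.k * m))⁻¹ * gammaComm P 1 0 m =
      powerDiff (P.x ^ P.s) (P.x ^ 2 / P.x ^ P.s) m / (m * (1 - (P.x ^ (2 * P.r)) ^ m)) ∧
    bosonComm P (.alphaT, 0) (.alphaT, 1) m + P.x ^ (P.k * m) * gammaComm P 0 1 m =
      (P.x ^ (2 * P.r)) ^ m * powerDiff (P.x ^ P.s) (P.x ^ 2 / P.x ^ P.s) m /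
        (m * (1 - (P.x ^ (2 * P.r)) ^ m)) := by
  have hm' : (m : ℝ) ≠ 0 := by exact_mod_cast hm.ne'
  have h0 : powerDiff (P.x ^ P.s) (P.x ^ 2 / P.x ^ P.s) m =
      -powerDiff (P.x ^ P.s)⁻¹ (P.x ^ P.s / P.x ^ 2) m := by
    rw [powerDiff, powerDiff, inv_inv, inv_div, inv_div]
    ring
  obtain ⟨h1, h2⟩ := base_ij (-powerDiff (P.x ^ P.s)⁻¹ (P.x ^ P.s / P.x ^ 2) m)
    (Real.rpow_pos_of_pos hx0 (P.r * m)).ne' (x_sub_inv_ne_zero hx0 hx1) hm'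
    (sub_inv_rpow_ne_zero hx0 hx1 (mul_ne_zero hr hm'))
  rw [neg_neg, sq_rpow_mul hx0, ← qInt_sub hx0, ← qInt_eq hx0] at h1 h2
  rw [h0, mul_neg, neg_div, neg_div, ← h1, ← h2]
  simp only [bosonComm, sameKind, gammaComm, qCartan]
  push_cast
  have e1 : P.x ^ (P.r * -m) = (P.x ^ (P.r * m))⁻¹ := by
    rw [mul_neg, Real.rpow_neg hx0.le]
  have e2 : P.x ^ (P.k * -m) = (P.x ^ (P.k * m))⁻¹ := by
    rw [mul_neg, Real.rpow_neg hx0.le]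
  constructor
  · rw [e1, e2]
    simp only [qInt_mul_neg, div_neg]
    ring
  · ring

end

/-! ### Contraction data of the four exchange relations -/

section

variable {P : Params} (hx0 : 0 < P.x) (hx1 : P.x < 1) (hk : P.k ≠ 0)
include hx0 hx1 hk

/-- The pairs I–II, I–I (or II–II) and II–I share the `α` part and carry `γ` with coefficient
`x^{km}`, the ratio `[(k+1)m]_+/[m]_+`, and `x^{-km}`. One base value in each order and the
differences from `gammaComm_sub` therefore give all eight entries. -/
lemma exchangeContr_E {i j : Fin 2} {q a b e : ℝ} (hb : b ≠ 0) (hab : P.x ^ 2 * a = b⁻¹)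
    (hσ : ∀ m : ℕ, 0 < m → qCartan P i j m * (P.x - P.x⁻¹) = (1 + (P.x ^ 2) ^ m) * (a ^ m - b ^ m))
    (h1 : ∀ m : ℕ, 0 < m → bosonComm P (.alpha, i) (.alpha, j) m + P.x ^ (P.k * m) * gammaComm P i j m =
      powerDiff a e m / (m * (1 - q ^ m)))
    (h2 : ∀ m : ℕ, 0 < m → bosonComm P (.alpha, j) (.alpha, i) m +
      (P.x ^ (P.k * m))⁻¹ * gammaComm P j i m = q ^ m * powerDiff a e m / (m * (1 - q ^ m))) :
    ExchangeContr P q a b e (eI P i) (eII P i) (eI P j) (eII P j) := by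
  have h3 : ∀ m : ℕ, 0 < m → (P.x ^ (P.k * m) - (P.x ^ (P.k * m))⁻¹) * gammaComm P i j m =
      powerDiff a b⁻¹ m / m := by
    intro m hm
    obtain ⟨g1, g2⟩ := gammaComm_sub hx0 hx1 hk hb hab hm (hσ m hm)
    rw [powerDiff, inv_inv]
    linear_combination g2 - g1
  constructor <;> intro m hm
  · rw [contr_join_join (isAlpha_cVertex _ _) (isBetaGamma_psiI _ _) (isAlpha_cVertex _ _)
      (isBetaGamma_psiII _ _), contr_cVertex_cVertex, contr_psiI_psiII hx0 i j hx1 hk hm, h1 m hm]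
  · rw [contr_join_join (isAlpha_cVertex _ _) (isBetaGamma_psiI _ _) (isAlpha_cVertex _ _)
      (isBetaGamma_psiI _ _), contr_cVertex_cVertex, contr_psiI_psiI hx0 i j]
    linear_combination h1 m hm + (gammaComm_sub hx0 hx1 hk hb hab hm (hσ m hm)).1
  · rw [contr_join_join (isAlpha_cVertex _ _) (isBetaGamma_psiII _ _) (isAlpha_cVertex _ _)
      (isBetaGamma_psiII _ _), contr_cVertex_cVertex, contr_psiII_psiII hx0 i j]
    linear_combination h1 m hm + (gammaComm_sub hx0 hx1 hk hb hab hm (hσ m hm)).1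
  · rw [contr_join_join (isAlpha_cVertex _ _) (isBetaGamma_psiII _ _) (isAlpha_cVertex _ _)
      (isBetaGamma_psiI _ _), contr_cVertex_cVertex, contr_psiII_psiI hx0 i j]
    linear_combination h1 m hm - h3 m hm
  · rw [contr_join_join (isAlpha_cVertex _ _) (isBetaGamma_psiII _ _) (isAlpha_cVertex _ _)
      (isBetaGamma_psiI _ _), contr_cVertex_cVertex, contr_psiII_psiI hx0 j i, h2 m hm]
  · rw [contr_join_join (isAlpha_cVertex _ _) (isBetaGamma_psiI _ _) (isAlpha_cVertex _ _)
      (isBetaGamma_psiI _ _), contr_cVertex_cVertex, contr_psiI_psiI hx0 j i]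
    linear_combination h2 m hm + (gammaComm_sub hx0 hx1 hk hb hab hm (hσ m hm)).2 -
      (plusRatio P m - (P.x ^ (P.k * m))⁻¹) * gammaComm_comm P i j m
  · rw [contr_join_join (isAlpha_cVertex _ _) (isBetaGamma_psiII _ _) (isAlpha_cVertex _ _)
      (isBetaGamma_psiII _ _), contr_cVertex_cVertex, contr_psiII_psiII hx0 j i]
    linear_combination h2 m hm + (gammaComm_sub hx0 hx1 hk hb hab hm (hσ m hm)).2 -
      (plusRatio P m - (P.x ^ (P.k * m))⁻¹) * gammaComm_comm P i j m
  · rw [contr_join_join (isAlpha_cVertex _ _) (isBetaGamma_psiI _ _) (isAlpha_cVertex _ _)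
      (isBetaGamma_psiII _ _), contr_cVertex_cVertex, contr_psiI_psiII hx0 j i hx1 hk hm]
    linear_combination h2 m hm + h3 m hm -
      (P.x ^ (P.k * m) - (P.x ^ (P.k * m))⁻¹) * gammaComm_comm P i j m

/-- Compared with `E`, the powers `x^{km}` and `x^{-km}` change places, so the two differences do
too and `a, b` are replaced by their inverses. -/
lemma exchangeContr_F {i j : Fin 2} {q a b e : ℝ} (hb : b ≠ 0) (hab : P.x ^ 2 * a = b⁻¹)
    (hσ : ∀ m : ℕ, 0 < m → qCartan P i j m * (P.x - P.x⁻¹) = (1 + (P.x ^ 2) ^ m) * (a ^ m - b ^ m))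
    (h1 : ∀ m : ℕ, 0 < m → bosonComm P (.alphaT, i) (.alphaT, j) m +
      (P.x ^ (P.k * m))⁻¹ * gammaComm P i j m = powerDiff a⁻¹ e m / (m * (1 - q ^ m)))
    (h2 : ∀ m : ℕ, 0 < m → bosonComm P (.alphaT, j) (.alphaT, i) m +
      P.x ^ (P.k * m) * gammaComm P j i m = q ^ m * powerDiff a⁻¹ e m / (m * (1 - q ^ m))) :
    ExchangeContr P q a⁻¹ b⁻¹ e (fI P i) (fII P i) (fI P j) (fII P j) := by
  have h3 : ∀ m : ℕ, 0 < m → (P.x ^ (P.k * m) - (P.x ^ (P.k * m))⁻¹) * gammaComm P i j m =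
      -(powerDiff a⁻¹ b m / m) := by
    intro m hm
    obtain ⟨g1, g2⟩ := gammaComm_sub hx0 hx1 hk hb hab hm (hσ m hm)
    rw [powerDiff, inv_inv]
    linear_combination g2 - g1
  constructor <;> intro m hm <;> try simp only [inv_inv]
  · rw [contr_join_join (isAlpha_cDagVertex _ _) (isBetaGamma_psiDagI _ _) (isAlpha_cDagVertex _ _)
      (isBetaGamma_psiDagII _ _), contr_cDagVertex_cDagVertex,
      contr_psiDagI_psiDagII hx0 i j hx1 hk hm, h1 m hm]
  · rw [contr_join_join (isAlpha_cDagVertex _ _) (isBetaGamma_psiDagI _ _) (isAlpha_cDagVertex _ _)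
      (isBetaGamma_psiDagI _ _), contr_cDagVertex_cDagVertex, contr_psiDagI_psiDagI hx0 i j]
    linear_combination h1 m hm + (gammaComm_sub hx0 hx1 hk hb hab hm (hσ m hm)).2
  · rw [contr_join_join (isAlpha_cDagVertex _ _) (isBetaGamma_psiDagII _ _) (isAlpha_cDagVertex _ _)
      (isBetaGamma_psiDagII _ _), contr_cDagVertex_cDagVertex, contr_psiDagII_psiDagII hx0 i j]
    linear_combination h1 m hm + (gammaComm_sub hx0 hx1 hk hb hab hm (hσ m hm)).2
  · rw [contr_join_join (isAlpha_cDagVertex _ _) (isBetaGamma_psiDagII _ _) (isAlpha_cDagVertex _ _)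
      (isBetaGamma_psiDagI _ _), contr_cDagVertex_cDagVertex, contr_psiDagII_psiDagI hx0 i j]
    linear_combination h1 m hm + h3 m hm
  · rw [contr_join_join (isAlpha_cDagVertex _ _) (isBetaGamma_psiDagII _ _) (isAlpha_cDagVertex _ _)
      (isBetaGamma_psiDagI _ _), contr_cDagVertex_cDagVertex, contr_psiDagII_psiDagI hx0 j i, h2 m hm]
  · rw [contr_join_join (isAlpha_cDagVertex _ _) (isBetaGamma_psiDagI _ _) (isAlpha_cDagVertex _ _)
      (isBetaGamma_psiDagI _ _), contr_cDagVertex_cDagVertex, contr_psiDagI_psiDagI hx0 j i]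
    linear_combination h2 m hm + (gammaComm_sub hx0 hx1 hk hb hab hm (hσ m hm)).1 -
      (plusRatio P m - P.x ^ (P.k * m)) * gammaComm_comm P i j m
  · rw [contr_join_join (isAlpha_cDagVertex _ _) (isBetaGamma_psiDagII _ _) (isAlpha_cDagVertex _ _)
      (isBetaGamma_psiDagII _ _), contr_cDagVertex_cDagVertex, contr_psiDagII_psiDagII hx0 j i]
    linear_combination h2 m hm + (gammaComm_sub hx0 hx1 hk hb hab hm (hσ m hm)).1 -
      (plusRatio P m - P.x ^ (P.k * m)) * gammaComm_comm P i j m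
  · rw [contr_join_join (isAlpha_cDagVertex _ _) (isBetaGamma_psiDagI _ _) (isAlpha_cDagVertex _ _)
      (isBetaGamma_psiDagII _ _), contr_cDagVertex_cDagVertex,
      contr_psiDagI_psiDagII hx0 j i hx1 hk hm]
    linear_combination h2 m hm - h3 m hm +
      (P.x ^ (P.k * m) - (P.x ^ (P.k * m))⁻¹) * gammaComm_comm P i j m

lemma exchangeContr_E_self (ht : P.r - P.k ≠ 0) (j : Fin 2) :
    ExchangeContr P (P.x ^ (2 * (P.r - P.k))) 1 (P.x ^ 2)⁻¹ (P.x ^ 2)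
      (eI P j) (eII P j) (eI P j) (eII P j) := by
  have hX : P.x ^ 2 ≠ 0 := by positivity
  have hab : P.x ^ 2 * 1 = ((P.x ^ 2)⁻¹)⁻¹ := by rw [inv_inv, mul_one]
  refine exchangeContr_E hx0 hx1 hk (inv_ne_zero hX) hab
    (fun m _ => qCartan_self hx0 hx1 j m) (fun m hm => base_E_self hx0 hx1 hk ht j hm) fun m hm => ?_
  obtain ⟨g1, g2⟩ := gammaComm_sub hx0 hx1 hk (inv_ne_zero hX) hab hm (qCartan_self hx0 hx1 j m)
  have h := base_E_self hx0 hx1 hk ht j hm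
  have h0 := one_sub_pow_ne_zero hx0 hx1 ht hm
  have hm' : (m : ℝ) ≠ 0 := by exact_mod_cast hm.ne'
  -- For equal currents the reversed base value follows from `1/(1 - q^m) = q^m/(1 - q^m) + 1`; the
  -- extra term is the difference of the pairs I–II and II–I.
  have h3 : powerDiff 1 (P.x ^ 2) m / (m * (1 - (P.x ^ (2 * (P.r - P.k))) ^ m)) =
      (P.x ^ (2 * (P.r - P.k))) ^ m * powerDiff 1 (P.x ^ 2) m /
        (m * (1 - (P.x ^ (2 * (P.r - P.k))) ^ m)) + powerDiff 1 (P.x ^ 2) m / m := by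
    field_simp
    ring
  rw [powerDiff] at h3
  rw [inv_inv] at g2
  rw [powerDiff] at h ⊢
  linear_combination h + h3 + g1 - g2

lemma exchangeContr_F_self (hr : P.r ≠ 0) (j : Fin 2) :
    ExchangeContr P (P.x ^ (2 * P.r)) 1 (P.x ^ 2) (P.x ^ 2)⁻¹
      (fI P j) (fII P j) (fI P j) (fII P j) := by
  have hX : P.x ^ 2 ≠ 0 := by positivity
  have hab : P.x ^ 2 * 1 = ((P.x ^ 2)⁻¹)⁻¹ := by rw [inv_inv, mul_one]
  have := exchangeContr_F (q := P.x ^ (2 * P.r)) (e := (P.x ^ 2)⁻¹) hx0 hx1 hk (inv_ne_zero hX) hab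
    (fun m _ => qCartan_self hx0 hx1 j m)
    (fun m hm => by rw [inv_one]; exact base_F_self hx0 hx1 hk hr j hm) fun m hm => ?_
  · rwa [inv_one, inv_inv] at this
  obtain ⟨g1, g2⟩ := gammaComm_sub hx0 hx1 hk (inv_ne_zero hX) hab hm (qCartan_self hx0 hx1 j m)
  have h := base_F_self hx0 hx1 hk hr j hm
  have h0 := one_sub_pow_ne_zero hx0 hx1 hr hm
  have hm' : (m : ℝ) ≠ 0 := by exact_mod_cast hm.ne'
  have h3 : powerDiff 1 (P.x ^ 2)⁻¹ m / (m * (1 - (P.x ^ (2 * P.r)) ^ m)) =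
      (P.x ^ (2 * P.r)) ^ m * powerDiff 1 (P.x ^ 2)⁻¹ m /
        (m * (1 - (P.x ^ (2 * P.r)) ^ m)) + powerDiff 1 (P.x ^ 2)⁻¹ m / m := by
    field_simp
    ring
  rw [inv_one]
  rw [powerDiff, inv_inv] at h3
  rw [inv_inv] at g2
  rw [powerDiff, inv_inv] at h ⊢
  linear_combination h + h3 + g2 - g1

lemma exchangeContr_E_ne (ht : P.r - P.k ≠ 0) :
    ExchangeContr P (P.x ^ (2 * (P.r - P.k))) (P.x ^ P.s)⁻¹ (P.x ^ P.s / P.x ^ 2)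
      (P.x ^ P.s / P.x ^ 2) (eI P 0) (eII P 0) (eI P 1) (eII P 1) := by
  have hX : P.x ^ 2 ≠ 0 := by positivity
  have hS : P.x ^ P.s ≠ 0 := (Real.rpow_pos_of_pos hx0 _).ne'
  exact exchangeContr_E hx0 hx1 hk (div_ne_zero hS hX) (by rw [inv_div, div_eq_mul_inv])
    (fun m _ => qCartan_ne hx0 hx1 (by decide) m) (fun m hm => (base_E_ne hx0 hx1 ht hm).1)
    fun m hm => (base_E_ne hx0 hx1 ht hm).2

/-- Taken in the order `F_2 F_1`, because that is the one whose base contraction has no factor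
`q^m`. The order is restored by `ContractionsContinue.swap`. -/
lemma exchangeContr_F_ne (hr : P.r ≠ 0) :
    ExchangeContr P (P.x ^ (2 * P.r)) (P.x ^ P.s) (P.x ^ 2 / P.x ^ P.s)
      (P.x ^ 2 / P.x ^ P.s) (fI P 1) (fII P 1) (fI P 0) (fII P 0) := by
  have hX : P.x ^ 2 ≠ 0 := by positivity
  have hS : P.x ^ P.s ≠ 0 := (Real.rpow_pos_of_pos hx0 _).ne'
  have := exchangeContr_F (q := P.x ^ (2 * P.r)) (e := P.x ^ 2 / P.x ^ P.s) hx0 hx1 hk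
    (div_ne_zero hS hX) (by rw [inv_div, div_eq_mul_inv])
    (fun m _ => qCartan_ne hx0 hx1 (i := 1) (j := 0) (by decide) m)
    (fun m hm => by rw [inv_inv]; exact (base_F_ne hx0 hx1 hr hm).1)
    fun m hm => by rw [inv_inv]; exact (base_F_ne hx0 hx1 hr hm).2
  rwa [inv_inv, inv_div] at this

end

/-! ### Theta functions and contractions -/

lemma cpow_eq_exp {x : ℝ} (hx : 0 < x) (c : ℂ) : (x : ℂ) ^ c = Complex.exp (Real.log x * c) := by
  have h : (x : ℂ) ≠ 0 := by exact_mod_cast hx.ne'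
  rw [Complex.cpow_def_of_ne_zero h, Complex.ofReal_log hx.le]

lemma ofReal_rpow_eq_exp {x : ℝ} (hx : 0 < x) (c : ℝ) :
    ((x ^ c : ℝ) : ℂ) = Complex.exp (Real.log x * c) := by
  rw [Complex.ofReal_cpow hx.le, cpow_eq_exp hx]

/-- `z₂ / z₁`. -/
def zRatio (x : ℝ) (u₁ u₂ : ℂ) : ℂ := zPow x u₂ 1 / zPow x u₁ 1

section

variable {x : ℝ} (hx : 0 < x)
include hx

lemma zRatio_eq (u₁ u₂ : ℂ) : zRatio x u₁ u₂ = Complex.exp (Real.log x * (2 * (u₂ - u₁))) := by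
  rw [zRatio, zPow_eq hx, zPow_eq hx, ← Complex.exp_sub]
  ring_nf

lemma zRatio_ne_zero (u₁ u₂ : ℂ) : zRatio x u₁ u₂ ≠ 0 := by
  rw [zRatio_eq hx]
  exact Complex.exp_ne_zero _

omit hx in
lemma zRatio_swap (u₁ u₂ : ℂ) : zRatio x u₂ u₁ = (zRatio x u₁ u₂)⁻¹ := by
  rw [zRatio, zRatio, inv_div]

lemma differentiable_zRatio : Differentiable ℂ fun u : ℂ × ℂ => zRatio x u.1 u.2 := by
  simp only [zRatio_eq hx]
  fun_prop

lemma norm_zRatio_lt {ρ : ℝ} {u₁ u₂ : ℂ} (h : ‖zPow x u₂ 1‖ < ρ * ‖zPow x u₁ 1‖) :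
    ‖zRatio x u₁ u₂‖ < ρ := by
  rw [zRatio, norm_div, div_lt_iff₀ (norm_pos_iff.mpr (zPow_ne_zero hx _ _))]
  exact h

/-- The constant factor of the theta function. -/
def thetaConst (q : ℂ) : ℂ := qPoch q q / qPoch q q ^ 3

lemma theta_eq (t p : ℝ) (u₁ u₂ : ℂ) :
    theta x t (u₁ - u₂ + p) = thetaConst ((x ^ (2 * t) : ℝ) : ℂ) *
      Complex.exp (Real.log x * ((u₁ - u₂ + p) ^ 2 / t - (u₁ - u₂ + p))) *
      (qPoch ((((x ^ (-2 * p) : ℝ) : ℂ) * zRatio x u₁ u₂)⁻¹) ((x ^ (2 * t) : ℝ) : ℂ) *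
        qPoch (((x ^ (2 * t) : ℝ) : ℂ) * (((x ^ (-2 * p) : ℝ) : ℂ) * zRatio x u₁ u₂))
          ((x ^ (2 * t) : ℝ) : ℂ)) := by
  have h : (x : ℂ) ^ (2 * (u₁ - u₂ + p)) = (((x ^ (-2 * p) : ℝ) : ℂ) * zRatio x u₁ u₂)⁻¹ := by
    rw [cpow_eq_exp hx, ofReal_rpow_eq_exp hx, zRatio_eq hx, ← Complex.exp_add, ← Complex.exp_neg]
    push_cast
    ring_nf
  rw [theta, bigTheta, h, div_inv_eq_mul, cpow_eq_exp hx, thetaConst]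
  ring

/-- The common monomial factor of both sides of an exchange relation. -/
def exchangeMonomial (x t p p' : ℝ) (u₁ u₂ : ℂ) : ℂ :=
  thetaConst ((x ^ (2 * t) : ℝ) : ℂ) ^ 2 * Complex.exp (Real.log x *
    (((u₂ - u₁ + p) ^ 2 + (u₂ - u₁ + p') ^ 2) / t - 2 * (u₂ - u₁) - p - p' -
      4 * u₂ * (p + p') / t))

omit hx in
lemma differentiable_exchangeMonomial (t p p' : ℝ) :
    Differentiable ℂ fun u : ℂ × ℂ => exchangeMonomial x t p p' u.1 u.2 := by
  unfold exchangeMonomial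
  simp only [div_eq_mul_inv]
  fun_prop

/-- The factors of an exchange relation. -/
def thetaProd (x t p p' : ℝ) (u₁ u₂ : ℂ) : ℂ :=
  theta x t (u₁ - u₂ + p) * theta x t (u₁ - u₂ + p')

/-- The quadratic exponents of the two theta products differ by `4 (u₁ - u₂)(p + p')/t`. The
zero-mode powers of `z₁` and `z₂` absorb exactly this, leaving one monomial common to both sides. -/
lemma thetaProd_swap {t : ℝ} (p p' : ℝ) (u₁ u₂ : ℂ) {q a e w : ℂ}
    (hq : q = ((x ^ (2 * t) : ℝ) : ℂ)) (ha : a = ((x ^ (-2 * p) : ℝ) : ℂ))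
    (he : e = ((x ^ (-2 * p') : ℝ) : ℂ)) (hw : w = zRatio x u₁ u₂) :
    thetaProd x t p p' u₂ u₁ * zPow x u₂ (-(2 * (p + p') / t)) =
      exchangeMonomial x t p p' u₁ u₂ * (qPoch (w / a) q * qPoch (q * (a / w)) q *
        (qPoch (w / e) q * qPoch (q * (e / w)) q)) := by
  have h1 : (a * w⁻¹)⁻¹ = w / a := by rw [mul_inv, inv_inv]; ring
  have h2 : (e * w⁻¹)⁻¹ = w / e := by rw [mul_inv, inv_inv]; ring
  rw [thetaProd, theta_eq hx, theta_eq hx, zRatio_swap, ← hw, ← hq, ← ha, ← he, h1, h2,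
    ← div_eq_mul_inv, ← div_eq_mul_inv, exchangeMonomial, zPow_eq hx, ← hq]
  have h3 : Complex.exp (Real.log x * ((u₂ - u₁ + p) ^ 2 / t - (u₂ - u₁ + p))) *
      Complex.exp (Real.log x * ((u₂ - u₁ + p') ^ 2 / t - (u₂ - u₁ + p'))) *
      Complex.exp (Real.log x * (2 * u₂ * -(2 * (p + p') / t))) = Complex.exp (Real.log x *
    (((u₂ - u₁ + p) ^ 2 + (u₂ - u₁ + p') ^ 2) / t - 2 * (u₂ - u₁) - p - p' -
      4 * u₂ * (p + p') / t)) := by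
    rw [← Complex.exp_add, ← Complex.exp_add]
    ring_nf
  rw [← h3]
  ring

/-- The factor `w²` stems from the linear terms `-u` in the exponents of the two theta functions,
which change sign under `u₁ ↔ u₂`. -/
lemma thetaProd_eq {t : ℝ} (p p' : ℝ) (u₁ u₂ : ℂ) {q a e w : ℂ}
    (hq : q = ((x ^ (2 * t) : ℝ) : ℂ)) (ha : a = ((x ^ (-2 * p) : ℝ) : ℂ))
    (he : e = ((x ^ (-2 * p') : ℝ) : ℂ)) (hw : w = zRatio x u₁ u₂) :
    thetaProd x t p p' u₁ u₂ * zPow x u₁ (-(2 * (p + p') / t)) =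
      w ^ 2 * exchangeMonomial x t p p' u₁ u₂ * (qPoch (a * w)⁻¹ q * qPoch (q * (a * w)) q *
        (qPoch (e * w)⁻¹ q * qPoch (q * (e * w)) q)) := by
  rw [thetaProd, theta_eq hx, theta_eq hx, ← hw, ← hq, ← ha, ← he,
    exchangeMonomial, zPow_eq hx, ← hq]
  have h3 : Complex.exp (Real.log x * ((u₁ - u₂ + p) ^ 2 / t - (u₁ - u₂ + p))) *
      Complex.exp (Real.log x * ((u₁ - u₂ + p') ^ 2 / t - (u₁ - u₂ + p'))) *
      Complex.exp (Real.log x * (2 * u₁ * -(2 * (p + p') / t))) = w ^ 2 * Complex.exp (Real.log x *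
    (((u₂ - u₁ + p) ^ 2 + (u₂ - u₁ + p') ^ 2) / t - 2 * (u₂ - u₁) - p - p' -
      4 * u₂ * (p + p') / t)) := by
    rw [hw, zRatio_eq hx, ← Complex.exp_nat_mul, ← Complex.exp_add, ← Complex.exp_add,
      ← Complex.exp_add]
    push_cast
    ring_nf
  linear_combination (thetaConst q ^ 2 * (qPoch (a * w)⁻¹ q * qPoch (q * (a * w)) q *
        (qPoch (e * w)⁻¹ q * qPoch (q * (e * w)) q))) * h3

end

/-- The common factor of infinite products of both sides of an exchange relation. -/
def exchangeProd (q a e w : ℂ) : ℂ :=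
  qPoch (q * (a * w)⁻¹) q * qPoch (q * (e * w)⁻¹) q * (qPoch (w / a) q * qPoch (w / e) q)

lemma differentiable_exchangeProd {x : ℝ} (hx : 0 < x) {q : ℂ} (hq : ‖q‖ < 1) (a e : ℂ) :
    Differentiable ℂ fun u : ℂ × ℂ => exchangeProd q a e (zRatio x u.1 u.2) := by
  have h1 := differentiable_zRatio hx
  have h2 : Differentiable ℂ fun u : ℂ × ℂ => (zRatio x u.1 u.2)⁻¹ := by
    simp only [zRatio_eq hx, ← Complex.exp_neg]
    fun_prop
  have hP := differentiable_qPoch hq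
  have h3 : ∀ c, Differentiable ℂ fun u : ℂ × ℂ => qPoch (q * (c * zRatio x u.1 u.2)⁻¹) q := by
    intro c
    have : Differentiable ℂ fun u : ℂ × ℂ => q * (c * zRatio x u.1 u.2)⁻¹ := by
      simp only [mul_inv]
      exact (h2.const_mul _).const_mul _
    exact hP.comp this
  have h4 : ∀ c, Differentiable ℂ fun u : ℂ × ℂ => qPoch (zRatio x u.1 u.2 / c) q := by
    intro c
    have : Differentiable ℂ fun u : ℂ × ℂ => zRatio x u.1 u.2 / c := by
      simp only [div_eq_mul_inv]
      exact h1.mul_const _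
    exact hP.comp this
  exact ((h3 a).mul (h3 e)).mul ((h4 a).mul (h4 e))

/-- The sums of the exponentials common to the contractions on both sides. -/
lemma expSum_powerDiff {q : ℂ} (hq : ‖q‖ < 1) {a e w : ℂ} (ha : ‖a * w‖ < 1) (ha' : ‖a⁻¹ * w‖ < 1)
    (he : ‖e * w‖ < 1) (he' : ‖e⁻¹ * w‖ < 1) :
    ExpSum (fun m => (a ^ m + e ^ m - a⁻¹ ^ m - e⁻¹ ^ m) / (m * (1 - q ^ m))) w
      (qPoch (w / a) q * qPoch (w / e) q / (qPoch (a * w) q * qPoch (e * w) q)) := by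
  have h := (((ExpSum.qPoch hq ha).add (ExpSum.qPoch hq he)).sub (ExpSum.qPoch hq ha')).sub
    (ExpSum.qPoch hq he')
  have e1 : (qPoch (a * w) q)⁻¹ * (qPoch (e * w) q)⁻¹ / (qPoch (a⁻¹ * w) q)⁻¹ /
      (qPoch (e⁻¹ * w) q)⁻¹ =
      qPoch (w / a) q * qPoch (w / e) q / (qPoch (a * w) q * qPoch (e * w) q) := by
    rw [div_inv_eq_mul, div_inv_eq_mul, div_eq_inv_mul w a, div_eq_inv_mul w e, div_eq_mul_inv,
      mul_inv]
    ring
  rw [e1] at h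
  refine h.congr fun m _ => ?_
  ring

lemma expSum_powerDiff_shift {q : ℂ} (hq : ‖q‖ < 1) {a e w : ℂ} (ha : ‖a * w‖ < 1)
    (ha' : ‖a⁻¹ * w‖ < 1) (he : ‖e * w‖ < 1) (he' : ‖e⁻¹ * w‖ < 1) :
    ExpSum (fun m => q ^ m * (a ^ m + e ^ m - a⁻¹ ^ m - e⁻¹ ^ m) / (m * (1 - q ^ m))) w
      (qPoch (q * (w / a)) q * qPoch (q * (w / e)) q /
        (qPoch (q * (a * w)) q * qPoch (q * (e * w)) q)) := by
  have hb : ∀ c : ℂ, ‖c * w‖ < 1 → ‖q * c * w‖ < 1 := fun c hc => by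
    rw [mul_assoc, norm_mul]
    exact mul_lt_one_of_nonneg_of_lt_one_left (norm_nonneg _) hq hc.le
  have h := (((ExpSum.qPoch hq (hb a ha)).add (ExpSum.qPoch hq (hb e he))).sub
    (ExpSum.qPoch hq (hb _ ha'))).sub (ExpSum.qPoch hq (hb _ he'))
  have e1 : (qPoch (q * a * w) q)⁻¹ * (qPoch (q * e * w) q)⁻¹ / (qPoch (q * a⁻¹ * w) q)⁻¹ /
      (qPoch (q * e⁻¹ * w) q)⁻¹ =
      qPoch (q * (w / a)) q * qPoch (q * (w / e)) q /
        (qPoch (q * (a * w)) q * qPoch (q * (e * w)) q) := by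
    rw [div_inv_eq_mul, div_inv_eq_mul, div_eq_inv_mul w a, div_eq_inv_mul w e, div_eq_mul_inv,
      mul_inv, mul_assoc q, mul_assoc q, mul_assoc q, mul_assoc q]
    ring
  rw [e1] at h
  refine h.congr fun m _ => ?_
  simp only [mul_pow]
  ring

lemma qPoch_ne_zero_of_shift {q z : ℂ} (hq : ‖q‖ < 1) (hz : ‖z‖ < 1) : qPoch (q * z) q ≠ 0 := by
  refine qPoch_ne_zero hq ?_
  rw [norm_mul]
  exact mul_lt_one_of_nonneg_of_lt_one_left (norm_nonneg _) hq hz.le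

lemma one_sub_ne_zero_of_norm_lt {z : ℂ} (hz : ‖z‖ < 1) : 1 - z ≠ 0 := by
  intro hc
  rw [← sub_eq_zero.mp hc, norm_one] at hz
  exact lt_irrefl _ hz

/-- The left-hand side of an exchange relation. -/
lemma exchange_left {q a e w μ : ℂ} (hq : ‖q‖ < 1) (ha0 : a ≠ 0) (he0 : e ≠ 0) (hw : w ≠ 0)
    (ha : ‖a * w‖ < 1) (he : ‖e * w‖ < 1) :
    w ^ 2 * μ * (qPoch (a * w)⁻¹ q * qPoch (q * (a * w)) q *
        (qPoch (e * w)⁻¹ q * qPoch (q * (e * w)) q)) *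
      (qPoch (w / a) q * qPoch (w / e) q / (qPoch (a * w) q * qPoch (e * w) q)) =
    (a * e)⁻¹ * (μ * exchangeProd q a e w) := by
  have h1 := qPoch_ne_zero_of_shift hq ha
  have h2 := qPoch_ne_zero_of_shift hq he
  have h3 := one_sub_ne_zero_of_norm_lt ha
  have h4 := one_sub_ne_zero_of_norm_lt he
  -- The theta zero at `a w = 1` cancels the first factor of the denominator product. The leftover
  -- `(a w)⁻¹`, together with its analogue for `e`, cancels `w²` and leaves `(a e)⁻¹`.
  have e1 : 1 - (a * w)⁻¹ = -(1 - a * w) * (a * w)⁻¹ := by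
    field_simp
    ring
  have e2 : 1 - (e * w)⁻¹ = -(1 - e * w) * (e * w)⁻¹ := by
    field_simp
    ring
  rw [qPoch_eq_mul hq (a * w), qPoch_eq_mul hq (e * w), qPoch_eq_mul hq (a * w)⁻¹,
    qPoch_eq_mul hq (e * w)⁻¹, exchangeProd, e1, e2]
  generalize 1 - a * w = A at *
  generalize 1 - e * w = B at *
  generalize qPoch (q * (a * w)) q = C at *
  generalize qPoch (q * (e * w)) q = D at *
  generalize qPoch (q * (a * w)⁻¹) q = C' at *
  generalize qPoch (q * (e * w)⁻¹) q = D' at *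
  generalize qPoch (w / a) q = F at *
  generalize qPoch (w / e) q = G at *
  field_simp

/-- The right-hand side of an exchange relation. -/
lemma exchange_right {q a e w μ : ℂ} (hq : ‖q‖ < 1) (ha : ‖a * w⁻¹‖ < 1) (he : ‖e * w⁻¹‖ < 1) :
    μ * (qPoch (w / a) q * qPoch (q * (a / w)) q * (qPoch (w / e) q * qPoch (q * (e / w)) q)) *
      (qPoch (q * (w⁻¹ / a)) q * qPoch (q * (w⁻¹ / e)) q /
        (qPoch (q * (a * w⁻¹)) q * qPoch (q * (e * w⁻¹)) q)) =
    μ * exchangeProd q a e w := by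
  have h1 := qPoch_ne_zero_of_shift hq ha
  have h2 := qPoch_ne_zero_of_shift hq he
  have e1 : w⁻¹ / a = (a * w)⁻¹ := by rw [mul_inv]; ring
  have e2 : w⁻¹ / e = (e * w)⁻¹ := by rw [mul_inv]; ring
  rw [e1, e2, div_eq_mul_inv a w, div_eq_mul_inv e w, exchangeProd]
  generalize qPoch (q * (a * w⁻¹)) q = C at *
  generalize qPoch (q * (e * w⁻¹)) q = D at *
  generalize qPoch (q * (a * w)⁻¹) q = C'
  generalize qPoch (q * (e * w)⁻¹) q = D'
  field_simp

/-- `z` and `z⁻¹` are at most `x⁻²`. -/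
def Moderate (x y : ℝ) : Prop := x ^ 2 ≤ y ∧ x ^ 2 ≤ y⁻¹

namespace Moderate

variable {x y : ℝ}

lemma inv (h : Moderate x y) : Moderate x y⁻¹ := ⟨h.2, by rw [inv_inv]; exact h.1⟩

lemma pos (hx : 0 < x) (h : Moderate x y) : 0 < y := (by positivity : 0 < x ^ 2).trans_le h.1

lemma ofReal_ne_zero (hx : 0 < x) (h : Moderate x y) : (y : ℂ) ≠ 0 := by
  exact_mod_cast (h.pos hx).ne'

lemma norm_mul_lt (hx : 0 < x) (h : Moderate x y) {w : ℂ} (hw : ‖w‖ < x ^ 2) :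
    ‖(y : ℂ) * w‖ < 1 := by
  have h0 := h.pos hx
  rw [norm_mul, Complex.norm_real, Real.norm_of_nonneg h0.le]
  calc y * ‖w‖ < y * x ^ 2 := mul_lt_mul_of_pos_left hw h0
    _ ≤ y * y⁻¹ := mul_le_mul_of_nonneg_left h.2 h0.le
    _ = 1 := mul_inv_cancel₀ h0.ne'

lemma norm_inv_mul_lt (hx : 0 < x) (h : Moderate x y) {w : ℂ} (hw : ‖w‖ < x ^ 2) :
    ‖(y : ℂ)⁻¹ * w‖ < 1 := by
  have := h.inv.norm_mul_lt hx hw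
  rwa [Complex.ofReal_inv] at this

end Moderate

/-- The theta functions and infinite products contribute the same entire function to both orders,
apart from `(a e)⁻¹`. Continuation is thereby reduced to the rational corrections `ψ(w)` and
`ψ'(w⁻¹)`, which must agree after multiplication by `g` and the zero-mode factors. The region `‖w‖ <
x²` suits every `Moderate` base and its inverse. -/
lemma contractionsContinue_core {P : Params} (hx0 : 0 < P.x) (hx1 : P.x < 1) {t : ℝ} (ht : 0 < t)
    {p p' : ℝ} {a e : ℝ} (ha : a = P.x ^ (-2 * p)) (he : e = P.x ^ (-2 * p'))
    (hma : Moderate P.x a) (hme : Moderate P.x e) {V W : Vertex}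
    (hVz : V.zExp W.shift = -(2 * (p + p') / t)) (hWz : W.zExp V.shift = -(2 * (p + p') / t))
    {A B : ℕ → ℝ} {ψ ψ' : ℂ → ℂ} {f g : ℂ × ℂ → ℂ}
    (hV : ∀ m, 0 < m → contr P V W m =
      powerDiff a e m / (m * (1 - (P.x ^ (2 * t)) ^ m)) + A m)
    (hW : ∀ m, 0 < m → contr P W V m =
      (P.x ^ (2 * t)) ^ m * powerDiff a e m / (m * (1 - (P.x ^ (2 * t)) ^ m)) + B m)
    (hA : ∀ w : ℂ, ‖w‖ < P.x ^ 2 → ExpSum (fun m => (A m : ℂ)) w (ψ w))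
    (hB : ∀ w : ℂ, ‖w‖ < P.x ^ 2 → ExpSum (fun m => (B m : ℂ)) w (ψ' w))
    (hf : Differentiable ℂ f)
    (h1 : ∀ u₁ u₂, ‖zRatio P.x u₁ u₂‖ < P.x ^ 2 →
      g (u₁, u₂) * (((P.x ^ V.xExp W.shift : ℝ) : ℂ) * ψ (zRatio P.x u₁ u₂)) =
        a * e * f (u₁, u₂))
    (h2 : ∀ u₁ u₂, ‖(zRatio P.x u₁ u₂)⁻¹‖ < P.x ^ 2 →
      g (u₁, u₂) * (((P.x ^ W.xExp V.shift : ℝ) : ℂ) * ψ' (zRatio P.x u₁ u₂)⁻¹) = f (u₁, u₂)) :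
    ContractionsContinue P (thetaProd P.x t p p') (fun u₁ u₂ => thetaProd P.x t p p' u₂ u₁)
      (P.x ^ 2) g V W := by
  obtain ⟨q, hqdef⟩ : ∃ q : ℂ, q = ((P.x ^ (2 * t) : ℝ) : ℂ) := ⟨_, rfl⟩
  have hq : ‖q‖ < 1 := by
    rw [hqdef, Complex.norm_real, Real.norm_of_nonneg (Real.rpow_nonneg hx0.le _)]
    exact Real.rpow_lt_one hx0.le hx1 (by positivity)
  have ha' : (a : ℂ) = ((P.x ^ (-2 * p) : ℝ) : ℂ) := by rw [ha]
  have he' : (e : ℂ) = ((P.x ^ (-2 * p') : ℝ) : ℂ) := by rw [he]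
  have ha0 := hma.ofReal_ne_zero hx0
  have he0 := hme.ofReal_ne_zero hx0
  refine ⟨fun u => exchangeMonomial P.x t p p' u.1 u.2 *
    exchangeProd q a e (zRatio P.x u.1 u.2) * f u,
    ((differentiable_exchangeMonomial t p p').mul (differentiable_exchangeProd hx0 hq _ _)).mul hf,
    fun u₁ u₂ hu => ?_, fun u₁ u₂ hu => ?_⟩
  · have hw := norm_zRatio_lt hx0 hu
    have hw0 := zRatio_ne_zero hx0 u₁ u₂
    have hs := (expSum_powerDiff hq (hma.norm_mul_lt hx0 hw) (hma.norm_inv_mul_lt hx0 hw)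
      (hme.norm_mul_lt hx0 hw) (hme.norm_inv_mul_lt hx0 hw)).add (hA _ hw)
    have hs' := (hs.congr (b := fun m => (contr P V W m : ℂ)) fun m hm => by
      rw [hV m hm, powerDiff, hqdef]
      push_cast
      rfl).hasSum
    refine ⟨_, (hasSum_congr_fun fun l => ?_).mpr hs', ?_⟩
    · rw [con, PowerSeries.coeff_mk, zRatio]
    · have hL := thetaProd_eq hx0 p p' u₁ u₂ hqdef ha' he' rfl
      have hE := exchange_left (μ := exchangeMonomial P.x t p p' u₁ u₂) hq ha0 he0 hw0
        (hma.norm_mul_lt hx0 hw) (hme.norm_mul_lt hx0 hw)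
      rw [← hL] at hE
      have h3 := h1 u₁ u₂ hw
      rw [hVz]
      calc _ = (thetaProd P.x t p p' u₁ u₂ * zPow P.x u₁ (-(2 * (p + p') / t)) *
            (qPoch (zRatio P.x u₁ u₂ / a) q * qPoch (zRatio P.x u₁ u₂ / e) q /
              (qPoch (a * zRatio P.x u₁ u₂) q * qPoch (e * zRatio P.x u₁ u₂) q))) *
            (g (u₁, u₂) * (((P.x ^ V.xExp W.shift : ℝ) : ℂ) * ψ (zRatio P.x u₁ u₂))) := by ring
        _ = _ := by
            rw [hE, h3]
            field_simp
  · have hw := norm_zRatio_lt hx0 hu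
    have hs := (expSum_powerDiff_shift hq (hma.norm_mul_lt hx0 hw) (hma.norm_inv_mul_lt hx0 hw)
      (hme.norm_mul_lt hx0 hw) (hme.norm_inv_mul_lt hx0 hw)).add (hB _ hw)
    have hs' := (hs.congr (b := fun m => (contr P W V m : ℂ)) fun m hm => by
      rw [hW m hm, powerDiff, hqdef]
      push_cast
      rfl).hasSum
    refine ⟨_, (hasSum_congr_fun fun l => ?_).mpr hs', ?_⟩
    · rw [con, PowerSeries.coeff_mk, zRatio]
    · rw [zRatio_swap] at hw ⊢
      have hL := thetaProd_swap hx0 p p' u₁ u₂ hqdef ha' he' rfl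
      have hE := exchange_right (μ := exchangeMonomial P.x t p p' u₁ u₂) hq
        (hma.norm_mul_lt hx0 hw) (hme.norm_mul_lt hx0 hw)
      rw [← hL] at hE
      have h3 := h2 u₁ u₂ hw
      dsimp only
      rw [hWz, ← h3, ← hE]
      ring

/-- The right factor is the left one with its arguments exchanged, so reversing the operators only
renames the variables. -/
lemma ContractionsContinue.swap {P : Params} {L : ℂ → ℂ → ℂ} {ρ : ℝ} {g : ℂ × ℂ → ℂ}
    {V W : Vertex} (h : ContractionsContinue P L (fun u₁ u₂ => L u₂ u₁) ρ g V W) :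
    ContractionsContinue P L (fun u₁ u₂ => L u₂ u₁) ρ (fun u => g (u.2, u.1)) W V := by
  obtain ⟨F, hF, h1, h2⟩ := h
  exact ⟨fun u => F (u.2, u.1), hF.comp (differentiable_snd.prodMk differentiable_fst),
    fun u₁ u₂ hu => h2 u₂ u₁ hu, fun u₁ u₂ hu => h1 u₂ u₁ hu⟩

lemma ExpSum.zero (w : ℂ) : ExpSum (fun _ => ((0 : ℝ) : ℂ)) w 1 :=
  ⟨0, by simp, Complex.exp_zero⟩

/-- The denominator of an exchange relation. -/
def exchangeDenom (x : ℝ) (a b : ℂ) (u : ℂ × ℂ) : ℂ :=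
  (1 - b * zRatio x u.1 u.2) * (1 - a⁻¹ * zRatio x u.1 u.2)

lemma differentiable_exchangeDenom {x : ℝ} (hx : 0 < x) (a b : ℂ) :
    Differentiable ℂ (exchangeDenom x a b) := by
  have h := differentiable_zRatio hx
  exact ((h.const_mul b).const_sub 1).mul ((h.const_mul a⁻¹).const_sub 1)

lemma exchangeDenom_ne_zero {x : ℝ} (hx0 : 0 < x) (hx1 : x < 1) {a b : ℝ} (ha : Moderate x a)
    (hb : Moderate x b) : exchangeDenom x a b ≠ 0 := by
  intro h
  -- At this point `w = x⁴`, well inside `‖w‖ < x²`, where neither factor vanishes.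
  have h1 := congrFun h (0, 2)
  have hw : ‖zRatio x 0 2‖ < x ^ 2 := by
    have h2 : zRatio x 0 2 = ((x ^ (4 : ℝ) : ℝ) : ℂ) := by
      rw [zRatio_eq hx0, ofReal_rpow_eq_exp hx0]
      push_cast
      ring_nf
    rw [h2, Complex.norm_real, Real.norm_of_nonneg (Real.rpow_nonneg hx0.le _), ← Real.rpow_two]
    exact Real.rpow_lt_rpow_of_exponent_gt hx0 hx1 (by norm_num)
  exact mul_ne_zero (one_sub_ne_zero_of_norm_lt (hb.norm_mul_lt hx0 hw))
    (one_sub_ne_zero_of_norm_lt (ha.norm_inv_mul_lt hx0 hw)) h1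

section

variable {x : ℝ} (hx0 : 0 < x) {a b : ℝ} (ha : Moderate x a) (hb : Moderate x b) {w : ℂ}
  (hw : ‖w‖ < x ^ 2)
include hx0 ha hb hw

lemma expSum_sub : ExpSum (fun m => ((-((a ^ m - b ^ m) / m) : ℝ) : ℂ)) w
    ((1 - b * w)⁻¹ / (1 - a * w)⁻¹) := by
  refine ((ExpSum.geom (hb.norm_mul_lt hx0 hw)).sub (ExpSum.geom (ha.norm_mul_lt hx0 hw))).congr
    fun m _ => ?_
  push_cast
  ring

lemma expSum_inv_sub : ExpSum (fun m => (((b⁻¹ ^ m - a⁻¹ ^ m) / m : ℝ) : ℂ)) w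
    ((1 - (b : ℂ)⁻¹ * w)⁻¹ / (1 - (a : ℂ)⁻¹ * w)⁻¹) := by
  refine ((ExpSum.geom (hb.norm_inv_mul_lt hx0 hw)).sub
    (ExpSum.geom (ha.norm_inv_mul_lt hx0 hw))).congr fun m _ => ?_
  push_cast
  ring

lemma expSum_pos : ExpSum (fun m => ((powerDiff a b⁻¹ m / m : ℝ) : ℂ)) w
    ((1 - a * w)⁻¹ * (1 - (b : ℂ)⁻¹ * w)⁻¹ / (1 - (a : ℂ)⁻¹ * w)⁻¹ / (1 - b * w)⁻¹) := by
  refine ((((ExpSum.geom (ha.norm_mul_lt hx0 hw)).add (ExpSum.geom (hb.norm_inv_mul_lt hx0 hw))).sub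
    (ExpSum.geom (ha.norm_inv_mul_lt hx0 hw))).sub (ExpSum.geom (hb.norm_mul_lt hx0 hw))).congr
    fun m _ => ?_
  rw [powerDiff, inv_inv]
  push_cast
  ring

lemma expSum_neg : ExpSum (fun m => ((-(powerDiff a b⁻¹ m / m) : ℝ) : ℂ)) w
    ((1 - (a : ℂ)⁻¹ * w)⁻¹ * (1 - b * w)⁻¹ / (1 - a * w)⁻¹ / (1 - (b : ℂ)⁻¹ * w)⁻¹) := by
  refine ((((ExpSum.geom (ha.norm_inv_mul_lt hx0 hw)).add (ExpSum.geom (hb.norm_mul_lt hx0 hw))).sub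
    (ExpSum.geom (ha.norm_mul_lt hx0 hw))).sub (ExpSum.geom (hb.norm_inv_mul_lt hx0 hw))).congr
    fun m _ => ?_
  rw [powerDiff, inv_inv]
  push_cast
  ring

end

lemma one_sub_inv_mul_inv {c w : ℂ} (hc : c ≠ 0) (hw : w ≠ 0) :
    1 - c⁻¹ * w⁻¹ = -(1 - c * w) * (c * w)⁻¹ := by
  field_simp
  ring

/-- The zero-mode data of an exchange relation. -/
structure ExchangeZeroModes (P : Params) (Z : ℂ) (a b e : ℝ) (V₁ V₂ W₁ W₂ : Vertex) : Prop where
  shiftV : V₂.shift = V₁.shift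
  shiftW : W₂.shift = W₁.shift
  zV₁ : V₁.zExp W₁.shift = Z
  zV₂ : V₂.zExp W₁.shift = Z
  zW₁ : W₁.zExp V₁.shift = Z
  zW₂ : W₂.zExp V₁.shift = Z
  x12 : P.x ^ V₁.xExp W₁.shift = a * e * P.x ^ W₂.xExp V₁.shift
  x11 : P.x ^ V₁.xExp W₁.shift = e * b * P.x ^ W₁.xExp V₁.shift
  x22 : P.x ^ V₂.xExp W₁.shift = e * b * P.x ^ W₂.xExp V₁.shift

/-- The pair I–II needs no rational correction. The correction for II–I has poles at `b w = 1` and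
`w = a`, and those for I–I and II–II only at `b w = 1`; `g` clears them all. Rewriting a correction
from `w⁻¹` to `w` yields constants, and these are what `ExchangeZeroModes` compensates. -/
lemma ExchangeContr.contractionsContinue {P : Params} (hx0 : 0 < P.x) (hx1 : P.x < 1) {t : ℝ}
    (ht : 0 < t) {p p' : ℝ} {a b e : ℝ} (ha : a = P.x ^ (-2 * p)) (he : e = P.x ^ (-2 * p'))
    (hma : Moderate P.x a) (hmb : Moderate P.x b) (hme : Moderate P.x e) {V₁ V₂ W₁ W₂ : Vertex}
    (h : ExchangeContr P (P.x ^ (2 * t)) a b e V₁ V₂ W₁ W₂)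
    (hz : ExchangeZeroModes P (-(2 * (p + p') / t)) a b e V₁ V₂ W₁ W₂) :
    let L := thetaProd P.x t p p'
    let R := fun u₁ u₂ => thetaProd P.x t p p' u₂ u₁
    let g := exchangeDenom P.x a b
    ContractionsContinue P L R (P.x ^ 2) g V₁ W₁ ∧ ContractionsContinue P L R (P.x ^ 2) g V₁ W₂ ∧
    ContractionsContinue P L R (P.x ^ 2) g V₂ W₁ ∧ ContractionsContinue P L R (P.x ^ 2) g V₂ W₂ := by
  intro L R g
  have ha0 := hma.ofReal_ne_zero hx0
  have hb0 := hmb.ofReal_ne_zero hx0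
  have he0 := hme.ofReal_ne_zero hx0
  have x12 : ((P.x ^ V₁.xExp W₁.shift : ℝ) : ℂ) = a * e * ((P.x ^ W₂.xExp V₁.shift : ℝ) : ℂ) := by
    exact_mod_cast hz.x12
  have x11 : ((P.x ^ V₁.xExp W₁.shift : ℝ) : ℂ) = e * b * ((P.x ^ W₁.xExp V₁.shift : ℝ) : ℂ) := by
    exact_mod_cast hz.x11
  have x22 : ((P.x ^ V₂.xExp W₁.shift : ℝ) : ℂ) = e * b * ((P.x ^ W₂.xExp V₁.shift : ℝ) : ℂ) := by
    exact_mod_cast hz.x22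
  have hd := differentiable_zRatio hx0
  refine ⟨?_, ?_, ?_, ?_⟩
  · refine contractionsContinue_core hx0 hx1 ht ha he hma hme hz.zV₁ hz.zW₁
      (A := fun m => -((a ^ m - b ^ m) / m)) (B := fun m => (b⁻¹ ^ m - a⁻¹ ^ m) / m)
      -- The correction is `(1 - a w)/(1 - b w)`; multiplication by `g` replaces `1 - b w` by `1 - a
      -- w`.
      (f := fun u => (a * e : ℂ)⁻¹ * ((P.x ^ V₁.xExp W₁.shift : ℝ) : ℂ) *
        ((1 - a * zRatio P.x u.1 u.2) * (1 - (a : ℂ)⁻¹ * zRatio P.x u.1 u.2)))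
      (fun m hm => by rw [h.h11 m hm, sub_eq_add_neg]) h.k11
      (fun w hw => expSum_sub hx0 hma hmb hw) (fun w hw => expSum_inv_sub hx0 hma hmb hw)
      ((((hd.const_mul _).const_sub 1).mul ((hd.const_mul _).const_sub 1)).const_mul _)
      (fun u₁ u₂ hw => ?_) fun u₁ u₂ hw => ?_
    · have h1 := one_sub_ne_zero_of_norm_lt (hmb.norm_mul_lt hx0 hw)
      dsimp only [g, exchangeDenom]
      rw [div_inv_eq_mul]
      field_simp
    · have hw0 := zRatio_ne_zero hx0 u₁ u₂
      have h1 := one_sub_ne_zero_of_norm_lt (hmb.norm_inv_mul_lt hx0 hw)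
      dsimp only [g, exchangeDenom]
      rw [one_sub_inv_mul_inv hb0 hw0] at h1 ⊢
      rw [one_sub_inv_mul_inv ha0 hw0, x11]
      have h2 := neg_ne_zero.mp (left_ne_zero_of_mul h1)
      generalize zRatio P.x u₁ u₂ = w at *
      generalize 1 - b * w = B at *
      generalize 1 - a * w = A at *
      generalize 1 - (a : ℂ)⁻¹ * w = C at *
      field_simp
  · refine contractionsContinue_core hx0 hx1 ht ha he hma hme (hz.shiftW ▸ hz.zV₁) hz.zW₂
      (A := fun _ => 0) (B := fun _ => 0)
      (f := fun u => exchangeDenom P.x a b u * ((P.x ^ W₂.xExp V₁.shift : ℝ) : ℂ))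
      (fun m hm => by rw [h.h12 m hm, add_zero]) (fun m hm => by rw [h.k21 m hm, add_zero])
      (fun w _ => ExpSum.zero w) (fun w _ => ExpSum.zero w)
      ((differentiable_exchangeDenom hx0 _ _).mul_const _) (fun u₁ u₂ _ => ?_) fun u₁ u₂ _ => ?_
    · dsimp only [g]
      rw [hz.shiftW, x12]
      ring
    · dsimp only [g]
      rw [mul_one]
  · refine contractionsContinue_core hx0 hx1 ht ha he hma hme hz.zV₂ (hz.shiftV ▸ hz.zW₁)
      (A := fun m => -(powerDiff a b⁻¹ m / m)) (B := fun m => powerDiff a b⁻¹ m / m)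
      -- Here both factors of `g` are used up by the denominators, and only the numerators `1 - a w`
      -- and `1 - b⁻¹ w` remain.
      (f := fun u => (a * e : ℂ)⁻¹ * ((P.x ^ V₂.xExp W₁.shift : ℝ) : ℂ) *
        ((1 - a * zRatio P.x u.1 u.2) * (1 - (b : ℂ)⁻¹ * zRatio P.x u.1 u.2)))
      (fun m hm => by rw [h.h21 m hm, sub_eq_add_neg]) h.k12
      (fun w hw => expSum_neg hx0 hma hmb hw) (fun w hw => expSum_pos hx0 hma hmb hw)
      ((((hd.const_mul _).const_sub 1).mul ((hd.const_mul _).const_sub 1)).const_mul _)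
      (fun u₁ u₂ hw => ?_) fun u₁ u₂ hw => ?_
    · have h1 := one_sub_ne_zero_of_norm_lt (hmb.norm_mul_lt hx0 hw)
      have h2 := one_sub_ne_zero_of_norm_lt (hma.norm_inv_mul_lt hx0 hw)
      dsimp only [g, exchangeDenom]
      rw [div_inv_eq_mul, div_inv_eq_mul]
      generalize zRatio P.x u₁ u₂ = w at *
      generalize 1 - b * w = B at *
      generalize 1 - a * w = A at *
      generalize 1 - (a : ℂ)⁻¹ * w = C at *
      field_simp
    · have hw0 := zRatio_ne_zero hx0 u₁ u₂
      have h1 := one_sub_ne_zero_of_norm_lt (hmb.norm_inv_mul_lt hx0 hw)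
      have h2 := one_sub_ne_zero_of_norm_lt (hma.norm_mul_lt hx0 hw)
      dsimp only [g, exchangeDenom]
      have e1 : 1 - a * (zRatio P.x u₁ u₂)⁻¹ =
          -(1 - (a : ℂ)⁻¹ * zRatio P.x u₁ u₂) * (a * (zRatio P.x u₁ u₂)⁻¹) := by
        field_simp
        ring
      have e2 : 1 - b * (zRatio P.x u₁ u₂)⁻¹ =
          -(1 - (b : ℂ)⁻¹ * zRatio P.x u₁ u₂) * (b * (zRatio P.x u₁ u₂)⁻¹) := by
        field_simp
        ring
      -- The fourth relation between the zero-mode factors is a consequence of the other three.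
      have x21 : ((P.x ^ V₂.xExp W₁.shift : ℝ) : ℂ) =
          e * b ^ 2 / a * ((P.x ^ W₁.xExp V₁.shift : ℝ) : ℂ) := by
        rw [x11] at x12
        rw [x22]
        field_simp
        field_simp at x12
        rw [x12]
        ring
      rw [one_sub_inv_mul_inv hb0 hw0] at h1 ⊢
      rw [e1] at h2 ⊢
      rw [e2, one_sub_inv_mul_inv ha0 hw0, x21, hz.shiftV]
      have h3 := neg_ne_zero.mp (left_ne_zero_of_mul h1)
      have h4 := neg_ne_zero.mp (left_ne_zero_of_mul h2)
      generalize zRatio P.x u₁ u₂ = w at *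
      generalize 1 - b * w = B at *
      generalize 1 - a * w = A at *
      generalize 1 - (a : ℂ)⁻¹ * w = C at *
      generalize 1 - (b : ℂ)⁻¹ * w = D at *
      field_simp
  · refine contractionsContinue_core hx0 hx1 ht ha he hma hme (hz.shiftW ▸ hz.zV₂)
      (hz.shiftV ▸ hz.zW₂)
      (A := fun m => -((a ^ m - b ^ m) / m)) (B := fun m => (b⁻¹ ^ m - a⁻¹ ^ m) / m)
      (f := fun u => (a * e : ℂ)⁻¹ * ((P.x ^ V₂.xExp W₁.shift : ℝ) : ℂ) *
        ((1 - a * zRatio P.x u.1 u.2) * (1 - (a : ℂ)⁻¹ * zRatio P.x u.1 u.2)))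
      (fun m hm => by rw [h.h22 m hm, sub_eq_add_neg]) h.k22
      (fun w hw => expSum_sub hx0 hma hmb hw) (fun w hw => expSum_inv_sub hx0 hma hmb hw)
      ((((hd.const_mul _).const_sub 1).mul ((hd.const_mul _).const_sub 1)).const_mul _)
      (fun u₁ u₂ hw => ?_) fun u₁ u₂ hw => ?_
    · have h1 := one_sub_ne_zero_of_norm_lt (hmb.norm_mul_lt hx0 hw)
      dsimp only [g, exchangeDenom]
      rw [div_inv_eq_mul, hz.shiftW]
      field_simp
    · have hw0 := zRatio_ne_zero hx0 u₁ u₂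
      have h1 := one_sub_ne_zero_of_norm_lt (hmb.norm_inv_mul_lt hx0 hw)
      dsimp only [g, exchangeDenom]
      rw [one_sub_inv_mul_inv hb0 hw0] at h1 ⊢
      rw [one_sub_inv_mul_inv ha0 hw0, x22, hz.shiftV]
      have h2 := neg_ne_zero.mp (left_ne_zero_of_mul h1)
      generalize zRatio P.x u₁ u₂ = w at *
      generalize 1 - b * w = B at *
      generalize 1 - a * w = A at *
      generalize 1 - (a : ℂ)⁻¹ * w = C at *
      field_simp

/-! ### Zero modes -/

lemma hEig_add (a b : Charge) : hEig (a + b) = hEig a + hEig b := by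
  rw [hEig, hEig, hEig, show (a + b).n = a.n + b.n from rfl]
  push_cast
  ring

lemma h0Eig_add (P : Params) (a b : Charge) : h0Eig P (a + b) = h0Eig P a + h0Eig P b := by
  rw [h0Eig, h0Eig, h0Eig, show (a + b).n₀ = a.n₀ + b.n₀ from rfl]
  push_cast
  ring

lemma hjEig_add (P : Params) (j : Fin 2) (a b : Charge) :
    hjEig P j (a + b) = hjEig P j a + hjEig P j b := by
  rw [hjEig, hjEig, hjEig, show (a + b).n₁ = a.n₁ + b.n₁ from rfl,
    show (a + b).n₂ = a.n₂ + b.n₂ from rfl]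
  split_ifs <;> push_cast <;> ring

lemma Vertex.IsLinear.join {V W : Vertex} (hV : V.IsLinear) (hW : W.IsLinear) :
    (V.join W).IsLinear where
  x_add a b := by
    simp only [Vertex.join, hV.x_add, hW.x_add]
    ring
  z_add a b := by
    simp only [Vertex.join, hV.z_add, hW.z_add]
    ring

lemma isLinear_cVertex (P : Params) (j : Fin 2) : (cVertex P j).IsLinear where
  x_add a b := by simp only [cVertex, add_zero]
  z_add a b := by
    simp only [cVertex, show (a + b).p = a.p + b.p from rfl]
    ring

lemma isLinear_cDagVertex (P : Params) (j : Fin 2) : (cDagVertex P j).IsLinear where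
  x_add a b := by simp only [cDagVertex, add_zero]
  z_add a b := by
    simp only [cDagVertex, show (a + b).p = a.p + b.p from rfl]
    ring

lemma isLinear_psiI (P : Params) (j : Fin 2) : (psiI P j).IsLinear where
  x_add a b := by
    simp only [psiI, hEig_add, h0Eig_add, hjEig_add]
    ring
  z_add a b := by
    simp only [psiI, hEig_add]
    push_cast
    ring

lemma isLinear_psiII (P : Params) (j : Fin 2) : (psiII P j).IsLinear where
  x_add a b := by
    simp only [psiII, hEig_add, h0Eig_add, hjEig_add]
    ring
  z_add a b := by
    simp only [psiII, hEig_add]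
    push_cast
    ring

lemma isLinear_psiDagI (P : Params) (j : Fin 2) : (psiDagI P j).IsLinear where
  x_add a b := by
    simp only [psiDagI, hEig_add, h0Eig_add, hjEig_add]
    ring
  z_add a b := by
    simp only [psiDagI, hEig_add]
    push_cast
    ring

lemma isLinear_psiDagII (P : Params) (j : Fin 2) : (psiDagII P j).IsLinear where
  x_add a b := by
    simp only [psiDagII, hEig_add, h0Eig_add, hjEig_add]
    ring
  z_add a b := by
    simp only [psiDagII, hEig_add]
    push_cast
    ring

lemma isLinear_eI (P : Params) (j : Fin 2) : (eI P j).IsLinear :=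
  (isLinear_cVertex P j).join (isLinear_psiI P j)

lemma isLinear_eII (P : Params) (j : Fin 2) : (eII P j).IsLinear :=
  (isLinear_cVertex P j).join (isLinear_psiII P j)

lemma isLinear_fI (P : Params) (j : Fin 2) : (fI P j).IsLinear :=
  (isLinear_cDagVertex P j).join (isLinear_psiDagI P j)

lemma isLinear_fII (P : Params) (j : Fin 2) : (fII P j).IsLinear :=
  (isLinear_cDagVertex P j).join (isLinear_psiDagII P j)

lemma shift_eI (P : Params) (j : Fin 2) : (eI P j).shift =
    ⟨-eps j * zeta P, eps j, eps j, if j = 0 then 1 else 0, if j = 1 then 1 else 0⟩ := by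
  ext
  · exact add_zero _
  · exact zero_add _
  · exact zero_add _
  · exact zero_add _
  · exact zero_add _

lemma shift_fI (P : Params) (j : Fin 2) : (fI P j).shift =
    ⟨eps j * zetaT P, -eps j, -eps j, if j = 0 then 1 else 0, if j = 1 then 1 else 0⟩ := by
  ext
  · exact add_zero _
  · exact zero_add _
  · exact zero_add _
  · exact zero_add _
  · exact zero_add _

lemma shift_eII (P : Params) (j : Fin 2) : (eII P j).shift = (eI P j).shift := rfl

lemma shift_fII (P : Params) (j : Fin 2) : (fII P j).shift = (fI P j).shift := rfl

/-- `h_1` pairs with `α_2` and `h_2` with `α_1`, so `h_i` sees the charge of a current with index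
`j` only when `i ≠ j`. -/
lemma hjEig_mk (P : Params) (i j : Fin 2) (p : ℂ) (n n₀ : ℤ) :
    hjEig P i ⟨p, n, n₀, if j = 0 then 1 else 0, if j = 1 then 1 else 0⟩ =
      if i = j then 0 else 2 - P.s := by
  fin_cases i <;> fin_cases j <;> simp [hjEig]

section

variable (P : Params) (i j : Fin 2)

lemma xExp_eI_E : (eI P i).xExp (eI P j).shift =
    eps i * eps j + (2 - P.s) * eps j + if i = j then 0 else 2 - P.s := by
  rw [shift_eI]
  change 0 + _ = _
  simp only [psiI, hEig, h0Eig, hjEig_mk]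
  ring

lemma xExp_eII_E : (eII P i).xExp (eI P j).shift =
    -(eps i * eps j) + (2 - P.s) * eps j - if i = j then 0 else 2 - P.s := by
  rw [shift_eI]
  change 0 + _ = _
  simp only [psiII, hEig, h0Eig, hjEig_mk]
  ring

lemma xExp_fI_F : (fI P i).xExp (fI P j).shift =
    -(eps i * eps j) + (2 - P.s) * eps j - if i = j then 0 else 2 - P.s := by
  rw [shift_fI]
  change 0 + _ = _
  simp only [psiDagI, hEig, h0Eig, hjEig_mk]
  push_cast
  ring

lemma xExp_fII_F : (fII P i).xExp (fI P j).shift =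
    eps i * eps j + (2 - P.s) * eps j + if i = j then 0 else 2 - P.s := by
  rw [shift_fI]
  change 0 + _ = _
  simp only [psiDagII, hEig, h0Eig, hjEig_mk]
  push_cast
  ring

lemma xExp_eI_F : (eI P i).xExp (fI P j).shift =
    -(eps i * eps j) - (2 - P.s) * eps j + if i = j then 0 else 2 - P.s := by
  rw [shift_fI]
  change 0 + _ = _
  simp only [psiI, hEig, h0Eig, hjEig_mk]
  push_cast
  ring

lemma xExp_eII_F : (eII P i).xExp (fI P j).shift =
    eps i * eps j - (2 - P.s) * eps j - if i = j then 0 else 2 - P.s := by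
  rw [shift_fI]
  change 0 + _ = _
  simp only [psiII, hEig, h0Eig, hjEig_mk]
  push_cast
  ring

lemma xExp_fI_E : (fI P i).xExp (eI P j).shift =
    eps i * eps j - (2 - P.s) * eps j - if i = j then 0 else 2 - P.s := by
  rw [shift_eI]
  change 0 + _ = _
  simp only [psiDagI, hEig, h0Eig, hjEig_mk]
  ring

lemma xExp_fII_E : (fII P i).xExp (eI P j).shift =
    -(eps i * eps j) - (2 - P.s) * eps j + if i = j then 0 else 2 - P.s := by
  rw [shift_eI]
  change 0 + _ = _
  simp only [psiDagII, hEig, h0Eig, hjEig_mk]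
  ring

lemma zExp_eI_E : (eI P i).zExp (eI P j).shift =
    eps i * eps j * (zeta P ^ 2 - 2 / P.k) := by
  rw [shift_eI]
  simp only [join, cVertex, psiI, hEig]
  push_cast
  ring

lemma zExp_fI_F : (fI P i).zExp (fI P j).shift =
    eps i * eps j * (zetaT P ^ 2 - 2 / P.k) := by
  rw [shift_fI]
  simp only [join, cDagVertex, psiDagI, hEig]
  push_cast
  ring

lemma zExp_eI_F : (eI P i).zExp (fI P j).shift =
    -(eps i * eps j * (zeta P * zetaT P - 2 / P.k)) := by
  rw [shift_fI]
  simp only [join, cVertex, psiI, hEig]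
  push_cast
  ring

lemma zExp_fI_E : (fI P i).zExp (eI P j).shift =
    -(eps i * eps j * (zeta P * zetaT P - 2 / P.k)) := by
  rw [shift_eI]
  simp only [join, cDagVertex, psiDagI, hEig]
  push_cast
  ring

end

lemma cpow_half_sq (z : ℂ) (hz : z ≠ 0) : (z ^ (1 / 2 : ℂ)) ^ 2 = z := by
  rw [pow_two, ← Complex.cpow_add _ _ hz]
  norm_num

section

variable {P : Params} (hr : 0 < P.r) (hk : P.k ≠ 0) (hrk : 0 < P.r - P.k)
include hr hk hrk

lemma zeta_sq : zeta P ^ 2 = 2 * P.r / (P.k * (P.r - P.k)) := by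
  rw [zeta, cpow_half_sq]
  · push_cast
    rfl
  · exact_mod_cast (div_ne_zero (by positivity) (mul_ne_zero hk hrk.ne'))

lemma zetaT_sq : zetaT P ^ 2 = 2 * (P.r - P.k) / (P.k * P.r) := by
  rw [zetaT, cpow_half_sq]
  · push_cast
    rfl
  · exact_mod_cast (div_ne_zero (mul_ne_zero two_ne_zero hrk.ne') (mul_ne_zero hk hr.ne'))

/-- For `k < 0` both square roots are imaginary, and multiplying radicands could lose a sign. Their
ratio is the square of a positive number, and such a factor leaves a principal root without any
change of branch. -/
lemma zetaT_eq : zetaT P = (((P.r - P.k) / P.r : ℝ) : ℂ) * zeta P := by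
  have hc : 0 < (P.r - P.k) / P.r := div_pos hrk hr
  have hz : 2 * P.r / (P.k * (P.r - P.k)) ≠ 0 :=
    div_ne_zero (by positivity) (mul_ne_zero hk hrk.ne')
  have h1 : 2 * (P.r - P.k) / (P.k * P.r) =
      ((P.r - P.k) / P.r) ^ 2 * (2 * P.r / (P.k * (P.r - P.k))) := by
    have := hrk.ne'
    field_simp
  have h2 : ((2 * P.r / (P.k * (P.r - P.k)) : ℝ) : ℂ) ≠ 0 := by exact_mod_cast hz
  have h3 : ((((P.r - P.k) / P.r) ^ 2 : ℝ) : ℂ) ≠ 0 := by exact_mod_cast (pow_pos hc 2).ne'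
  rw [zetaT, zeta, h1, Complex.ofReal_mul, Complex.cpow_def_of_ne_zero (mul_ne_zero h3 h2),
    Complex.cpow_def_of_ne_zero h2, Complex.log_ofReal_mul (pow_pos hc 2) h2, add_mul,
    Complex.exp_add, Real.log_pow]
  congr 1
  rw [← Complex.exp_log (by exact_mod_cast hc.ne' : (((P.r - P.k) / P.r : ℝ) : ℂ) ≠ 0),
    ← Complex.ofReal_log hc.le]
  congr 1
  push_cast
  ring

/-- This value cancels the power of `z` from `e^{±α}` against the one from `Q₀`, so that only
integral powers of `z₂/z₁` occur between `E_j` and `F_j`. -/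
lemma zeta_mul_zetaT : zeta P * zetaT P = 2 / P.k := by
  have h1 : (P.r : ℂ) ≠ 0 := by exact_mod_cast hr.ne'
  have h2 : (P.r : ℂ) - P.k ≠ 0 := by exact_mod_cast hrk.ne'
  have h3 : (P.k : ℂ) ≠ 0 := by exact_mod_cast hk
  have := zeta_sq hr hk hrk
  rw [zetaT_eq hr hk hrk]
  push_cast
  rw [show zeta P * (((P.r : ℂ) - P.k) / P.r * zeta P) = ((P.r : ℂ) - P.k) / P.r * zeta P ^ 2 by ring,
    this]
  field_simp

lemma zeta_sq_sub : zeta P ^ 2 - 2 / P.k = 2 / (P.r - P.k) := by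
  have h2 : (P.r : ℂ) - P.k ≠ 0 := by exact_mod_cast hrk.ne'
  have h3 : (P.k : ℂ) ≠ 0 := by exact_mod_cast hk
  rw [zeta_sq hr hk hrk]
  field_simp
  ring

lemma zetaT_sq_sub : zetaT P ^ 2 - 2 / P.k = -(2 / P.r) := by
  have h1 : (P.r : ℂ) ≠ 0 := by exact_mod_cast hr.ne'
  have h3 : (P.k : ℂ) ≠ 0 := by exact_mod_cast hk
  rw [zetaT_sq hr hk hrk]
  field_simp
  ring

end

lemma eps_mul_self (j : Fin 2) : eps j * eps j = 1 := by
  fin_cases j <;> simp [eps]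

lemma eps_zero : eps 0 = 1 := rfl

lemma eps_one : eps 1 = -1 := rfl

/-! ### The currents in terms of vertex operators -/

/-- The factors live in disjoint families of bosons, and the zero modes of `C` ignore the charge of
`Ψ`. The product at one point is therefore already normally ordered. -/
lemma mul_toCurrent_sub {P : Params} (hx : 0 < P.x) {V W₁ W₂ : Vertex} (hV : V.IsLinear)
    (hα : IsAlpha V) (h₁ : IsBetaGamma W₁) (h₂ : IsBetaGamma W₂)
    (hx₁ : V.xExp W₁.shift = 0) (hx₂ : V.xExp W₂.shift = 0)
    (hz₁ : V.zExp W₁.shift = 0) (hz₂ : V.zExp W₂.shift = 0) (s : ℂ) (c : ℂ) (v : Fock) :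
    Current.mul (V.toCurrent P) (fun d w => s • (W₁.toCurrent P d w - W₂.toCurrent P d w)) c v =
      s • ((V.join W₁).toLin P c v - (V.join W₂).toLin P c v) := by
  obtain ⟨f1, e1⟩ := toCurrent_mul hx hV (fun m _ => hα.contr_eq_zero h₁ m) hx₁ hz₁ c v
  obtain ⟨f2, e2⟩ := toCurrent_mul hx hV (fun m _ => hα.contr_eq_zero h₂ m) hx₂ hz₂ c v
  rw [Current.mul, ← e1, ← e2, ← finsum_sub_distrib f1 f2, smul_finsum]
  refine finsum_congr fun d => ?_
  rw [toCurrent_eq, toCurrent_eq, toCurrent_eq, map_smul, map_sub]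

lemma currentE_eq {P : Params} (hx : 0 < P.x) (j : Fin 2) (c : ℂ) (v : Fock) :
    currentE P j c v = (1 / ((P.x - P.x⁻¹ : ℝ) : ℂ)) •
      ((eI P j).toLin P c v - (eII P j).toLin P c v) :=
  mul_toCurrent_sub hx (isLinear_cVertex P j) (isAlpha_cVertex P j) (isBetaGamma_psiI P j)
    (isBetaGamma_psiII P j) rfl rfl (mul_zero _) (mul_zero _) _ c v

lemma currentF_eq {P : Params} (hx : 0 < P.x) (j : Fin 2) (c : ℂ) (v : Fock) :
    currentF P j c v = (-1 / ((P.x - P.x⁻¹ : ℝ) : ℂ)) •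
      ((fI P j).toLin P c v - (fII P j).toLin P c v) :=
  mul_toCurrent_sub hx (isLinear_cDagVertex P j) (isAlpha_cDagVertex P j) (isBetaGamma_psiDagI P j)
    (isBetaGamma_psiDagII P j) rfl rfl (mul_zero _) (mul_zero _) _ c v

/-! ### The exchange relations -/

lemma moderate_rpow {x : ℝ} (hx0 : 0 < x) (hx1 : x < 1) {y c : ℝ} (hy : y = x ^ c) (h1 : -2 ≤ c)
    (h2 : c ≤ 2) : Moderate x y := by
  rw [hy]
  constructor
  · rw [← Real.rpow_two]
    exact Real.rpow_le_rpow_of_exponent_ge hx0 hx1.le h2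
  · rw [← Real.rpow_two, ← Real.rpow_neg hx0.le]
    exact Real.rpow_le_rpow_of_exponent_ge hx0 hx1.le (by linarith)

section

variable {P : Params} (hx0 : 0 < P.x) (hx1 : P.x < 1) (hr : 0 < P.r) (hk : P.k ≠ 0)
  (hrk : 0 < P.r - P.k)

include hx0 in
lemma sq_inv_eq_rpow : (P.x ^ 2)⁻¹ = P.x ^ (-2 : ℝ) := by
  rw [Real.rpow_neg hx0.le, Real.rpow_two]

include hx0 in
lemma rpow_s_div_sq : P.x ^ P.s / P.x ^ 2 = P.x ^ (P.s - 2) := by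
  rw [Real.rpow_sub hx0, Real.rpow_two]

include hx0 in
lemma sq_div_rpow_s : P.x ^ 2 / P.x ^ P.s = P.x ^ (2 - P.s) := by
  rw [Real.rpow_sub hx0, Real.rpow_two]

include hx0 hr hk hrk in
lemma exchangeZeroModes_E_self (j : Fin 2) :
    ExchangeZeroModes P (-(2 * ((0 : ℝ) + (-1 : ℝ)) / (P.r - P.k : ℝ))) 1 (P.x ^ 2)⁻¹ (P.x ^ 2)
      (eI P j) (eII P j) (eI P j) (eII P j) := by
  have hz : (eI P j).zExp (eI P j).shift = -(2 * ((0 : ℝ) + (-1 : ℝ)) / (P.r - P.k : ℝ)) := by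
    rw [zExp_eI_E, zeta_sq_sub hr hk hrk, ← Int.cast_mul, eps_mul_self]
    push_cast
    ring
  have hX : P.x ^ 2 ≠ 0 := by positivity
  refine ⟨rfl, rfl, hz, hz, hz, hz, ?_, ?_, ?_⟩
  · rw [xExp_eI_E, xExp_eII_E, if_pos rfl, ← Int.cast_mul, eps_mul_self, one_mul,
      ← Real.rpow_two, ← Real.rpow_add hx0]
    congr 1
    push_cast
    ring
  · rw [mul_inv_cancel₀ hX, one_mul]
  · rw [mul_inv_cancel₀ hX, one_mul]

include hx0 hr hk hrk in
lemma exchangeZeroModes_F_self (j : Fin 2) :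
    ExchangeZeroModes P (-(2 * ((0 : ℝ) + (1 : ℝ)) / P.r)) 1 (P.x ^ 2) (P.x ^ 2)⁻¹
      (fI P j) (fII P j) (fI P j) (fII P j) := by
  have hz : (fI P j).zExp (fI P j).shift = -(2 * ((0 : ℝ) + (1 : ℝ)) / P.r) := by
    rw [zExp_fI_F, zetaT_sq_sub hr hk hrk, ← Int.cast_mul, eps_mul_self]
    push_cast
    ring
  have hX : P.x ^ 2 ≠ 0 := by positivity
  refine ⟨rfl, rfl, hz, hz, hz, hz, ?_, ?_, ?_⟩
  · rw [xExp_fI_F, xExp_fII_F, if_pos rfl, ← Int.cast_mul, eps_mul_self, one_mul,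
      sq_inv_eq_rpow hx0, ← Real.rpow_add hx0]
    congr 1
    push_cast
    ring
  · rw [inv_mul_cancel₀ hX, one_mul]
  · rw [inv_mul_cancel₀ hX, one_mul]

include hx0 hr hk hrk in
lemma exchangeZeroModes_E_ne :
    ExchangeZeroModes P (-(2 * ((P.s / 2 : ℝ) + (-(P.s / 2) + 1 : ℝ)) / (P.r - P.k : ℝ)))
      (P.x ^ P.s)⁻¹ (P.x ^ P.s / P.x ^ 2) (P.x ^ P.s / P.x ^ 2)
      (eI P 0) (eII P 0) (eI P 1) (eII P 1) := by
  have hz : ∀ i j, i ≠ j → (eI P i).zExp (eI P j).shift =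
      -(2 * ((P.s / 2 : ℝ) + (-(P.s / 2) + 1 : ℝ)) / (P.r - P.k : ℝ)) := by
    intro i j hij
    have he : eps i * eps j = -1 := by
      revert hij
      fin_cases i <;> fin_cases j <;> simp [eps]
    rw [zExp_eI_E, zeta_sq_sub hr hk hrk, ← Int.cast_mul, he]
    push_cast
    ring
  refine ⟨rfl, rfl, hz 0 1 (by decide), hz 0 1 (by decide), hz 1 0 (by decide), hz 1 0 (by decide),
    ?_, ?_, ?_⟩
  · rw [xExp_eI_E, xExp_eII_E, if_neg (by decide), if_neg (by decide), eps_zero, eps_one,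
      rpow_s_div_sq hx0, ← Real.rpow_neg hx0.le, ← Real.rpow_add hx0, ← Real.rpow_add hx0]
    congr 1
    push_cast
    ring
  · rw [xExp_eI_E, xExp_eI_E, if_neg (by decide), if_neg (by decide), eps_zero, eps_one,
      rpow_s_div_sq hx0, ← Real.rpow_add hx0, ← Real.rpow_add hx0]
    congr 1
    push_cast
    ring
  · rw [xExp_eII_E, xExp_eII_E, if_neg (by decide), if_neg (by decide), eps_zero, eps_one,
      rpow_s_div_sq hx0, ← Real.rpow_add hx0, ← Real.rpow_add hx0]
    congr 1
    push_cast
    ring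

include hx0 hr hk hrk in
lemma exchangeZeroModes_F_ne :
    ExchangeZeroModes P (-(2 * ((-(P.s / 2) : ℝ) + (P.s / 2 - 1 : ℝ)) / P.r))
      (P.x ^ P.s) (P.x ^ 2 / P.x ^ P.s) (P.x ^ 2 / P.x ^ P.s)
      (fI P 1) (fII P 1) (fI P 0) (fII P 0) := by
  have hz : ∀ i j, i ≠ j → (fI P i).zExp (fI P j).shift =
      -(2 * ((-(P.s / 2) : ℝ) + (P.s / 2 - 1 : ℝ)) / P.r) := by
    intro i j hij
    have he : eps i * eps j = -1 := by
      revert hij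
      fin_cases i <;> fin_cases j <;> simp [eps]
    rw [zExp_fI_F, zetaT_sq_sub hr hk hrk, ← Int.cast_mul, he]
    push_cast
    ring
  refine ⟨rfl, rfl, hz 1 0 (by decide), hz 1 0 (by decide), hz 0 1 (by decide), hz 0 1 (by decide),
    ?_, ?_, ?_⟩
  · rw [xExp_fI_F, xExp_fII_F, if_neg (by decide), if_neg (by decide), eps_zero, eps_one,
      sq_div_rpow_s hx0, ← Real.rpow_add hx0, ← Real.rpow_add hx0]
    congr 1
    push_cast
    ring
  · rw [xExp_fI_F, xExp_fI_F, if_neg (by decide), if_neg (by decide), eps_zero, eps_one,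
      sq_div_rpow_s hx0, ← Real.rpow_add hx0, ← Real.rpow_add hx0]
    congr 1
    push_cast
    ring
  · rw [xExp_fII_F, xExp_fII_F, if_neg (by decide), if_neg (by decide), eps_zero, eps_one,
      sq_div_rpow_s hx0, ← Real.rpow_add hx0, ← Real.rpow_add hx0]
    congr 1
    push_cast
    ring

include hx0 hx1 hr hk hrk

theorem exchangeRelation_E_self (j : Fin 2) :
    ExchangeRelation P.x (thetaProd P.x (P.r - P.k) (0 : ℝ) (-1 : ℝ))
      (fun u₁ u₂ => thetaProd P.x (P.r - P.k) (0 : ℝ) (-1 : ℝ) u₂ u₁)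
      (currentE P j) (currentE P j) := by
  have ha : (1 : ℝ) = P.x ^ (-2 * (0 : ℝ)) := by rw [mul_zero, Real.rpow_zero]
  have he : P.x ^ 2 = P.x ^ (-2 * (-1 : ℝ)) := by norm_num
  have hma := moderate_rpow hx0 hx1 ha (by norm_num) (by norm_num)
  have hmb := moderate_rpow hx0 hx1 (sq_inv_eq_rpow hx0) (by norm_num) (by norm_num)
  have hme := moderate_rpow hx0 hx1 he (by norm_num) (by norm_num)
  obtain ⟨h11, h12, h21, h22⟩ := (exchangeContr_E_self hx0 hx1 hk hrk.ne' j).contractionsContinue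
    hx0 hx1 hrk ha he hma hmb hme (exchangeZeroModes_E_self hx0 hr hk hrk j)
  exact exchangeRelation_of_contractions hx0 (by positivity) (differentiable_exchangeDenom hx0 _ _)
    (exchangeDenom_ne_zero hx0 hx1 hma hmb) (currentE_eq hx0 j) (currentE_eq hx0 j)
    (isLinear_eI P j) (isLinear_eII P j) (isLinear_eI P j) (isLinear_eII P j) h11 h12 h21 h22

theorem exchangeRelation_F_self (j : Fin 2) :
    ExchangeRelation P.x (thetaProd P.x P.r (0 : ℝ) (1 : ℝ))
      (fun u₁ u₂ => thetaProd P.x P.r (0 : ℝ) (1 : ℝ) u₂ u₁) (currentF P j) (currentF P j) := by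
  have ha : (1 : ℝ) = P.x ^ (-2 * (0 : ℝ)) := by rw [mul_zero, Real.rpow_zero]
  have he : (P.x ^ 2)⁻¹ = P.x ^ (-2 * (1 : ℝ)) := by rw [mul_one, sq_inv_eq_rpow hx0]
  have hma := moderate_rpow hx0 hx1 ha (by norm_num) (by norm_num)
  have hme := moderate_rpow hx0 hx1 he (by norm_num) (by norm_num)
  have hmb : Moderate P.x (P.x ^ 2) := by
    have := hme.inv
    rwa [inv_inv] at this
  obtain ⟨h11, h12, h21, h22⟩ := (exchangeContr_F_self hx0 hx1 hk hr.ne' j).contractionsContinue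
    hx0 hx1 hr ha he hma hmb hme (exchangeZeroModes_F_self hx0 hr hk hrk j)
  exact exchangeRelation_of_contractions hx0 (by positivity) (differentiable_exchangeDenom hx0 _ _)
    (exchangeDenom_ne_zero hx0 hx1 hma hmb) (currentF_eq hx0 j) (currentF_eq hx0 j)
    (isLinear_fI P j) (isLinear_fII P j) (isLinear_fI P j) (isLinear_fII P j) h11 h12 h21 h22

theorem exchangeRelation_E_ne (hs0 : 0 < P.s) (hs2 : P.s < 2) :
    ExchangeRelation P.x (thetaProd P.x (P.r - P.k) (P.s / 2) (-(P.s / 2) + 1))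
      (fun u₁ u₂ => thetaProd P.x (P.r - P.k) (P.s / 2) (-(P.s / 2) + 1) u₂ u₁)
      (currentE P 0) (currentE P 1) := by
  have ha : (P.x ^ P.s)⁻¹ = P.x ^ (-2 * (P.s / 2)) := by
    rw [← Real.rpow_neg hx0.le]
    congr 1
    ring
  have he : P.x ^ P.s / P.x ^ 2 = P.x ^ (-2 * (-(P.s / 2) + 1)) := by
    rw [rpow_s_div_sq hx0]
    congr 1
    ring
  -- The bounds `0 < s < 2` place the exponents `-s` and `s - 2` in `[-2, 2]`.
  have hma := moderate_rpow hx0 hx1 ha (by linarith) (by linarith)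
  have hme := moderate_rpow hx0 hx1 he (by linarith) (by linarith)
  obtain ⟨h11, h12, h21, h22⟩ := (exchangeContr_E_ne hx0 hx1 hk hrk.ne').contractionsContinue
    hx0 hx1 hrk ha he hma hme hme (exchangeZeroModes_E_ne hx0 hr hk hrk)
  exact exchangeRelation_of_contractions hx0 (by positivity) (differentiable_exchangeDenom hx0 _ _)
    (exchangeDenom_ne_zero hx0 hx1 hma hme) (currentE_eq hx0 0) (currentE_eq hx0 1)
    (isLinear_eI P 0) (isLinear_eII P 0) (isLinear_eI P 1) (isLinear_eII P 1) h11 h12 h21 h22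

theorem exchangeRelation_F_ne (hs0 : 0 < P.s) (hs2 : P.s < 2) :
    ExchangeRelation P.x (thetaProd P.x P.r (-(P.s / 2)) (P.s / 2 - 1))
      (fun u₁ u₂ => thetaProd P.x P.r (-(P.s / 2)) (P.s / 2 - 1) u₂ u₁)
      (currentF P 0) (currentF P 1) := by
  have ha : P.x ^ P.s = P.x ^ (-2 * (-(P.s / 2))) := by
    congr 1
    ring
  have he : P.x ^ 2 / P.x ^ P.s = P.x ^ (-2 * (P.s / 2 - 1)) := by
    rw [sq_div_rpow_s hx0]
    congr 1
    ring
  have hma := moderate_rpow hx0 hx1 ha (by linarith) (by linarith)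
  have hme := moderate_rpow hx0 hx1 he (by linarith) (by linarith)
  obtain ⟨h11, h12, h21, h22⟩ := (exchangeContr_F_ne hx0 hx1 hk hr.ne').contractionsContinue
    hx0 hx1 hr ha he hma hme hme (exchangeZeroModes_F_ne hx0 hr hk hrk)
  have hg := differentiable_exchangeDenom hx0 ((P.x ^ P.s : ℝ) : ℂ) ((P.x ^ 2 / P.x ^ P.s : ℝ) : ℂ)
  have hg0 := exchangeDenom_ne_zero hx0 hx1 hma hme
  have hg' : Differentiable ℂ fun u : ℂ × ℂ => exchangeDenom P.x ((P.x ^ P.s : ℝ) : ℂ)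
      ((P.x ^ 2 / P.x ^ P.s : ℝ) : ℂ) (u.2, u.1) :=
    hg.comp (differentiable_snd.prodMk differentiable_fst)
  have hg0' : (fun u : ℂ × ℂ => exchangeDenom P.x ((P.x ^ P.s : ℝ) : ℂ)
      ((P.x ^ 2 / P.x ^ P.s : ℝ) : ℂ) (u.2, u.1)) ≠ 0 :=
    fun h => hg0 (funext fun u => congrFun h (u.2, u.1))
  -- The data were computed for `F_2 F_1`. Swapping turns the pair `(V_i, W_j)` into `(W_j, V_i)`,
  -- which is why the two mixed pairs change places below.
  have k11 := ContractionsContinue.swap (L := thetaProd P.x P.r (-(P.s / 2)) (P.s / 2 - 1)) h11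
  have k12 := ContractionsContinue.swap (L := thetaProd P.x P.r (-(P.s / 2)) (P.s / 2 - 1)) h12
  have k21 := ContractionsContinue.swap (L := thetaProd P.x P.r (-(P.s / 2)) (P.s / 2 - 1)) h21
  have k22 := ContractionsContinue.swap (L := thetaProd P.x P.r (-(P.s / 2)) (P.s / 2 - 1)) h22
  exact exchangeRelation_of_contractions hx0 (by positivity) hg' hg0'
    (currentF_eq hx0 0) (currentF_eq hx0 1)
    (isLinear_fI P 0) (isLinear_fII P 0) (isLinear_fI P 1) (isLinear_fII P 1) k11 k21 k12 k22

end

/-! ### The commutator of `E_j` and `F_j` -/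

lemma IsExp.congr {A B : ℕ → ℂ} {E : PowerSeries ℂ} (h : IsExp A E) (hAB : ∀ m, 0 < m → A m = B m) :
    IsExp B E := by
  refine ⟨h.zero, h.eq.trans ?_⟩
  congr 1
  ext m
  rcases Nat.eq_zero_or_pos m with rfl | hm
  · simp
  · simp [hAB m hm]

/-- This is `exp(-log(1 - a w)) = 1/(1 - a w)`: each of the `n` terms in the recursion for the
coefficient of index `n` equals `a^n`. -/
lemma isExp_geom (a : ℂ) : IsExp (fun m => a ^ m / m) (.mk fun m => a ^ m) := by
  refine ⟨by simp, ?_⟩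
  ext n
  rw [coeff_euler, PowerSeries.coeff_mk, PowerSeries.coeff_mul,
    Finset.Nat.sum_antidiagonal_eq_sum_range_succ_mk, Finset.sum_range_succ']
  have h : ∀ i ∈ Finset.range n, PowerSeries.coeff (i + 1) (euler (.mk fun m : ℕ => a ^ m / m)) *
      PowerSeries.coeff (n - (i + 1)) (.mk fun m => a ^ m) = a ^ n := by
    intro i hi
    have hi := Finset.mem_range.mp hi
    rw [coeff_euler, PowerSeries.coeff_mk, PowerSeries.coeff_mk, smul_eq_mul,
      mul_div_cancel₀ _ (Nat.cast_ne_zero.mpr (Nat.succ_ne_zero i)), ← pow_add]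
    congr 1
    omega
  rw [Finset.sum_congr rfl h]
  simp

/-- The coefficients of `(1 - c w) / (1 - a w)`. -/
lemma coeff_of_isExp_sub {a c : ℂ} {E : PowerSeries ℂ}
    (h : IsExp (fun m => (a ^ m - c ^ m) / m) E) (l : ℕ) :
    PowerSeries.coeff (l + 1) E = a ^ (l + 1) - c * a ^ l := by
  -- Multiplying by `1/(1 - c w)` turns `E` into `1/(1 - a w)`; comparing consecutive coefficients
  -- then isolates those of `E`.
  have h1 : E * (.mk fun m => c ^ m) = .mk fun m => a ^ m :=
    ((h.mul (isExp_geom c) fun _ _ => Commute.all _ _).congr fun m _ => by ring).unique (isExp_geom a)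
  have h2 : ∀ n, ∑ i ∈ Finset.range (n + 1), PowerSeries.coeff i E * c ^ (n - i) = a ^ n := by
    intro n
    have := congrArg (PowerSeries.coeff n) h1
    rw [PowerSeries.coeff_mul, Finset.Nat.sum_antidiagonal_eq_sum_range_succ_mk] at this
    simpa only [PowerSeries.coeff_mk] using this
  have h3 := h2 (l + 1)
  rw [Finset.sum_range_succ, Nat.sub_self, pow_zero, mul_one] at h3
  have h4 : ∑ i ∈ Finset.range (l + 1), PowerSeries.coeff i E * c ^ (l + 1 - i) = c * a ^ l := by
    rw [← h2 l, Finset.mul_sum]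
    refine Finset.sum_congr rfl fun i hi => ?_
    have hi := Finset.mem_range.mp hi
    rw [show l + 1 - i = (l - i) + 1 by omega, pow_succ]
    ring
  rw [← h3, h4]
  ring

lemma coeff_con_of_contr {P : Params} {V W : Vertex} {a y : ℝ}
    (h : ∀ m, 0 < m → contr P V W m = (a ^ m - (y * a) ^ m) / m) {l : ℕ} (hl : 0 < l) :
    PowerSeries.coeff l (con P V W) = ((a ^ l * (1 - y) : ℝ) : ℂ) := by
  obtain ⟨l, rfl⟩ : ∃ n, l = n + 1 := ⟨l - 1, by omega⟩
  have h1 : IsExp (fun m => ((a : ℂ) ^ m - ((y * a : ℝ) : ℂ) ^ m) / m) (con P V W) :=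
    (isExp_con P V W).congr fun m hm => by
      rw [h m hm]
      push_cast
      rfl
  rw [coeff_of_isExp_sub h1]
  push_cast
  ring

section

variable {P : Params} (hx0 : 0 < P.x) (hx1 : P.x < 1) (hk : P.k ≠ 0) (j : Fin 2) {m : ℕ}
  (hm : 0 < m)

include hx0

lemma contr_eI_fI_aux : contr P (eI P j) (fI P j) m =
    (1 - P.x ^ (P.k * m) * plusRatio P m) * gammaComm P j j m := by
  rw [contr_join_join (isAlpha_cVertex _ _) (isBetaGamma_psiI _ _) (isAlpha_cDagVertex _ _)
    (isBetaGamma_psiDagI _ _), contr_cVertex_cDagVertex, contr_psiI_psiDagI hx0 j j]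
  ring

lemma contr_eII_fII_aux : contr P (eII P j) (fII P j) m =
    (1 - (P.x ^ (P.k * m))⁻¹ * plusRatio P m) * gammaComm P j j m := by
  rw [contr_join_join (isAlpha_cVertex _ _) (isBetaGamma_psiII _ _) (isAlpha_cDagVertex _ _)
    (isBetaGamma_psiDagII _ _), contr_cVertex_cDagVertex, contr_psiII_psiDagII hx0 j j]
  ring

lemma contr_fI_eI_aux : contr P (fI P j) (eI P j) m =
    (1 - (P.x ^ (P.k * m))⁻¹ * plusRatio P m) * gammaComm P j j m := by
  rw [contr_join_join (isAlpha_cDagVertex _ _) (isBetaGamma_psiDagI _ _) (isAlpha_cVertex _ _)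
    (isBetaGamma_psiI _ _), contr_cDagVertex_cVertex, contr_psiDagI_psiI hx0 j j]
  ring

lemma contr_fII_eII_aux : contr P (fII P j) (eII P j) m =
    (1 - P.x ^ (P.k * m) * plusRatio P m) * gammaComm P j j m := by
  rw [contr_join_join (isAlpha_cDagVertex _ _) (isBetaGamma_psiDagII _ _) (isAlpha_cVertex _ _)
    (isBetaGamma_psiII _ _), contr_cDagVertex_cVertex, contr_psiDagII_psiII hx0 j j]
  ring

lemma contr_eII_fI : contr P (eII P j) (fI P j) m = 0 := by
  rw [contr_join_join (isAlpha_cVertex _ _) (isBetaGamma_psiII _ _) (isAlpha_cDagVertex _ _)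
    (isBetaGamma_psiDagI _ _), contr_cVertex_cDagVertex, contr_psiII_psiDagI hx0 j j]
  ring

lemma contr_fII_eI : contr P (fII P j) (eI P j) m = 0 := by
  rw [contr_join_join (isAlpha_cDagVertex _ _) (isBetaGamma_psiDagII _ _) (isAlpha_cVertex _ _)
    (isBetaGamma_psiI _ _), contr_cDagVertex_cVertex, contr_psiDagII_psiI hx0 j j]
  ring

include hx1 hk hm

lemma contr_eI_fII : contr P (eI P j) (fII P j) m = 0 := by
  rw [contr_join_join (isAlpha_cVertex _ _) (isBetaGamma_psiI _ _) (isAlpha_cDagVertex _ _)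
    (isBetaGamma_psiDagII _ _), contr_cVertex_cDagVertex, contr_psiI_psiDagII hx0 j j hx1 hk hm]
  ring

lemma contr_fI_eII : contr P (fI P j) (eII P j) m = 0 := by
  rw [contr_join_join (isAlpha_cDagVertex _ _) (isBetaGamma_psiDagI _ _) (isAlpha_cVertex _ _)
    (isBetaGamma_psiII _ _), contr_cDagVertex_cVertex, contr_psiDagI_psiII hx0 j j hx1 hk hm]
  ring

/-- Multiplying the second difference in `gammaComm_sub` by `-x^{km}` gives this expression. After
exponentiation the contraction is `(1 - x^{k+2} w)/(1 - x^k w)`. -/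
lemma one_sub_ratio : (1 - P.x ^ (P.k * m) * plusRatio P m) * gammaComm P j j m =
    ((P.x ^ P.k) ^ m - (P.x ^ 2 * P.x ^ P.k) ^ m) / m := by
  have hX : P.x ^ 2 ≠ 0 := by positivity
  have hK : P.x ^ (P.k * m) ≠ 0 := (Real.rpow_pos_of_pos hx0 _).ne'
  have h := (gammaComm_sub hx0 hx1 hk (inv_ne_zero hX) (a := 1) (by rw [inv_inv, mul_one]) hm
    (qCartan_self hx0 hx1 j m)).2
  rw [inv_inv, inv_one, one_pow] at h
  have h2 : P.x ^ (P.k * m) * (P.x ^ (P.k * m))⁻¹ = 1 := mul_inv_cancel₀ hK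
  rw [mul_pow, ← rpow_mul_natCast hx0]
  linear_combination (-P.x ^ (P.k * m)) * h - gammaComm P j j m * h2

lemma one_sub_inv_ratio : (1 - (P.x ^ (P.k * m))⁻¹ * plusRatio P m) * gammaComm P j j m =
    ((P.x ^ (-P.k)) ^ m - ((P.x ^ 2)⁻¹ * P.x ^ (-P.k)) ^ m) / m := by
  have hX : P.x ^ 2 ≠ 0 := by positivity
  have hK : P.x ^ (P.k * m) ≠ 0 := (Real.rpow_pos_of_pos hx0 _).ne'
  have h := (gammaComm_sub hx0 hx1 hk (inv_ne_zero hX) (a := 1) (by rw [inv_inv, mul_one]) hm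
    (qCartan_self hx0 hx1 j m)).1
  rw [one_pow] at h
  have h2 : P.x ^ (P.k * m) * (P.x ^ (P.k * m))⁻¹ = 1 := mul_inv_cancel₀ hK
  rw [mul_pow, ← rpow_mul_natCast hx0 (-P.k), neg_mul, Real.rpow_neg hx0.le]
  linear_combination (-(P.x ^ (P.k * m))⁻¹) * h - gammaComm P j j m * h2

end

lemma contractionsDelta_zero {P : Params} {V W : Vertex} (hVz : V.zExp W.shift = 0)
    (hWz : W.zExp V.shift = 0) (h0 : V.xExp W.shift = W.xExp V.shift)
    (hV : ∀ m, 0 < m → contr P V W m = 0) (hW : ∀ m, 0 < m → contr P W V m = 0) :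
    ContractionsDelta P V W 0 1 where
  left := hVz
  right := hWz
  zero := by rw [h0, sub_self]
  pos l hl := by rw [coeff_con_of_contr_eq_zero hV, if_neg hl.ne', mul_zero, zero_mul]
  neg l hl := by rw [coeff_con_of_contr_eq_zero hW, if_neg hl.ne', mul_zero, zero_mul, neg_zero]

/-- The contraction coefficients are `y^l (1 - c)` in one order and `y^{-l} (1 - c⁻¹)` in the other.
With `B = A c` the zero-mode factors turn `1 - c` and `1 - c⁻¹` into `A - B` and `B - A`, the two
halves of one delta function. -/
lemma contractionsDelta_of_contr {P : Params} {V W : Vertex} {A B y c : ℝ}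
    (hVz : V.zExp W.shift = 0) (hWz : W.zExp V.shift = 0) (hA : P.x ^ V.xExp W.shift = A)
    (hB : P.x ^ W.xExp V.shift = B) (hAB : B = A * c) (hc : c ≠ 0)
    (hV : ∀ m, 0 < m → contr P V W m = (y ^ m - (c * y) ^ m) / m)
    (hW : ∀ m, 0 < m → contr P W V m = (y⁻¹ ^ m - (c⁻¹ * y⁻¹) ^ m) / m) :
    ContractionsDelta P V W ((A - B : ℝ) : ℂ) y where
  left := hVz
  right := hWz
  zero := by rw [hA, hB, Complex.ofReal_sub]
  pos l hl := by
    rw [coeff_con_of_contr hV hl, hA, ← Complex.ofReal_mul, ← Complex.ofReal_mul, zpow_natCast, hAB]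
    congr 1
    ring
  neg l hl := by
    rw [coeff_con_of_contr hW hl, hB, ← Complex.ofReal_mul, ← Complex.ofReal_mul,
      ← Complex.ofReal_neg, zpow_neg, zpow_natCast, hAB, inv_pow]
    congr 1
    field_simp
    ring

section

variable {P : Params} (hx0 : 0 < P.x) (hx1 : P.x < 1) (hr : 0 < P.r) (hk : P.k ≠ 0)
  (hrk : 0 < P.r - P.k) (j : Fin 2)

include hr hk hrk in
lemma zExp_E_F : (eI P j).zExp (fI P j).shift = 0 := by
  rw [zExp_eI_F, zeta_mul_zetaT hr hk hrk, sub_self, mul_zero, neg_zero]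

include hr hk hrk in
lemma zExp_F_E : (fI P j).zExp (eI P j).shift = 0 := by
  rw [zExp_fI_E, zeta_mul_zetaT hr hk hrk, sub_self, mul_zero, neg_zero]

/-- Equal zero-mode factors, together with vanishing contractions, make the mixed terms commute. -/
lemma xExp_mixed : (eI P j).xExp (fII P j).shift = (fII P j).xExp (eI P j).shift ∧
    (eII P j).xExp (fI P j).shift = (fI P j).xExp (eII P j).shift := by
  rw [shift_fII, shift_eII, xExp_eI_F, xExp_eII_F, xExp_fI_E, xExp_fII_E]
  exact ⟨rfl, rfl⟩

include hx0 in
lemma rpow_xExp_lower : P.x ^ (-(eps j * eps j : ℝ) - (2 - P.s) * eps j +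
    if j = j then 0 else 2 - P.s) = P.x ^ (eps j * (P.s - 2)) * P.x⁻¹ := by
  rw [if_pos rfl, ← Int.cast_mul, eps_mul_self, ← Real.rpow_neg_one, ← Real.rpow_add hx0]
  congr 1
  push_cast
  ring

include hx0 in
lemma rpow_xExp_upper : P.x ^ ((eps j * eps j : ℝ) - (2 - P.s) * eps j -
    if j = j then 0 else 2 - P.s) = P.x ^ (eps j * (P.s - 2)) * P.x := by
  rw [if_pos rfl, ← Int.cast_mul, eps_mul_self]
  nth_rw 3 [← Real.rpow_one P.x]
  rw [← Real.rpow_add hx0]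
  congr 1
  push_cast
  ring

include hx0 hx1 hr hk hrk

lemma contractionsDelta_I : ContractionsDelta P (eI P j) (fI P j)
    ((P.x ^ (eps j * (P.s - 2)) * P.x⁻¹ - P.x ^ (eps j * (P.s - 2)) * P.x : ℝ) : ℂ)
    (P.x ^ P.k) := by
  have hx := hx0.ne'
  refine contractionsDelta_of_contr (c := P.x ^ 2) (zExp_E_F hr hk hrk j) (zExp_F_E hr hk hrk j)
    (by rw [xExp_eI_F, rpow_xExp_lower hx0]) (by rw [xExp_fI_E, rpow_xExp_upper hx0])
    (by field_simp) (by positivity)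
    (fun m hm => by rw [contr_eI_fI_aux hx0, one_sub_ratio hx0 hx1 hk j hm]) fun m hm => ?_
  rw [contr_fI_eI_aux hx0, one_sub_inv_ratio hx0 hx1 hk j hm, Real.rpow_neg hx0.le]

lemma contractionsDelta_II : ContractionsDelta P (eII P j) (fII P j)
    ((P.x ^ (eps j * (P.s - 2)) * P.x - P.x ^ (eps j * (P.s - 2)) * P.x⁻¹ : ℝ) : ℂ)
    (P.x ^ (-P.k)) := by
  have hx := hx0.ne'
  refine contractionsDelta_of_contr (c := (P.x ^ 2)⁻¹) (zExp_E_F hr hk hrk j)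
    (zExp_F_E hr hk hrk j) (by rw [shift_fII, xExp_eII_F, rpow_xExp_upper hx0])
    (by rw [shift_eII, xExp_fII_E, rpow_xExp_lower hx0])
    (by field_simp) (by positivity)
    (fun m hm => by rw [contr_eII_fII_aux hx0, one_sub_inv_ratio hx0 hx1 hk j hm]) fun m hm => ?_
  rw [contr_fII_eII_aux hx0, one_sub_ratio hx0 hx1 hk j hm, inv_inv, Real.rpow_neg hx0.le, inv_inv]

theorem commutator_E_F (c d : ℂ) (v : Fock) :
    currentE P j c (currentF P j d v) - currentF P j d (currentE P j c v) =
      ((P.x ^ (eps j * (P.s - 2)) / (P.x - P.x⁻¹) : ℝ) : ℂ) •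
        (mulDelta (normalI P j) (P.x ^ P.k) c d v -
          mulDelta (normalII P j) (P.x ^ (-P.k)) c d v) := by
  have h11 := (contractionsDelta_I hx0 hx1 hr hk hrk j).commutator hx0 (isLinear_eI P j)
    (isLinear_fI P j) c d v
  have h22 := (contractionsDelta_II hx0 hx1 hr hk hrk j).commutator hx0 (isLinear_eII P j)
    (isLinear_fII P j) c d v
  have h12 := (contractionsDelta_zero (V := eI P j) (W := fII P j) (zExp_E_F hr hk hrk j) (zExp_F_E hr hk hrk j)
    (xExp_mixed j).1 (fun m hm => contr_eI_fII hx0 hx1 hk j hm)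
    fun m _ => contr_fII_eI hx0 j).commutator hx0 (isLinear_eI P j) (isLinear_fII P j) c d v
  have h21 := (contractionsDelta_zero (V := eII P j) (W := fI P j) (zExp_E_F hr hk hrk j) (zExp_F_E hr hk hrk j)
    (xExp_mixed j).2 (fun m _ => contr_eII_fI hx0 j)
    fun m hm => contr_fI_eII hx0 hx1 hk j hm).commutator hx0 (isLinear_eII P j) (isLinear_fI P j) c d v
  rw [zero_smul, sub_eq_zero] at h12 h21
  have hd : ((P.x - P.x⁻¹ : ℝ) : ℂ) ≠ 0 := by exact_mod_cast x_sub_inv_ne_zero hx0 hx1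
  rw [normalI, normalII]
  generalize mulDelta (Vertex.normalOrdered P (eI P j) (fI P j)) (P.x ^ P.k) c d v = NI at h11 ⊢
  generalize mulDelta (Vertex.normalOrdered P (eII P j) (fII P j)) (P.x ^ (-P.k)) c d v = NII
    at h22 ⊢
  rw [currentF_eq hx0, currentE_eq hx0, currentE_eq hx0, currentF_eq hx0]
  rw [map_smul, map_smul, map_smul, map_smul, map_sub, map_sub, map_sub, map_sub, h12, h21]
  generalize (eI P j).toLin P c ((fI P j).toLin P d v) = X₁ at *
  generalize (fI P j).toLin P d ((eI P j).toLin P c v) = Y₁ at *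
  generalize (eII P j).toLin P c ((fII P j).toLin P d v) = X₂ at *
  generalize (fII P j).toLin P d ((eII P j).toLin P c v) = Y₂ at *
  generalize (fII P j).toLin P d ((eI P j).toLin P c v) = Y₁₂ at *
  generalize (fI P j).toLin P d ((eII P j).toLin P c v) = Y₂₁ at *
  -- The normalisations of `E_j` and `F_j` give `-(x - x⁻¹)⁻²`. The strength of the delta function
  -- for I–I contains `x⁻¹ - x`, which cancels one power and the sign; for II–II the sign is
  -- opposite.
  have e1 : -(1 / ((P.x - P.x⁻¹ : ℝ) : ℂ) * (1 / ((P.x - P.x⁻¹ : ℝ) : ℂ))) • (X₁ - Y₁) =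
      ((P.x ^ (eps j * (P.s - 2)) / (P.x - P.x⁻¹) : ℝ) : ℂ) • NI := by
    rw [h11, smul_smul, ← mul_sub, ← neg_sub P.x P.x⁻¹, mul_neg]
    congr 1
    rw [Complex.ofReal_neg, Complex.ofReal_mul, Complex.ofReal_div]
    field_simp
  have e2 : -(1 / ((P.x - P.x⁻¹ : ℝ) : ℂ) * (1 / ((P.x - P.x⁻¹ : ℝ) : ℂ))) • (X₂ - Y₂) =
      -((P.x ^ (eps j * (P.s - 2)) / (P.x - P.x⁻¹) : ℝ) : ℂ) • NII := by
    rw [h22, smul_smul, ← mul_sub]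
    congr 1
    rw [Complex.ofReal_mul, Complex.ofReal_div]
    field_simp
  have e3 : ((P.x ^ (eps j * (P.s - 2)) / (P.x - P.x⁻¹) : ℝ) : ℂ) • (NI - NII) =
      -(1 / ((P.x - P.x⁻¹ : ℝ) : ℂ) * (1 / ((P.x - P.x⁻¹ : ℝ) : ℂ))) • (X₁ - Y₁) +
        -(1 / ((P.x - P.x⁻¹ : ℝ) : ℂ) * (1 / ((P.x - P.x⁻¹ : ℝ) : ℂ))) • (X₂ - Y₂) := by
    rw [e1, e2, smul_sub, sub_eq_add_neg, neg_smul]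
  rw [e3]
  module

end

end LevelK

end

theorem mainTheorem12 (P : Params) (hx0 : 0 < P.x) (hx1 : P.x < 1) (hr : 0 < P.r)
    (hk : P.k ≠ 0) (hrk : 0 < P.r - P.k) (hs0 : 0 < P.s) (hs2 : P.s < 2) :
    -- `E_j E_j`
    (∀ j : Fin 2, ExchangeRelation P.x
      (fun u₁ u₂ => theta P.x (P.r - P.k) (u₁ - u₂) * theta P.x (P.r - P.k) (u₁ - u₂ - 1))
      (fun u₁ u₂ => theta P.x (P.r - P.k) (u₂ - u₁) * theta P.x (P.r - P.k) (u₂ - u₁ - 1))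
      (currentE P j) (currentE P j)) ∧
    -- `E_1 E_2`
    ExchangeRelation P.x
      (fun u₁ u₂ => theta P.x (P.r - P.k) (u₁ - u₂ + P.s / 2) *
        theta P.x (P.r - P.k) (u₁ - u₂ - P.s / 2 + 1))
      (fun u₁ u₂ => theta P.x (P.r - P.k) (u₂ - u₁ + P.s / 2) *
        theta P.x (P.r - P.k) (u₂ - u₁ - P.s / 2 + 1))
      (currentE P 0) (currentE P 1) ∧
    -- `F_j F_j`
    (∀ j : Fin 2, ExchangeRelation P.x
      (fun u₁ u₂ => theta P.x P.r (u₁ - u₂) * theta P.x P.r (u₁ - u₂ + 1))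
      (fun u₁ u₂ => theta P.x P.r (u₂ - u₁) * theta P.x P.r (u₂ - u₁ + 1))
      (currentF P j) (currentF P j)) ∧
    -- `F_1 F_2`
    ExchangeRelation P.x
      (fun u₁ u₂ => theta P.x P.r (u₁ - u₂ - P.s / 2) *
        theta P.x P.r (u₁ - u₂ + P.s / 2 - 1))
      (fun u₁ u₂ => theta P.x P.r (u₂ - u₁ - P.s / 2) *
        theta P.x P.r (u₂ - u₁ + P.s / 2 - 1))
      (currentF P 0) (currentF P 1) ∧
    -- `[E_j, F_j]`, coefficient of `z₁^c z₂^d`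
    (∀ (j : Fin 2) (c d : ℂ) (v : Fock),
      currentE P j c (currentF P j d v) - currentF P j d (currentE P j c v) =
        ((P.x ^ (eps j * (P.s - 2)) / (P.x - P.x⁻¹) : ℝ) : ℂ) •
          (mulDelta (normalI P j) (P.x ^ P.k) c d v -
            mulDelta (normalII P j) (P.x ^ (-P.k)) c d v)) := by
  refine ⟨fun j => ?_, ?_, fun j => ?_, ?_, commutator_E_F hx0 hx1 hr hk hrk⟩
  -- What remains is to bring the theta arguments to the form `u₁ - u₂ + p` with real `p`.
  · convert exchangeRelation_E_self hx0 hx1 hr hk hrk j using 3 <;> simp [thetaProd, sub_eq_add_neg]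
  · convert exchangeRelation_E_ne hx0 hx1 hr hk hrk hs0 hs2 using 3 <;>
      simp [thetaProd, sub_eq_add_neg, add_assoc]
  · convert exchangeRelation_F_self hx0 hx1 hr hk hrk j using 3 <;> simp [thetaProd]
  · convert exchangeRelation_F_ne hx0 hx1 hr hk hrk hs0 hs2 using 3 <;>
      simp [thetaProd, sub_eq_add_neg, add_assoc]
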